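/- Conventions. All objects are smooth. Let $f\colon M^2\to\mathbb{R}^N$ be an immersion of a 2-manifold, with the induced metric, second fundamental form $\alpha_f$ and shape operators $A_\xi$. The normal bundle is flat if the curvature of the normal connection vanishes; $p$ is umbilic if there is a vector $H$ with $\alpha_f(X,Y)=\langle X,Y\rangle H$ for all $X,Y\in T_pM$; a principal direction is a common eigenvector of all $A_\xi$; a curvature line is a curve that is everywhere tangent to a principal direction. If the normal bundle is flat and there are no umbilics, there are exactly two orthogonal families of curvature lines. A local isothermic parametrization by curvature lines is a diffeomorphism $\psi\colon J_1\times J_2\to U$ from a product of two open intervals onto an open set $U\subset M^2$ such that $(f\circ\psi)^*\langle\,,\,\rangle=\varphi^2(ds^2+dt^2)$ with $\varphi>0$ and the coordinate curves of $\psi$ are curvature lines of $f$ (the order of the two families is free). An inversion in $\mathbb{R}^N$ is the inversion in a sphere of some radius $r>0$ or, hyperplanes being counted as spheres, the reflection in a hyperplane. For $c>0$, let $\mathbb{L}^{n}$ denote $n$-dimensional Minkowski space, of signature $(+,\dots,+,-)$, let $\mathbb{H}^m(-c)\subset\mathbb{L}^{m+1}$ be the sheet $\{X:\langle X,X\rangle=-1/c,\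 x_{m+1}>0\}$, and let $\mathbb{S}^{k}(c)=\{Y\in\mathbb{R}^{k+1}:\langle Y,Y\rangle=1/c\}$. Let $1\le m\le N-1$, let $\mathbb{L}^{N+2}=V\oplus W$ be an orthogonal decomposition with $V$ time-like, and let $C\colon\mathbb{L}^{m+1}\to V$ and $D\colon\mathbb{R}^{N-m+1}\to W$ be linear isometries. Let $p_0,w\in\mathbb{L}^{N+2}$ be light-like with $\langle p_0,w\rangle=1$, let $A\colon\mathbb{R}^N\to\mathrm{span}\{p_0,w\}^\perp$ be a linear isometry, and let $\Psi(x)=p_0+A(x)-\tfrac12\|x\|^2w$, an isometry of $\mathbb{R}^N$ onto $\{q:\langle q,q\rangle=0,\ \langle q,w\rangle=1\}$. These data define the conformal diffeomorphism $\Theta\colon\mathbb{H}^m(-c)\times\mathbb{S}^{N-m}(c)\to\mathbb{R}^N$ (onto the complement of an $(m-1)$-dimensional sphere) $$\Theta(X,Y)=\Psi^{-1}\!\left(\frac{C(X)+D(Y)}{\langle C(X)+D(Y),w\rangle}\right),$$ which is defined at every point with $C(X)+D(Y)\notin\mathbb{R}w$. Statement. Let $f\colon M^2\to\mathbb{R}^N$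 be a surface (an immersion of a 2-manifold) with flat normal bundle and without umbilic points, and assume that each curvature line, of both families, has constant geodesic curvature in $M^2$ (the constant may depend on the line). Then for every $p\in M^2$ at least one of the following holds: (i) There exist a local isothermic parametrization by curvature lines $\psi\colon J_1\times J_2\to M^2$ of a neighbourhood of $p$, an isometry $\Phi\colon\mathbb{R}^{N_1}\times\mathbb{R}^{N_2}\to\mathbb{R}^N$, unit speed curves $\alpha\colon J_1\to\mathbb{R}^{N_1}$ and $\beta\colon J_2\to\mathbb{R}^{N_2}$, and an inversion $I$ in $\mathbb{R}^N$ whose centre (if it is an inversion in a sphere) does not lie on the image of $\Phi\circ(\alpha\times\beta)$, such that $f\circ\psi=I\circ\Phi\circ(\alpha\times\beta)$. (ii) There exist a local isothermic parametrization by curvature lines $\psi\colon J_1\times J_2\to M^2$ of a neighbourhood of $p$, numbers $c>0$ and $1\le m\le N-1$, unit speed curves $\alpha\colon J_1\to\mathbb{H}^{m}(-c)$ and $\beta\colon J_2\to\mathbb{S}^{N-m}(c)$, and a conformal diffeomorphism $\Theta$ as above, defined on the image of $\alpha\times\beta$, such that $f\circ\psi=\Theta\circ(\alpha\times\beta)$.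 -/

import Mathlib

open scoped Manifold ContDiff

namespace Isothermic

noncomputable section

/-- Euclidean space `ℝ^n`. -/
abbrev E (n : ℕ) := EuclideanSpace ℝ (Fin n)

/-! ### Geometry of an immersed surface `f : M² → ℝ^N` -/

section Patch

variable {N : ℕ}

/-- Orthogonal projection of `ℝ^N` onto the tangent plane of the patch `F` at `x`. -/
def tangentProj (F : E 2 → E N) (x : E 2) (v : E N) : E N :=
  (LinearMap.range (fderiv ℝ F x).toLinearMap).starProjection v

/-- Orthogonal projection of `ℝ^N` onto the normal space of the patch `F` at `x`. -/
def normalProj (F : E 2 → E N) (x : E 2) (v : E N) : E N :=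
  (LinearMap.range (fderiv ℝ F x).toLinearMap)ᗮ.starProjection v

/-- `ξ` is a smooth normal vector field of the patch `F` on the open set `V`. -/
def IsNormalField (F : E 2 → E N) (V : Set (E 2)) (ξ : E 2 → E N) : Prop :=
  ContDiffOn ℝ ∞ ξ V ∧ ∀ x ∈ V, ∀ u : E 2, inner ℝ (fderiv ℝ F x u) (ξ x) = 0

/-- The normal connection: `∇^⊥_u ξ` for the constant coordinate field `u`. -/
def normalDeriv (F : E 2 → E N) (ξ : E 2 → E N) (u : E 2) (x : E 2) : E N :=
  normalProj F x (fderiv ℝ ξ x u)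

/-- The curvature of the normal connection of the patch `F` vanishes on `U`:
`∇^⊥_u ∇^⊥_v ξ = ∇^⊥_v ∇^⊥_u ξ` for (commuting) constant coordinate fields `u`, `v` and all local
normal fields `ξ`. -/
def PatchFlatNormal (F : E 2 → E N) (U : Set (E 2)) : Prop :=
  ∀ V ⊆ U, IsOpen V → ∀ ξ : E 2 → E N, IsNormalField F V ξ → ∀ u v : E 2, ∀ x ∈ V,
    normalDeriv F (normalDeriv F ξ v) u x = normalDeriv F (normalDeriv F ξ u) v x

end Patch

section Surface

variable {N : ℕ} {M : Type*} [TopologicalSpace M] [ChartedSpace (E 2) M]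

/-- The expression of `f` in the preferred chart at `p`. -/
def localRep (f : M → E N) (p : M) : E 2 → E N := f ∘ (extChartAt (𝓡 2) p).symm

/-- The differential of `f` at `p`. -/
def diff (f : M → E N) (p : M) : TangentSpace (𝓡 2) p →L[ℝ] E N :=
  mfderiv (𝓡 2) 𝓘(ℝ, E N) f p

/-- `f` is a smooth immersion. -/
def IsSmoothImmersion (f : M → E N) : Prop :=
  ContMDiff (𝓡 2) 𝓘(ℝ, E N) ∞ f ∧ ∀ p, Function.Injective (diff f p)

/-- The metric induced by `f`. -/
def metric (f : M → E N) (p : M) (X Y : TangentSpace (𝓡 2) p) : ℝ :=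
  inner ℝ (diff f p X) (diff f p Y)

/-- The second fundamental form of `f` at `p`: the normal component of the second derivative of `f`
in the chart at `p`, the chart through which Mathlib identifies `T_p M` with `ℝ²`. -/
def sff (f : M → E N) (p : M) (X Y : TangentSpace (𝓡 2) p) : E N :=
  normalProj (localRep f p) (extChartAt (𝓡 2) p p)
    (fderiv ℝ (fderiv ℝ (localRep f p)) (extChartAt (𝓡 2) p p) X Y)

/-- The normal bundle of `f` is flat. -/
def HasFlatNormalBundle (f : M → E N) : Prop :=
  ∀ p : M, PatchFlatNormal (localRep f p) (extChartAt (𝓡 2) p).target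

/-- `p` is an umbilic point of `f`. -/
def IsUmbilic (f : M → E N) (p : M) : Prop :=
  ∃ H : E N, ∀ X Y : TangentSpace (𝓡 2) p, sff f p X Y = metric f p X Y • H

/-- `X` is a principal direction of `f` at `p`: an eigenvector of all shape operators `A_ξ`, where
`⟨A_ξ X, Y⟩ = ⟨α(X, Y), ξ⟩`. -/
def IsPrincipal (f : M → E N) (p : M) (X : TangentSpace (𝓡 2) p) : Prop :=
  X ≠ 0 ∧ ∀ ξ : E N, (∀ Z, inner ℝ (diff f p Z) ξ = 0) →
    ∃ l : ℝ, ∀ Y, inner ℝ (sff f p X Y) ξ = l * metric f p X Y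

/-- The velocity of a curve in `M`. -/
def velocity (γ : ℝ → M) (t : ℝ) : TangentSpace (𝓡 2) (γ t) :=
  mfderiv 𝓘(ℝ, ℝ) (𝓡 2) γ t (1 : ℝ)

/-- `γ`, on the open interval `J`, is a curvature line of `f` parametrized by arc length. -/
def IsCurvatureLine (f : M → E N) (γ : ℝ → M) (J : Set ℝ) : Prop :=
  IsOpen J ∧ J.OrdConnected ∧ ContMDiffOn 𝓘(ℝ, ℝ) (𝓡 2) ∞ γ J ∧
    ∀ t ∈ J, ‖diff f (γ t) (velocity γ t)‖ = 1 ∧ IsPrincipal f (γ t) (velocity γ t)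

/-- The (absolute) geodesic curvature of a curve `γ` of unit speed: the length of
`∇_{γ'} γ'`, whose image under `df` is the tangential part of `(f ∘ γ)''`. On an interval this is
constant if and only if the signed geodesic curvature is, the latter being continuous. -/
def geodesicCurvature (f : M → E N) (γ : ℝ → M) (t : ℝ) : ℝ :=
  ‖tangentProj (localRep f (γ t)) (extChartAt (𝓡 2) (γ t) (γ t)) (deriv (deriv (f ∘ γ)) t)‖

/-- The curvature lines of `f`, of both families, have constant geodesic curvature (the constant may
vary from line to line). -/
def CurvatureLinesHaveConstantGeodesicCurvature (f : M → E N) : Prop :=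
  ∀ (γ : ℝ → M) (J : Set ℝ), IsCurvatureLine f γ J →
    ∀ s ∈ J, ∀ t ∈ J, geodesicCurvature f γ s = geodesicCurvature f γ t

/-- The coordinate vectors `∂_s` and `∂_t` of a parametrization of (a part of) `M`. -/
def coordVec (ψ : ℝ × ℝ → M) (z : ℝ × ℝ) (e : ℝ × ℝ) : TangentSpace (𝓡 2) (ψ z) :=
  mfderiv 𝓘(ℝ, ℝ × ℝ) (𝓡 2) ψ z e

/-- `ψ` is an isothermic parametrization by curvature lines, with domain the product `J₁ × J₂` of
two open intervals, of an open neighbourhood of `p`: a diffeomorphism onto this neighbourhood,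
conformal for the flat metric `ds² + dt²`, whose coordinate curves are curvature lines. -/
def IsIsothermicAt (f : M → E N) (p : M) (J₁ J₂ : Set ℝ)
    (ψ : PartialDiffeomorph 𝓘(ℝ, ℝ × ℝ) (𝓡 2) (ℝ × ℝ) M ∞) : Prop :=
  IsOpen J₁ ∧ J₁.OrdConnected ∧ IsOpen J₂ ∧ J₂.OrdConnected ∧
    ψ.source = J₁ ×ˢ J₂ ∧ p ∈ ψ.target ∧
    ∀ z ∈ J₁ ×ˢ J₂,
      (∃ φ : ℝ, 0 < φ ∧
        metric f (ψ z) (coordVec ψ z (1, 0)) (coordVec ψ z (1, 0)) = φ ^ 2 ∧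
        metric f (ψ z) (coordVec ψ z (0, 1)) (coordVec ψ z (0, 1)) = φ ^ 2 ∧
        metric f (ψ z) (coordVec ψ z (1, 0)) (coordVec ψ z (0, 1)) = 0) ∧
      IsPrincipal f (ψ z) (coordVec ψ z (1, 0)) ∧ IsPrincipal f (ψ z) (coordVec ψ z (0, 1))

end Surface

/-! ### Curves, inversions -/

/-- `α` is a smooth curve of unit speed in `ℝ^n` on the open interval `J`. -/
def IsUnitSpeed {n : ℕ} (α : ℝ → E n) (J : Set ℝ) : Prop :=
  ContDiffOn ℝ ∞ α J ∧ ∀ s ∈ J, ‖deriv α s‖ = 1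

/-- `I` is the inversion in a hypersphere of `ℝ^N` and is defined on `D`, that is, `D` does not
contain the centre. Hyperplanes count as hyperspheres; the inversion in one is the reflection. -/
def IsInversionOn {N : ℕ} (I : E N → E N) (D : Set (E N)) : Prop :=
  (∃ (q : E N) (r : ℝ), 0 < r ∧ q ∉ D ∧ I = EuclideanGeometry.inversion q r) ∨
    ∃ q v : E N, ‖v‖ = 1 ∧ I = fun x => x - (2 * inner ℝ v (x - q)) • v

/-! ### The light cone model and the conformal diffeomorphisms `ℍ^m(-c) × 𝕊^k(c) → ℝ^(m+k)` -/

/-- Minkowski space `𝕃^(n+1)` of dimension `n + 1`. -/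
abbrev L (n : ℕ) := E n × ℝ

/-- The Lorentz scalar product, of signature `(+, …, +, -)`. -/
def lor {n : ℕ} (X Y : L n) : ℝ := inner ℝ X.1 Y.1 - X.2 * Y.2

/-- Hyperbolic space `ℍ^m(-c)` (for `m = 1`, a branch of a hyperbola) in `𝕃^(m+1)`. -/
def hyp (m : ℕ) (c : ℝ) : Set (L m) := {X | lor X X = -1 / c ∧ 0 < X.2}

/-- The sphere `𝕊^k(c)` in `ℝ^(k+1)`. -/
def sph (k : ℕ) (c : ℝ) : Set (E (k + 1)) := {Y | inner ℝ Y Y = 1 / c}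

/-- `α` is a smooth curve of unit speed in `ℍ^m(-c)` on the open interval `J`. -/
def IsUnitSpeedHyp {m : ℕ} (c : ℝ) (α : ℝ → L m) (J : Set ℝ) : Prop :=
  ContDiffOn ℝ ∞ α J ∧ ∀ s ∈ J, α s ∈ hyp m c ∧ lor (deriv α s) (deriv α s) = 1

/-- `β` is a smooth curve of unit speed in `𝕊^k(c)` on the open interval `J`. -/
def IsUnitSpeedSph {k : ℕ} (c : ℝ) (β : ℝ → E (k + 1)) (J : Set ℝ) : Prop :=
  IsUnitSpeed β J ∧ ∀ t ∈ J, β t ∈ sph k c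

/-- A triple `(p₀, w, A)` that represents `ℝ^N` as the section `⟨p, w⟩ = 1` of the light cone of
`𝕃^(N+2)`: `w`, `p₀` are light-like with `⟨p₀, w⟩ = 1`, and `A` is a linear isometry of `ℝ^N` onto
`span {p₀, w}^⊥`. -/
structure Triple (N : ℕ) where
  p₀ : L (N + 1)
  w : L (N + 1)
  A : E N →ₗ[ℝ] L (N + 1)
  lor_p₀ : lor p₀ p₀ = 0
  lor_w : lor w w = 0
  lor_p₀_w : lor p₀ w = 1
  lor_A : ∀ x y, lor (A x) (A y) = inner ℝ x y
  lor_A_p₀ : ∀ x, lor (A x) p₀ = 0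
  lor_A_w : ∀ x, lor (A x) w = 0

/-- The isometry `Ψ` of `ℝ^N` onto `{p | ⟨p, p⟩ = 0, ⟨p, w⟩ = 1}`. -/
def Triple.Psi {N : ℕ} (T : Triple N) (x : E N) : L (N + 1) :=
  T.p₀ + T.A x - ((1 / 2 : ℝ) * ‖x‖ ^ 2) • T.w

/-- The projection `q ↦ Ψ⁻¹ (q / ⟨q, w⟩)` of the light cone onto `ℝ^N`, meaningful for light-like
`q` with `⟨q, w⟩ ≠ 0`, that is, for `q` outside the line of `w`. -/
def Triple.toEuclidean {N : ℕ} (T : Triple N) (q : L (N + 1)) : E N :=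
  Function.invFun T.Psi ((lor q T.w)⁻¹ • q)

/-- Linear isometries `C : 𝕃^(m+1) → V` and `D : ℝ^(k+1) → W`, where `𝕃^(N+2) = V ⊕ W` is an
orthogonal decomposition with `V` time-like and `N = m + k`. -/
structure Splitting (m k N : ℕ) where
  dim : m + k = N
  C : L m →ₗ[ℝ] L (N + 1)
  D : E (k + 1) →ₗ[ℝ] L (N + 1)
  lor_C : ∀ X X', lor (C X) (C X') = lor X X'
  lor_D : ∀ Y Y', lor (D Y) (D Y') = inner ℝ Y Y'
  lor_C_D : ∀ X Y, lor (C X) (D Y) = 0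

/-- The map `(X, Y) ↦ C X + D Y`, which takes `ℍ^m(-c) × 𝕊^k(c)` isometrically into the light
cone. -/
def Splitting.toCone {m k N : ℕ} (S : Splitting m k N) (z : L m × E (k + 1)) : L (N + 1) :=
  S.C z.1 + S.D z.2

/-- The conformal diffeomorphism `Θ : ℍ^m(-c) × 𝕊^k(c) → ℝ^N` onto the complement of an
`(m-1)`-dimensional sphere. It is defined where `C X + D Y` is not a multiple of `w`. -/
def Theta {m k N : ℕ} (T : Triple N) (S : Splitting m k N) (z : L m × E (k + 1)) : E N :=
  T.toEuclidean (S.toCone z)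

/-! ### The two cases -/

section Cases

variable {N : ℕ} {M : Type*} [TopologicalSpace M] [ChartedSpace (E 2) M]

/-- Near `p`, in isothermic curvature line coordinates, `f` is `I ∘ Φ ∘ (α × β)` with `I` an
inversion, `Φ : ℝ^N₁ × ℝ^N₂ → ℝ^N` an isometry and `α`, `β` curves of unit speed. -/
def IsInvertedProductAt (f : M → E N) (p : M) : Prop :=
  ∃ (J₁ J₂ : Set ℝ) (ψ : PartialDiffeomorph 𝓘(ℝ, ℝ × ℝ) (𝓡 2) (ℝ × ℝ) M ∞),
    IsIsothermicAt f p J₁ J₂ ψ ∧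
    ∃ (N₁ N₂ : ℕ) (Φ : WithLp 2 (E N₁ × E N₂) ≃ᵢ E N) (I : E N → E N)
      (α : ℝ → E N₁) (β : ℝ → E N₂),
      IsUnitSpeed α J₁ ∧ IsUnitSpeed β J₂ ∧
      IsInversionOn I {x | ∃ s ∈ J₁, ∃ t ∈ J₂, x = Φ (WithLp.toLp 2 (α s, β t))} ∧
      ∀ s ∈ J₁, ∀ t ∈ J₂, f (ψ (s, t)) = I (Φ (WithLp.toLp 2 (α s, β t)))

/-- Near `p`, in isothermic curvature line coordinates, `f` is `Θ ∘ (α × β)` with `α` and `β` curves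
of unit speed in `ℍ^m(-c)` and `𝕊^(N-m)(c)`. -/
def IsHypSphProductAt (f : M → E N) (p : M) : Prop :=
  ∃ (J₁ J₂ : Set ℝ) (ψ : PartialDiffeomorph 𝓘(ℝ, ℝ × ℝ) (𝓡 2) (ℝ × ℝ) M ∞),
    IsIsothermicAt f p J₁ J₂ ψ ∧
    ∃ (m k : ℕ) (c : ℝ) (T : Triple N) (S : Splitting m k N) (α : ℝ → L m) (β : ℝ → E (k + 1)),
      1 ≤ m ∧ 1 ≤ k ∧ 0 < c ∧
      IsUnitSpeedHyp c α J₁ ∧ IsUnitSpeedSph c β J₂ ∧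
      ∀ s ∈ J₁, ∀ t ∈ J₂, lor (S.toCone (α s, β t)) T.w ≠ 0 ∧
        f (ψ (s, t)) = Theta T S (α s, β t)

end Cases

end

end Isothermic

namespace Isothermic

noncomputable section

open Set Filter Topology

/-! ### Orthonormal frames of a patch, the normal connection and the Ricci equation. -/

section Frames

variable {N : ℕ}

/-! Near a non-umbilic point the Ricci equation makes the shape operators commute, and rotating an
arbitrary orthonormal frame gives a smooth orthonormal frame `X`, `Y` of principal directions
(`exists_isPrincipalFrame`). Let k₁, k₂ be the signed geodesic curvatures of the integral curves of
`X` and of `Y`. The hypothesis says X k₁ = 0 and Y k₂ = 0. With the dual frame ω₁, ω₂, this makes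
k₂ω₁ + k₁ω₂ closed, hence equal to d log ρ; then ρω₁ and ρω₂ are closed too, and their primitives s,
t are isothermic curvature line coordinates with metric ρ⁻²(ds² + dt²) (`exists_isIsothermicChart`).

The decisive fact is that ρ, ρF and ρ‖F‖² are all sums of a function of s and a function of t
(`isSplitNet`). Their t-derivatives are k₁, k₁F + F_*Y and k₁‖F‖² + 2⟨F, F_*Y⟩, and each is constant
in s because X k₁ = 0 and D_X(F_*Y) = -k₁ F_*X; the latter holds since the second fundamental form
vanishes on (X, Y).

Put ℝ^N into the light cone by Ψ. The lift ρΨ(f) is linear in the three functions above, so it has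
the form F₀ + p(s) + q(t) (`splits_lift`), and it is flat: p and q have unit speed
(`lor_fderiv_lift`). Light-likeness at the corners of coordinate rectangles forces p ⟂ q
(`lor_lift_sub`). The classification is now linear algebra in Minkowski space (`classification`). If
the span of q, or that of p, is space-like, splitting F₀ along it yields a curve in a sphere and a
curve in a hyperbolic space (`exists_hyp_sph`). Otherwise both spans contain nonzero causal vectors;
these are orthogonal, hence proportional and light-like, and they give a light-like ν with ⟨ρΨ(f),
ν⟩ constant. If ν is a multiple of w, then ρ is constant and f itself is a product of curves.
Otherwise ν is a multiple of some Ψ(y), so ρ‖f - y‖² is constant, and the inversion centred at y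
takes f to a product (`isInvertedProduct_of_null`). -/

theorem two_le_infty : (2 : WithTop ℕ∞) ≤ ∞ :=
  WithTop.coe_le_coe.2 (le_top : (2 : ℕ∞) ≤ ⊤)

theorem fderiv_real_inner {G : Type*} [NormedAddCommGroup G] [NormedSpace ℝ G] {a b : G → E N}
    {x : G} (ha : DifferentiableAt ℝ a x) (hb : DifferentiableAt ℝ b x) (v : G) :
    fderiv ℝ (fun y => inner ℝ (a y) (b y)) x v
      = inner ℝ (a x) (fderiv ℝ b x v) + inner ℝ (fderiv ℝ a x v) (b x) :=
  fderiv_inner_apply ℝ ha hb v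

/-- The image `dF(X)` of a vector field `X` under the differential of the patch `F`. -/
def push (F : E 2 → E N) (X : E 2 → E 2) (x : E 2) : E N := fderiv ℝ F x (X x)

/-- `X`, `Y` are smooth vector fields on the open set `V`, orthonormal for the metric induced by the
smooth map `F`. -/
structure IsFrame (F : E 2 → E N) (V : Set (E 2)) (X Y : E 2 → E 2) : Prop where
  isOpen : IsOpen V
  smooth : ContDiffOn ℝ ∞ F V
  smooth_fst : ContDiffOn ℝ ∞ X V
  smooth_snd : ContDiffOn ℝ ∞ Y V
  inner_fst : ∀ x ∈ V, inner ℝ (push F X x) (push F X x) = 1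
  inner_snd : ∀ x ∈ V, inner ℝ (push F Y x) (push F Y x) = 1
  inner_fst_snd : ∀ x ∈ V, inner ℝ (push F X x) (push F Y x) = 0

namespace IsFrame

variable {F : E 2 → E N} {V : Set (E 2)} {X Y : E 2 → E 2} {x : E 2}

theorem mono (h : IsFrame F V X Y) {V' : Set (E 2)} (hV' : IsOpen V') (hs : V' ⊆ V) :
    IsFrame F V' X Y :=
  ⟨hV', h.smooth.mono hs, h.smooth_fst.mono hs, h.smooth_snd.mono hs,
    fun x hx => h.inner_fst x (hs hx), fun x hx => h.inner_snd x (hs hx),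
    fun x hx => h.inner_fst_snd x (hs hx)⟩

theorem inner_snd_fst (h : IsFrame F V X Y) (hx : x ∈ V) :
    inner ℝ (push F Y x) (push F X x) = 0 := by
  rw [real_inner_comm]; exact h.inner_fst_snd x hx

/-- Orthonormality for the induced metric forces linear independence in ℝ², so (bi)linear identities
need only be checked on the frame. -/
theorem decomp (h : IsFrame F V X Y) (hx : x ∈ V) (v : E 2) :
    v = inner ℝ (fderiv ℝ F x v) (push F X x) • X x
      + inner ℝ (fderiv ℝ F x v) (push F Y x) • Y x := by
  have h11 := h.inner_fst x hx
  have h22 := h.inner_snd x hx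
  have h12 := h.inner_fst_snd x hx
  have h21 := h.inner_snd_fst hx
  have hli : LinearIndependent ℝ ![X x, Y x] := by
    rw [LinearIndependent.pair_iff]
    intro s t hst
    have e : s • push F X x + t • push F Y x = 0 := by
      have := congrArg (fderiv ℝ F x) hst
      simpa [push] using this
    constructor
    · have := congrArg (fun z => inner ℝ z (push F X x)) e
      simpa only [inner_add_left, inner_smul_left, h11, h21, RCLike.conj_to_real, mul_one, mul_zero,
        add_zero, inner_zero_left] using this
    · have := congrArg (fun z => inner ℝ z (push F Y x)) e
      simpa only [inner_add_left, inner_smul_left, h22, h12, RCLike.conj_to_real, mul_one, mul_zero,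
        zero_add, inner_zero_left] using this
  have hspan : Submodule.span ℝ (range ![X x, Y x]) = ⊤ :=
    hli.span_eq_top_of_card_eq_finrank (by simp)
  have hv : v ∈ Submodule.span ℝ {X x, Y x} := by
    have : range ![X x, Y x] = {X x, Y x} := by simp [Set.pair_comm]
    rw [← this, hspan]; trivial
  obtain ⟨a, b, rfl⟩ := Submodule.mem_span_pair.1 hv
  have e : fderiv ℝ F x (a • X x + b • Y x) = a • push F X x + b • push F Y x := by simp [push]
  rw [e]
  simp only [inner_add_left, inner_smul_left, h11, h22, h12, h21, RCLike.conj_to_real, mul_one,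
    mul_zero, zero_add, add_zero]

theorem fderiv_decomp (h : IsFrame F V X Y) (hx : x ∈ V) (v : E 2) :
    fderiv ℝ F x v = inner ℝ (fderiv ℝ F x v) (push F X x) • push F X x
      + inner ℝ (fderiv ℝ F x v) (push F Y x) • push F Y x := by
  conv_lhs => rw [h.decomp hx v]
  simp [push]

theorem tangentProj_eq (h : IsFrame F V X Y) (hx : x ∈ V) (v : E N) :
    tangentProj F x v = inner ℝ v (push F X x) • push F X x
      + inner ℝ v (push F Y x) • push F Y x := by
  unfold tangentProj
  refine Submodule.eq_starProjection_of_mem_of_inner_eq_zero ?_ ?_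
  · exact add_mem (Submodule.smul_mem _ _ ⟨X x, rfl⟩) (Submodule.smul_mem _ _ ⟨Y x, rfl⟩)
  · rintro _ ⟨w, rfl⟩
    change inner ℝ _ (fderiv ℝ F x w) = 0
    rw [h.fderiv_decomp hx w]
    simp only [inner_sub_left, inner_add_left, inner_add_right, inner_smul_left, inner_smul_right,
      h.inner_fst x hx, h.inner_snd x hx, h.inner_fst_snd x hx, h.inner_snd_fst hx]
    simp

theorem normalProj_eq (h : IsFrame F V X Y) (hx : x ∈ V) (v : E N) :
    normalProj F x v = v - (inner ℝ v (push F X x) • push F X x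
      + inner ℝ v (push F Y x) • push F Y x) := by
  rw [← h.tangentProj_eq hx, normalProj, tangentProj, Submodule.starProjection_orthogonal_val]

theorem contDiffOn_push (h : IsFrame F V X Y) {Z : E 2 → E 2} (hZ : ContDiffOn ℝ ∞ Z V) :
    ContDiffOn ℝ ∞ (push F Z) V :=
  (h.smooth.fderiv_of_isOpen h.isOpen (m := ∞) (by simp)).clm_apply hZ

theorem contDiffOn_fst (h : IsFrame F V X Y) : ContDiffOn ℝ ∞ (push F X) V :=
  h.contDiffOn_push h.smooth_fst

theorem contDiffOn_snd (h : IsFrame F V X Y) : ContDiffOn ℝ ∞ (push F Y) V :=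
  h.contDiffOn_push h.smooth_snd

theorem differentiableAt_fderiv (h : IsFrame F V X Y) (hx : x ∈ V) :
    DifferentiableAt ℝ (fderiv ℝ F) x :=
  ((h.smooth.fderiv_of_isOpen h.isOpen (m := ∞) (by simp)).differentiableOn
    (by simp)).differentiableAt (h.isOpen.mem_nhds hx)

theorem fderiv_fderiv_symm (h : IsFrame F V X Y) (hx : x ∈ V) (u v : E 2) :
    fderiv ℝ (fderiv ℝ F) x u v = fderiv ℝ (fderiv ℝ F) x v u :=
  ((h.smooth.contDiffAt (h.isOpen.mem_nhds hx)).isSymmSndFDerivAt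
    (by rw [minSmoothness_of_isRCLikeNormedField]; exact two_le_infty)) u v

theorem fderiv_push (h : IsFrame F V X Y) {Z : E 2 → E 2} (hZ : ContDiffOn ℝ ∞ Z V) (hx : x ∈ V)
    (v : E 2) :
    fderiv ℝ (push F Z) x v
      = fderiv ℝ (fderiv ℝ F) x v (Z x) + fderiv ℝ F x (fderiv ℝ Z x v) := by
  have h1 := (h.differentiableAt_fderiv hx).hasFDerivAt.clm_apply
    ((hZ.differentiableOn (by simp)).differentiableAt (h.isOpen.mem_nhds hx)).hasFDerivAt
  have h2 : fderiv ℝ (push F Z) x = _ := h1.fderiv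
  rw [h2]
  simp [add_comm]

/-- The projection of a constant vector to the normal bundle. -/
def normalExt (F : E 2 → E N) (X Y : E 2 → E 2) (ξ : E N) (y : E 2) : E N :=
  ξ - (inner ℝ ξ (push F X y) • push F X y + inner ℝ ξ (push F Y y) • push F Y y)

theorem isNormalField_normalExt (h : IsFrame F V X Y) (ξ : E N) :
    IsNormalField F V (normalExt F X Y ξ) := by
  refine ⟨?_, fun x hx u => ?_⟩
  · exact contDiffOn_const.sub
      (((contDiffOn_const.inner ℝ h.contDiffOn_fst).smul h.contDiffOn_fst).add
        ((contDiffOn_const.inner ℝ h.contDiffOn_snd).smul h.contDiffOn_snd))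
  · rw [h.fderiv_decomp hx u, normalExt]
    simp only [inner_sub_right, inner_add_left, inner_add_right, inner_smul_left, inner_smul_right,
      h.inner_fst x hx, h.inner_snd x hx, h.inner_fst_snd x hx, h.inner_snd_fst hx,
      RCLike.conj_to_real]
    rw [real_inner_comm ξ (push F X x), real_inner_comm ξ (push F Y x)]
    ring

theorem normalExt_eq_self (ξ : E N) (hξ : ∀ u, inner ℝ (fderiv ℝ F x u) ξ = 0) :
    normalExt F X Y ξ x = ξ := by
  have hξ' : ∀ u, inner ℝ ξ (fderiv ℝ F x u) = 0 := fun u => by rw [real_inner_comm]; exact hξ u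
  simp [normalExt, push, hξ']

/-- The Weingarten formula: differentiate ⟨ξ, dF(w)⟩ = 0. -/
theorem inner_fderiv_normalField (h : IsFrame F V X Y) {ξ : E 2 → E N} (hξ : IsNormalField F V ξ)
    (hx : x ∈ V) (v w : E 2) :
    inner ℝ (fderiv ℝ ξ x v) (fderiv ℝ F x w) = - inner ℝ (ξ x) (fderiv ℝ (fderiv ℝ F) x v w) := by
  have d1 : DifferentiableAt ℝ ξ x :=
    (hξ.1.differentiableOn (by simp)).differentiableAt (h.isOpen.mem_nhds hx)
  have d2 : HasFDerivAt (fun y => fderiv ℝ F y w) ((fderiv ℝ (fderiv ℝ F) x).flip w) x := by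
    have := (h.differentiableAt_fderiv hx).hasFDerivAt.clm_apply (hasFDerivAt_const w x)
    simpa using this
  have e : (fun y => inner ℝ (ξ y) (fderiv ℝ F y w)) =ᶠ[𝓝 x] fun _ => (0 : ℝ) := by
    filter_upwards [h.isOpen.mem_nhds hx] with y hy
    rw [real_inner_comm]; exact hξ.2 y hy w
  have e2 := e.fderiv_eq (𝕜 := ℝ)
  have := fderiv_real_inner d1 d2.differentiableAt v
  rw [e2, d2.fderiv] at this
  simp at this
  linarith

theorem inner_normalDeriv (h : IsFrame F V X Y) {η : E N} (hx : x ∈ V)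
    (hη : ∀ u, inner ℝ (fderiv ℝ F x u) η = 0) (v : E N) :
    inner ℝ (normalProj F x v) η = inner ℝ v η := by
  rw [h.normalProj_eq hx]
  simp [inner_sub_left, inner_add_left, inner_smul_left, push, hη]

/-- Differentiate ⟨∇^⊥_v ξ, η⟩ = ⟨∂_v ξ, η⟩. The two sides differ by the tangential part of ∂_v ξ
paired with ∂_u η, a product of shape operators by the Weingarten formula. After antisymmetrizing in
u, v only the commutator of the shape operators of ξ and η survives. -/
theorem inner_fderiv_normalDeriv (h : IsFrame F V X Y) {ξ η : E 2 → E N}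
    (hξ : IsNormalField F V ξ) (hη : IsNormalField F V η) (hx : x ∈ V) (u v : E 2) :
    inner ℝ (normalDeriv F (normalDeriv F ξ v) u x) (η x)
      = inner ℝ (fderiv ℝ (fderiv ℝ ξ) x u v) (η x)
        + inner ℝ (ξ x) (fderiv ℝ (fderiv ℝ F) x v (X x))
          * inner ℝ (η x) (fderiv ℝ (fderiv ℝ F) x u (X x))
        + inner ℝ (ξ x) (fderiv ℝ (fderiv ℝ F) x v (Y x))
          * inner ℝ (η x) (fderiv ℝ (fderiv ℝ F) x u (Y x)) := by
  have hV := h.isOpen.mem_nhds hx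
  have sξ' : ContDiffOn ℝ ∞ (fderiv ℝ ξ) V := hξ.1.fderiv_of_isOpen h.isOpen (by simp)
  have sξv : ContDiffOn ℝ ∞ (fun y => fderiv ℝ ξ y v) V := sξ'.clm_apply contDiffOn_const
  have dη : DifferentiableAt ℝ η x := (hη.1.differentiableOn (by simp)).differentiableAt hV
  have dξ' : DifferentiableAt ℝ (fderiv ℝ ξ) x := (sξ'.differentiableOn (by simp)).differentiableAt hV
  have dξv : HasFDerivAt (fun y => fderiv ℝ ξ y v) ((fderiv ℝ (fderiv ℝ ξ) x).flip v) x := by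
    simpa using dξ'.hasFDerivAt.clm_apply (hasFDerivAt_const v x)
  have sζ : ContDiffOn ℝ ∞ (normalDeriv F ξ v) V := by
    refine ContDiffOn.congr (f := fun y => fderiv ℝ ξ y v
      - (inner ℝ (fderiv ℝ ξ y v) (push F X y) • push F X y
      + inner ℝ (fderiv ℝ ξ y v) (push F Y y) • push F Y y)) ?_
      fun y hy => h.normalProj_eq hy _
    exact sξv.sub (((sξv.inner ℝ h.contDiffOn_fst).smul h.contDiffOn_fst).add
        ((sξv.inner ℝ h.contDiffOn_snd).smul h.contDiffOn_snd))
  have dζ := (sζ.differentiableOn (by simp)).differentiableAt hV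
  have e : (fun y => inner ℝ (normalDeriv F ξ v y) (η y))
      =ᶠ[𝓝 x] fun y => inner ℝ (fderiv ℝ ξ y v) (η y) := by
    filter_upwards [hV] with y hy
    exact h.inner_normalDeriv hy (hη.2 y hy) _
  have e2 := congrArg (fun T => T u) (e.fderiv_eq (𝕜 := ℝ))
  simp only [fderiv_real_inner dζ dη, fderiv_real_inner dξv.differentiableAt dη,
    dξv.fderiv, ContinuousLinearMap.flip_apply] at e2
  rw [normalDeriv, h.inner_normalDeriv hx (hη.2 x hx)]
  have e3 : normalDeriv F ξ v x = _ := h.normalProj_eq hx _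
  rw [e3] at e2
  have a1 := h.inner_fderiv_normalField hξ hx v (X x)
  have a2 := h.inner_fderiv_normalField hξ hx v (Y x)
  have b1 := h.inner_fderiv_normalField hη hx u (X x)
  have b2 := h.inner_fderiv_normalField hη hx u (Y x)
  rw [real_inner_comm] at b1 b2
  simp only [inner_sub_left, inner_add_left, inner_smul_left, push, a1, a2, b1, b2,
    RCLike.conj_to_real] at e2
  linarith

/-- The Ricci equation of a patch with flat normal bundle, in an orthonormal frame. -/
theorem ricci (h : IsFrame F V X Y) (hflat : PatchFlatNormal F V) (hx : x ∈ V) (ξ η : E N)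
    (hξ : ∀ u, inner ℝ (fderiv ℝ F x u) ξ = 0) (hη : ∀ u, inner ℝ (fderiv ℝ F x u) η = 0) :
    inner ℝ ξ (fderiv ℝ (fderiv ℝ F) x (X x) (Y x))
        * (inner ℝ η (fderiv ℝ (fderiv ℝ F) x (X x) (X x))
          - inner ℝ η (fderiv ℝ (fderiv ℝ F) x (Y x) (Y x)))
      = (inner ℝ ξ (fderiv ℝ (fderiv ℝ F) x (X x) (X x))
          - inner ℝ ξ (fderiv ℝ (fderiv ℝ F) x (Y x) (Y x)))
        * inner ℝ η (fderiv ℝ (fderiv ℝ F) x (X x) (Y x)) := by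
  have nξ := h.isNormalField_normalExt ξ
  have nη := h.isNormalField_normalExt η
  -- Flatness concerns constant fields, so the values of the frame at the single point `x` are used
  -- as u and v.
  have e := congrArg (fun z => inner ℝ z (normalExt F X Y η x))
    (hflat V subset_rfl h.isOpen _ nξ (X x) (Y x) x hx)
  beta_reduce at e
  rw [h.inner_fderiv_normalDeriv nξ nη hx, h.inner_fderiv_normalDeriv nξ nη hx,
    normalExt_eq_self ξ hξ, normalExt_eq_self η hη] at e
  have hs : fderiv ℝ (fderiv ℝ (normalExt F X Y ξ)) x (X x) (Y x)
      = fderiv ℝ (fderiv ℝ (normalExt F X Y ξ)) x (Y x) (X x) :=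
    ((nξ.1.contDiffAt (h.isOpen.mem_nhds hx)).isSymmSndFDerivAt
    (by rw [minSmoothness_of_isRCLikeNormedField]; exact two_le_infty)) _ _
  rw [hs, h.fderiv_fderiv_symm hx (Y x) (X x)] at e
  linarith

end IsFrame

/-- Gram–Schmidt. -/
theorem exists_isFrame {F : E 2 → E N} {U : Set (E 2)} (hU : IsOpen U) (hF : ContDiffOn ℝ ∞ F U)
    (hinj : ∀ x ∈ U, Function.Injective (fderiv ℝ F x)) : ∃ X Y, IsFrame F U X Y := by
  have hF' : ContDiffOn ℝ ∞ (fderiv ℝ F) U := hF.fderiv_of_isOpen hU (by simp)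
  let e₁ : E 2 := EuclideanSpace.single 0 1
  let e₂ : E 2 := EuclideanSpace.single 1 1
  have he (a : ℝ) : e₂ - a • e₁ ≠ 0 := fun h => by
    have := congrArg (fun v : E 2 => v 1) h
    simp [e₁, e₂] at this
  have he₁ : e₁ ≠ 0 := fun h => by
    have := congrArg (fun v : E 2 => v 0) h
    simp [e₁] at this
  have normalize : ∀ Z : E 2 → E 2, ContDiffOn ℝ ∞ Z U → (∀ x ∈ U, Z x ≠ 0) →
      ContDiffOn ℝ ∞ (fun x => ‖push F Z x‖⁻¹ • Z x) U ∧
        ∀ x ∈ U, ‖push F Z x‖ ≠ 0 := by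
    intro Z hZ hZ0
    have hne : ∀ x ∈ U, push F Z x ≠ 0 := fun x hx h0 =>
      hZ0 x hx ((hinj x hx) (by rw [map_zero]; exact h0))
    refine ⟨?_, fun x hx => norm_ne_zero_iff.2 (hne x hx)⟩
    exact (((hF'.clm_apply hZ).norm ℝ hne).inv fun x hx => norm_ne_zero_iff.2 (hne x hx)).smul hZ
  obtain ⟨sX, nX⟩ := normalize (fun _ => e₁) contDiffOn_const fun _ _ => he₁
  set X : E 2 → E 2 := fun x => ‖push F (fun _ => e₁) x‖⁻¹ • e₁ with hX
  have pX : ∀ x, push F X x = ‖push F (fun _ => e₁) x‖⁻¹ • push F (fun _ => e₁) x := fun x => by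
    simp [push, X]
  have iX : ∀ x ∈ U, inner ℝ (push F X x) (push F X x) = 1 := fun x hx => by
    rw [pX, inner_smul_left, inner_smul_right, real_inner_self_eq_norm_sq]
    have := nX x hx
    simp only [RCLike.conj_to_real]
    field_simp
  set Z : E 2 → E 2 := fun x => e₂ - inner ℝ (fderiv ℝ F x e₂) (push F X x) • X x with hZ
  have sZ : ContDiffOn ℝ ∞ Z U := contDiffOn_const.sub
    (((hF'.clm_apply contDiffOn_const).inner ℝ (hF'.clm_apply sX)).smul sX)
  obtain ⟨sY, nY⟩ := normalize Z sZ fun x hx => by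
    simp only [Z, X, smul_smul]; exact he _
  have pZ : ∀ x ∈ U, inner ℝ (push F X x) (push F Z x) = 0 := fun x hx => by
    have : push F Z x = fderiv ℝ F x e₂ - inner ℝ (fderiv ℝ F x e₂) (push F X x) • push F X x := by
      simp [push, Z]
    rw [this, inner_sub_right, inner_smul_right, iX x hx, real_inner_comm]; ring
  have pY : ∀ x, push F (fun x => ‖push F Z x‖⁻¹ • Z x) x = ‖push F Z x‖⁻¹ • push F Z x :=
    fun x => by simp [push]
  refine ⟨X, fun x => ‖push F Z x‖⁻¹ • Z x, hU, hF, sX, sY, iX, fun x hx => ?_, fun x hx => ?_⟩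
  · rw [pY, inner_smul_left, inner_smul_right, real_inner_self_eq_norm_sq]
    have := nY x hx
    simp only [RCLike.conj_to_real]
    field_simp
  · rw [pY, inner_smul_right, pZ x hx, mul_zero]

end Frames

/-! ### Smooth orthonormal frames of principal directions. -/

section PrincipalFrames

variable {N : ℕ}

namespace IsFrame

variable {F : E 2 → E N} {V : Set (E 2)} {X Y : E 2 → E 2} {x : E 2}

theorem normalProj_eq_zero (h : IsFrame F V X Y) (hx : x ∈ V) (z : E N)
    (hz : ∀ η : E N, (∀ u, inner ℝ (fderiv ℝ F x u) η = 0) → inner ℝ η z = 0) :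
    normalProj F x z = 0 := by
  have hn : ∀ u, inner ℝ (fderiv ℝ F x u) (normalProj F x z) = 0 := fun u => by
    rw [h.normalProj_eq hx]; exact (h.isNormalField_normalExt z).2 x hx u
  have h1 := h.inner_normalDeriv hx hn z
  rw [real_inner_comm (normalProj F x z) z, hz _ hn] at h1
  exact inner_self_eq_zero.1 h1

/-- In an orthonormal frame the trace-free part of the second fundamental form α has the components
α(X,X) - α(Y,Y) and α(X,Y). If both vanish, the point is umbilic with H = α(X,X). -/
theorem exists_ne_zero_of_not_umbilic (h : IsFrame F V X Y) (hx : x ∈ V)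
    (hu : ¬ ∃ H : E N, ∀ u v, normalProj F x (fderiv ℝ (fderiv ℝ F) x u v)
      = inner ℝ (fderiv ℝ F x u) (fderiv ℝ F x v) • H) :
    ∃ ξ : E N, (∀ u, inner ℝ (fderiv ℝ F x u) ξ = 0) ∧
      ¬ (inner ℝ ξ (fderiv ℝ (fderiv ℝ F) x (X x) (X x) - fderiv ℝ (fderiv ℝ F) x (Y x) (Y x)) = 0
        ∧ inner ℝ ξ (fderiv ℝ (fderiv ℝ F) x (X x) (Y x)) = 0) := by
  by_contra! hcon
  apply hu
  have h1 := h.normalProj_eq_zero hx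
    (fderiv ℝ (fderiv ℝ F) x (X x) (X x) - fderiv ℝ (fderiv ℝ F) x (Y x) (Y x))
    fun η hη => (hcon η hη).1
  have h2 := h.normalProj_eq_zero hx (fderiv ℝ (fderiv ℝ F) x (X x) (Y x))
    fun η hη => (hcon η hη).2
  have h3 : normalProj F x (fderiv ℝ (fderiv ℝ F) x (Y x) (X x)) = 0 := by
    rw [h.fderiv_fderiv_symm hx]; exact h2
  refine ⟨normalProj F x (fderiv ℝ (fderiv ℝ F) x (X x) (X x)), fun u v => ?_⟩
  have h4 : normalProj F x (fderiv ℝ (fderiv ℝ F) x (Y x) (Y x))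
      = normalProj F x (fderiv ℝ (fderiv ℝ F) x (X x) (X x)) := by
    unfold normalProj at h1 ⊢
    rw [map_sub, sub_eq_zero] at h1
    exact h1.symm
  rw [h.fderiv_decomp hx u, h.fderiv_decomp hx v]
  conv_lhs => rw [h.decomp hx u, h.decomp hx v]
  unfold normalProj at h2 h3 h4 ⊢
  simp only [map_add, map_smul, add_apply, smul_apply,
    h2, h3, h4, smul_zero, add_zero, zero_add, inner_add_left, inner_add_right, inner_smul_left,
    inner_smul_right, h.inner_fst x hx, h.inner_snd x hx, h.inner_fst_snd x hx, h.inner_snd_fst hx,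
    smul_smul, ← add_smul, RCLike.conj_to_real]
  congr 1
  ring

/-- Rotation of an orthonormal frame. -/
theorem rotate (h : IsFrame F V X Y) {c s : E 2 → ℝ} (hc : ContDiffOn ℝ ∞ c V)
    (hs : ContDiffOn ℝ ∞ s V) (hcs : ∀ x ∈ V, c x ^ 2 + s x ^ 2 = 1) :
    IsFrame F V (fun x => c x • X x + s x • Y x) (fun x => -s x • X x + c x • Y x) := by
  have e1 : ∀ x, push F (fun x => c x • X x + s x • Y x) x = c x • push F X x + s x • push F Y x :=
    fun x => by simp [push]
  have e2 : ∀ x, push F (fun x => -s x • X x + c x • Y x) x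
      = -s x • push F X x + c x • push F Y x := fun x => by simp [push]
  refine ⟨h.isOpen, h.smooth, (hc.smul h.smooth_fst).add (hs.smul h.smooth_snd),
    (hs.neg.smul h.smooth_fst).add (hc.smul h.smooth_snd), fun x hx => ?_, fun x hx => ?_,
    fun x hx => ?_⟩
  all_goals
    simp only [e1, e2, inner_add_left, inner_add_right, inner_smul_left, inner_smul_right,
      h.inner_fst x hx, h.inner_snd x hx, h.inner_fst_snd x hx, h.inner_snd_fst hx,
      RCLike.conj_to_real]
    first | linear_combination hcs x hx | ring

end IsFrame

/-- An orthonormal frame of principal directions. -/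
structure IsPrincipalFrame (F : E 2 → E N) (V : Set (E 2)) (X Y : E 2 → E 2) : Prop extends
    IsFrame F V X Y where
  conjugate : ∀ x ∈ V, normalProj F x (fderiv ℝ (fderiv ℝ F) x (X x) (Y x)) = 0

theorem IsPrincipalFrame.mono {F : E 2 → E N} {V V' : Set (E 2)} {X Y : E 2 → E 2}
    (h : IsPrincipalFrame F V X Y) (hV' : IsOpen V') (hs : V' ⊆ V) : IsPrincipalFrame F V' X Y :=
  ⟨h.toIsFrame.mono hV' hs, fun x hx => h.conjugate x (hs hx)⟩

theorem IsPrincipalFrame.swap {F : E 2 → E N} {V : Set (E 2)} {X Y : E 2 → E 2}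
    (h : IsPrincipalFrame F V X Y) : IsPrincipalFrame F V Y X :=
  ⟨⟨h.isOpen, h.smooth, h.smooth_snd, h.smooth_fst, h.inner_snd, h.inner_fst,
    fun _ hx => h.inner_snd_fst hx⟩, fun x hx => by
      rw [h.fderiv_fderiv_symm hx]; exact h.conjugate x hx⟩

/-- One normal field ξ with a non-scalar shape operator determines the frame. With A = ⟨ξ, α(X,X) -
α(Y,Y)⟩ and B = ⟨ξ, α(X,Y)⟩, the rotation angle θ satisfies (cos 2θ, sin 2θ) ∝ (A, 2B). By the Ricci
equation the same rotation diagonalizes every other shape operator. -/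
theorem IsFrame.exists_isPrincipalFrame {F : E 2 → E N} {U : Set (E 2)} {X Y : E 2 → E 2}
    (h : IsFrame F U X Y) (hflat : PatchFlatNormal F U) {x₀ : E 2} (hx₀ : x₀ ∈ U)
    (hu : ¬ ∃ H : E N, ∀ u v, normalProj F x₀ (fderiv ℝ (fderiv ℝ F) x₀ u v)
      = inner ℝ (fderiv ℝ F x₀ u) (fderiv ℝ F x₀ v) • H) :
    ∃ V ⊆ U, x₀ ∈ V ∧ ∃ X' Y', IsPrincipalFrame F V X' Y' := by
  let S := fderiv ℝ (fderiv ℝ F)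
  have sS : ContDiffOn ℝ ∞ S U :=
    (h.smooth.fderiv_of_isOpen h.isOpen (m := ∞) (by simp)).fderiv_of_isOpen h.isOpen (by simp)
  -- The sign of ξ is chosen so that A ≥ 0 at `x₀`; the half-angle formula below degenerates where A
  -- + r = 0.
  obtain ⟨ξ, hξ, hne, hA⟩ : ∃ ξ : E N, (∀ u, inner ℝ (fderiv ℝ F x₀ u) ξ = 0) ∧
      ¬ (inner ℝ ξ (S x₀ (X x₀) (X x₀) - S x₀ (Y x₀) (Y x₀)) = 0
        ∧ inner ℝ ξ (S x₀ (X x₀) (Y x₀)) = 0) ∧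
      0 ≤ inner ℝ ξ (S x₀ (X x₀) (X x₀) - S x₀ (Y x₀) (Y x₀)) := by
    obtain ⟨ξ, hξ, hne⟩ := h.exists_ne_zero_of_not_umbilic hx₀ hu
    rcases le_total 0 (inner ℝ ξ (S x₀ (X x₀) (X x₀) - S x₀ (Y x₀) (Y x₀))) with h0 | h0
    · exact ⟨ξ, hξ, hne, h0⟩
    · refine ⟨-ξ, fun u => by rw [inner_neg_right, hξ, neg_zero], ?_, ?_⟩
      · simpa only [inner_neg_left, neg_eq_zero] using hne
      · rw [inner_neg_left]; linarith
  let A : E 2 → ℝ := fun x =>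
    inner ℝ (IsFrame.normalExt F X Y ξ x) (S x (X x) (X x) - S x (Y x) (Y x))
  let B : E 2 → ℝ := fun x => inner ℝ (IsFrame.normalExt F X Y ξ x) (S x (X x) (Y x))
  have nξ := h.isNormalField_normalExt ξ
  have sA : ContDiffOn ℝ ∞ A U := nξ.1.inner ℝ
    (((sS.clm_apply h.smooth_fst).clm_apply h.smooth_fst).sub
      ((sS.clm_apply h.smooth_snd).clm_apply h.smooth_snd))
  have sB : ContDiffOn ℝ ∞ B U := nξ.1.inner ℝ
    ((sS.clm_apply h.smooth_fst).clm_apply h.smooth_snd)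
  let r : E 2 → ℝ := fun x => √(A x ^ 2 + (2 * B x) ^ 2)
  have r2 : ∀ x, r x ^ 2 = A x ^ 2 + (2 * B x) ^ 2 := fun x => Real.sq_sqrt (by positivity)
  have cr : ContinuousOn r U := Real.continuous_sqrt.comp_continuousOn
    ((sA.continuousOn.pow 2).add ((continuousOn_const.mul sB.continuousOn).pow 2))
  let V := U ∩ (fun x => A x + r x) ⁻¹' Ioi 0
  have hV : IsOpen V := (sA.continuousOn.add cr).isOpen_inter_preimage h.isOpen isOpen_Ioi
  have hVU : V ⊆ U := inter_subset_left
  have hpos : ∀ x ∈ V, 0 < A x + r x := fun x hx => hx.2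
  have hx₀V : x₀ ∈ V := by
    refine ⟨hx₀, ?_⟩
    have e : IsFrame.normalExt F X Y ξ x₀ = ξ := IsFrame.normalExt_eq_self ξ hξ
    have hA' : 0 ≤ A x₀ := by simpa only [A, e] using hA
    change 0 < A x₀ + r x₀
    have hr : 0 < r x₀ := by
      apply Real.sqrt_pos.2
      by_contra hle
      apply hne
      have hA0 : A x₀ = 0 := by nlinarith [sq_nonneg (A x₀), sq_nonneg (2 * B x₀)]
      have hB0 : B x₀ = 0 := by nlinarith [sq_nonneg (A x₀), sq_nonneg (2 * B x₀)]
      simp only [A, B, e] at hA0 hB0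
      exact ⟨hA0, hB0⟩
    linarith
  have hrne : ∀ x ∈ V, A x ^ 2 + (2 * B x) ^ 2 ≠ 0 := fun x hx h0 => by
    have h1 : r x = 0 := by simp only [r, h0, Real.sqrt_zero]
    have h2 : A x = 0 := by nlinarith [sq_nonneg (A x), sq_nonneg (2 * B x)]
    have := hpos x hx
    rw [h1, h2] at this
    simp at this
  have sA' := sA.mono hVU
  have sB' := sB.mono hVU
  have sr : ContDiffOn ℝ ∞ r V :=
    ((sA'.pow 2).add ((contDiffOn_const.mul sB').pow 2)).sqrt hrne
  let n : E 2 → ℝ := fun x => √((A x + r x) ^ 2 + (2 * B x) ^ 2)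
  have hn0 : ∀ x ∈ V, 0 < (A x + r x) ^ 2 + (2 * B x) ^ 2 := fun x hx => by
    have := hpos x hx
    positivity
  have n2 : ∀ x, n x ^ 2 = (A x + r x) ^ 2 + (2 * B x) ^ 2 := fun x => Real.sq_sqrt (by positivity)
  have hn : ∀ x ∈ V, n x ≠ 0 := fun x hx => (Real.sqrt_pos.2 (hn0 x hx)).ne'
  have sn : ContDiffOn ℝ ∞ n V :=
    (((sA'.add sr).pow 2).add ((contDiffOn_const.mul sB').pow 2)).sqrt fun x hx => (hn0 x hx).ne'
  -- Half angles without trigonometric functions: (cos θ, sin θ) is (A + r, 2B) normalized, which is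
  -- smooth where A + r > 0.
  let c : E 2 → ℝ := fun x => (A x + r x) / n x
  let s : E 2 → ℝ := fun x => 2 * B x / n x
  have sc : ContDiffOn ℝ ∞ c V := (sA'.add sr).div sn hn
  have ss : ContDiffOn ℝ ∞ s V := (contDiffOn_const.mul sB').div sn hn
  have hV' := h.mono hV hVU
  have hrot := hV'.rotate sc ss fun x hx => by
    have := hn x hx
    simp only [c, s, div_pow]
    rw [← add_div, ← n2]
    field_simp
  refine ⟨V, hVU, hx₀V, _, _, hrot, fun x hx => ?_⟩
  apply hrot.normalProj_eq_zero hx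
  intro η hη
  have hric := h.ricci hflat (hVU hx) _ η (fun u => nξ.2 x (hVU hx) u) hη
  simp only [← inner_sub_right] at hric
  change B x * _ = A x * _ at hric
  have hsymm := h.fderiv_fderiv_symm (hVU hx) (Y x) (X x)
  have key : inner ℝ η (fderiv ℝ (fderiv ℝ F) x (c x • X x + s x • Y x) (-s x • X x + c x • Y x))
      = - (c x * s x) * inner ℝ η (S x (X x) (X x) - S x (Y x) (Y x))
        + (c x ^ 2 - s x ^ 2) * inner ℝ η (S x (X x) (Y x)) := by
    simp only [map_add, map_smul, add_apply, smul_apply,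
      hsymm, inner_add_right, inner_sub_right, inner_smul_right, S]
    ring
  rw [key]
  have hnx := hn x hx
  have hr2 := r2 x
  simp only [c, s]
  field_simp
  -- Since c² - s² = 2A(A + r)/n² and cs = 2B(A + r)/n², the expression is a multiple of the
  -- difference of the two sides of the Ricci equation.
  linear_combination (-2 * (A x + r x)) * hric
    + inner ℝ η (S x (X x) (Y x)) * hr2

end PrincipalFrames

/-! ### Integral curves of the frame fields. -/

section IntegralCurves

variable {G : Type*} [NormedAddCommGroup G] [NormedSpace ℝ G]

/-- Bootstrapping: the derivative X ∘ c is as smooth as c. -/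
theorem contDiffOn_integralCurve {X : G → G} {V : Set G} (hX : ContDiffOn ℝ ∞ X V) {c : ℝ → G}
    {J : Set ℝ} (hJ : IsOpen J) (hcV : ∀ t ∈ J, c t ∈ V)
    (hc : ∀ t ∈ J, HasDerivAt c (X (c t)) t) : ContDiffOn ℝ ∞ c J := by
  rw [contDiffOn_infty]
  intro n
  induction n with
  | zero => exact contDiffOn_zero.2 fun t ht => (hc t ht).continuousAt.continuousWithinAt
  | succ n ih =>
    rw [Nat.cast_succ, contDiffOn_succ_iff_deriv_of_isOpen hJ]
    refine ⟨fun t ht => (hc t ht).differentiableAt.differentiableWithinAt, by simp, ?_⟩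
    exact ((hX.of_le (by exact_mod_cast le_top)).comp ih hcV).congr fun t ht => (hc t ht).deriv

/-- A function whose absolute value is constant along the integral curves of `X` has derivative zero
in the direction of `X`. -/
theorem fderiv_eq_zero_of_abs_const [CompleteSpace G] {X : G → G} {V : Set G} (hV : IsOpen V)
    (hX : ContDiffOn ℝ ∞ X V) {k : G → ℝ} (hk : DifferentiableOn ℝ k V)
    (h : ∀ (c : ℝ → G) (J : Set ℝ), IsOpen J → J.OrdConnected → (∀ t ∈ J, c t ∈ V) →
      (∀ t ∈ J, HasDerivAt c (X (c t)) t) → ∀ s ∈ J, ∀ t ∈ J, |k (c s)| = |k (c t)|)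
    {x : G} (hx : x ∈ V) : fderiv ℝ k x (X x) = 0 := by
  have hX1 : ContDiffAt ℝ 1 X x :=
    (hX.contDiffAt (hV.mem_nhds hx)).of_le (by exact_mod_cast le_top)
  obtain ⟨c, hc0, ε, hε, hc⟩ :=
    hX1.exists_forall_mem_closedBall_exists_eq_forall_mem_Ioo_hasDerivAt₀ 0
  have h0 : (0 : ℝ) ∈ Ioo (0 - ε) (0 + ε) := by constructor <;> linarith
  have hcont : ContinuousAt c 0 := (hc 0 h0).continuousAt
  have hV0 : c ⁻¹' V ∈ 𝓝 (0 : ℝ) := hcont (by rw [hc0]; exact hV.mem_nhds hx)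
  obtain ⟨δ, hδ, hball⟩ := Metric.mem_nhds_iff.1 (inter_mem hV0 (Ioo_mem_nhds h0.1 h0.2))
  have hδ0 : (0 : ℝ) ∈ Metric.ball (0 : ℝ) δ := Metric.mem_ball_self hδ
  have habs := h c (Metric.ball 0 δ) Metric.isOpen_ball
    (convex_ball (0 : ℝ) δ).ordConnected (fun t ht => (hball ht).1)
    fun t ht => hc t (hball ht).2
  have hd : HasDerivAt (k ∘ c) (fderiv ℝ k x (X x)) 0 := by
    have h1 : HasFDerivAt k (fderiv ℝ k x) (c 0) := by
      rw [hc0]; exact (hk.differentiableAt (hV.mem_nhds hx)).hasFDerivAt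
    have := h1.comp_hasDerivAt 0 (hc 0 h0)
    rwa [hc0] at this
  have hsq : HasDerivAt (fun t => (k ∘ c) t * (k ∘ c) t)
      (fderiv ℝ k x (X x) * k x + k x * fderiv ℝ k x (X x)) 0 := by
    have := hd.mul hd
    rw [Function.comp_apply, hc0] at this
    exact this
  have hconst : (fun t => (k ∘ c) t * (k ∘ c) t) =ᶠ[𝓝 0] fun _ => k x * k x := by
    filter_upwards [Metric.ball_mem_nhds (0 : ℝ) hδ] with t ht
    have := habs t ht 0 hδ0
    rw [hc0] at this
    simpa using mul_self_eq_mul_self_iff.2 (abs_eq_abs.1 this)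
  have e1 := hsq.unique ((hasDerivAt_const 0 (k x * k x)).congr_of_eventuallyEq hconst)
  -- The square k² is constant along the curve, so k · k' = 0. This is inconclusive where k
  -- vanishes, but there |k| is zero along the whole curve.
  by_cases hk0 : k x = 0
  · have hconst' : (k ∘ c) =ᶠ[𝓝 0] fun _ => (0 : ℝ) := by
      filter_upwards [Metric.ball_mem_nhds (0 : ℝ) hδ] with t ht
      have := habs t ht 0 hδ0
      rw [hc0, hk0, abs_zero, abs_eq_zero] at this
      exact this
    exact hd.unique ((hasDerivAt_const 0 (0 : ℝ)).congr_of_eventuallyEq hconst')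
  · have : k x * fderiv ℝ k x (X x) = 0 := by linarith
    exact (mul_eq_zero.1 this).resolve_left hk0

end IntegralCurves

/-! ### Geodesic curvatures, closed 1-forms and isothermic coordinates. -/

section Coordinates

variable {N : ℕ}

/-- The signed geodesic curvature of the integral curves of the first field of an orthonormal frame.
-/
def geodCurv (F : E 2 → E N) (X Y : E 2 → E 2) (x : E 2) : ℝ :=
  inner ℝ (fderiv ℝ (push F X) x (X x)) (push F Y x)

namespace IsFrame

variable {F : E 2 → E N} {V : Set (E 2)} {X Y : E 2 → E 2} {x : E 2}

theorem differentiableAt_of_mem (h : IsFrame F V X Y) {G : Type*} [NormedAddCommGroup G]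
    [NormedSpace ℝ G] {u : E 2 → G} (hu : ContDiffOn ℝ ∞ u V) (hx : x ∈ V) :
    DifferentiableAt ℝ u x :=
  (hu.differentiableOn (by simp)).differentiableAt (h.isOpen.mem_nhds hx)

theorem inner_fderiv_const (h : IsFrame F V X Y) {a b : E 2 → E N} {r : ℝ}
    (ha : ContDiffOn ℝ ∞ a V) (hb : ContDiffOn ℝ ∞ b V) (hab : ∀ x ∈ V, inner ℝ (a x) (b x) = r)
    (hx : x ∈ V) (v : E 2) :
    inner ℝ (fderiv ℝ a x v) (b x) = - inner ℝ (fderiv ℝ b x v) (a x) := by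
  have e : (fun y => inner ℝ (a y) (b y)) =ᶠ[𝓝 x] fun _ => r := by
    filter_upwards [h.isOpen.mem_nhds hx] with y hy using hab y hy
  have e2 := congrArg (fun T => T v) (e.fderiv_eq (𝕜 := ℝ))
  beta_reduce at e2
  rw [fderiv_real_inner (h.differentiableAt_of_mem ha hx) (h.differentiableAt_of_mem hb hx)] at e2
  simp at e2
  rw [real_inner_comm (a x)]
  linarith

theorem inner_fderiv_fst_fst (h : IsFrame F V X Y) (hx : x ∈ V) (v : E 2) :
    inner ℝ (fderiv ℝ (push F X) x v) (push F X x) = 0 := by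
  have := h.inner_fderiv_const h.contDiffOn_fst h.contDiffOn_fst h.inner_fst hx v
  linarith

theorem inner_fderiv_snd_snd (h : IsFrame F V X Y) (hx : x ∈ V) (v : E 2) :
    inner ℝ (fderiv ℝ (push F Y) x v) (push F Y x) = 0 := by
  have := h.inner_fderiv_const h.contDiffOn_snd h.contDiffOn_snd h.inner_snd hx v
  linarith

theorem inner_fderiv_snd_fst (h : IsFrame F V X Y) (hx : x ∈ V) :
    inner ℝ (fderiv ℝ (push F Y) x (X x)) (push F X x) = - geodCurv F X Y x :=
  h.inner_fderiv_const h.contDiffOn_snd h.contDiffOn_fst (fun _ hy => h.inner_snd_fst hy) hx (X x)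

theorem contDiffOn_geodCurv (h : IsFrame F V X Y) : ContDiffOn ℝ ∞ (geodCurv F X Y) V :=
  ((h.contDiffOn_fst.fderiv_of_isOpen h.isOpen (m := ∞) (by simp)).clm_apply h.smooth_fst).inner ℝ
    h.contDiffOn_snd

theorem contDiffOn_geodCurv_swap (h : IsFrame F V X Y) : ContDiffOn ℝ ∞ (geodCurv F Y X) V :=
  ((h.contDiffOn_snd.fderiv_of_isOpen h.isOpen (m := ∞) (by simp)).clm_apply h.smooth_snd).inner ℝ
    h.contDiffOn_fst

/-- The 1-form `a ω₁ + b ω₂`, where `ω₁`, `ω₂` is the dual frame. -/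
def form (F : E 2 → E N) (X Y : E 2 → E 2) (a b : E 2 → ℝ) (x : E 2) : E 2 →L[ℝ] ℝ :=
  (innerSL ℝ (a x • push F X x + b x • push F Y x)).comp (fderiv ℝ F x)

theorem contDiffOn_form (h : IsFrame F V X Y) {a b : E 2 → ℝ} (ha : ContDiffOn ℝ ∞ a V)
    (hb : ContDiffOn ℝ ∞ b V) : ContDiffOn ℝ ∞ (form F X Y a b) V :=
  ((innerSL ℝ (E := E N)).contDiff.comp_contDiffOn
    ((ha.smul h.contDiffOn_fst).add (hb.smul h.contDiffOn_snd))).clm_comp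
    (h.smooth.fderiv_of_isOpen h.isOpen (m := ∞) (by simp))

theorem fderiv_form (h : IsFrame F V X Y) {a b : E 2 → ℝ} (ha : ContDiffOn ℝ ∞ a V)
    (hb : ContDiffOn ℝ ∞ b V) (hx : x ∈ V) (u v : E 2) :
    fderiv ℝ (form F X Y a b) x u v
      = fderiv ℝ a x u * inner ℝ (push F X x) (fderiv ℝ F x v)
        + a x * inner ℝ (fderiv ℝ (push F X) x u) (fderiv ℝ F x v)
        + fderiv ℝ b x u * inner ℝ (push F Y x) (fderiv ℝ F x v)
        + b x * inner ℝ (fderiv ℝ (push F Y) x u) (fderiv ℝ F x v)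
        + inner ℝ (a x • push F X x + b x • push F Y x) (fderiv ℝ (fderiv ℝ F) x u v) := by
  have d1 := (h.differentiableAt_of_mem (h.contDiffOn_form ha hb) hx).hasFDerivAt.clm_apply
    (hasFDerivAt_const v x)
  have d2 : HasFDerivAt (fun y => fderiv ℝ F y v) ((fderiv ℝ (fderiv ℝ F) x).flip v) x := by
    simpa using (h.differentiableAt_fderiv hx).hasFDerivAt.clm_apply (hasFDerivAt_const v x)
  have d3 := ((h.differentiableAt_of_mem ha hx).hasFDerivAt.smul
    (h.differentiableAt_of_mem h.contDiffOn_fst hx).hasFDerivAt).add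
    ((h.differentiableAt_of_mem hb hx).hasFDerivAt.smul
    (h.differentiableAt_of_mem h.contDiffOn_snd hx).hasFDerivAt)
  have d4 := fderiv_real_inner d3.differentiableAt d2.differentiableAt u
  rw [d2.fderiv, d3.fderiv] at d4
  have d5 := congrArg (fun T => T u) d1.fderiv
  have d6 : fderiv ℝ (fun y => form F X Y a b y v) x u = fderiv ℝ (form F X Y a b) x u v := by
    simpa using d5
  rw [← d6]
  refine Eq.trans d4 ?_
  simp only [ContinuousLinearMap.flip_apply, add_apply, smul_apply,
    ContinuousLinearMap.smulRight_apply, inner_add_left, inner_smul_left, RCLike.conj_to_real,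
    Pi.add_apply, Pi.smul_apply']
  ring

/-- A 1-form on a convex open set has a primitive if it is closed. -/
theorem exists_primitive (h : IsFrame F V X Y) (hconv : Convex ℝ V) {a b : E 2 → ℝ}
    (ha : ContDiffOn ℝ ∞ a V) (hb : ContDiffOn ℝ ∞ b V)
    (hclosed : ∀ x ∈ V, fderiv ℝ b x (X x) + a x * geodCurv F X Y x
      = fderiv ℝ a x (Y x) + b x * geodCurv F Y X x) :
    ∃ g : E 2 → ℝ, ContDiffOn ℝ ∞ g V ∧
      ∀ x ∈ V, fderiv ℝ g x (X x) = a x ∧ fderiv ℝ g x (Y x) = b x := by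
  have sω := h.contDiffOn_form ha hb
  -- In dimension two closedness is a single equation, on the pair (X, Y). The second derivative of
  -- F contributes symmetrically and cancels; the derivatives of the frame produce the geodesic
  -- curvatures.
  have hXY : ∀ x ∈ V, fderiv ℝ (form F X Y a b) x (X x) (Y x)
      = fderiv ℝ (form F X Y a b) x (Y x) (X x) := fun x hx => by
    rw [h.fderiv_form ha hb hx, h.fderiv_form ha hb hx, h.fderiv_fderiv_symm hx (Y x)]
    have e1 := h.inner_fderiv_fst_fst hx (Y x)
    have e2 := h.inner_fderiv_snd_snd hx (X x)
    have e3 := h.inner_fst x hx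
    have e4 := h.inner_snd x hx
    have e5 := h.inner_fst_snd x hx
    have e6 := h.inner_snd_fst hx
    have e7 := hclosed x hx
    simp only [geodCurv] at e7
    change _ * inner ℝ (push F X x) (push F Y x) + _ * inner ℝ _ (push F Y x)
      + _ * inner ℝ (push F Y x) (push F Y x) + _ * inner ℝ _ (push F Y x) + _
      = _ * inner ℝ (push F X x) (push F X x) + _ * inner ℝ _ (push F X x)
      + _ * inner ℝ (push F Y x) (push F X x) + _ * inner ℝ _ (push F X x) + _
    rw [e1, e2, e3, e4, e5, e6]
    linarith
  obtain ⟨g, hg⟩ := hconv.exists_forall_hasFDerivAt_of_fderiv_symmetric h.isOpen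
    (sω.differentiableOn (by simp)) fun x hx u v => by
      rw [h.decomp hx u, h.decomp hx v]
      simp only [map_add, map_smul, add_apply, smul_apply, smul_eq_mul, hXY x hx]
      ring
  refine ⟨g, ?_, fun x hx => ?_⟩
  · rw [contDiffOn_infty_iff_fderiv_of_isOpen h.isOpen]
    exact ⟨fun x hx => (hg x hx).differentiableAt.differentiableWithinAt,
      sω.congr fun x hx => (hg x hx).fderiv⟩
  · rw [(hg x hx).fderiv]
    change inner ℝ _ (push F X x) = _ ∧ inner ℝ _ (push F Y x) = _
    simp only [inner_add_left, inner_smul_left, h.inner_fst x hx, h.inner_snd x hx,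
      h.inner_fst_snd x hx, h.inner_snd_fst hx, RCLike.conj_to_real]
    constructor <;> ring

end IsFrame

/-- The normal part is α(X, Y) = 0, and the component along F_*Y vanishes because F_*Y has unit
length. This is where principality enters the splitting of the net. -/
theorem IsPrincipalFrame.fderiv_snd_fst {F : E 2 → E N} {V : Set (E 2)} {X Y : E 2 → E 2} {x : E 2}
    (h : IsPrincipalFrame F V X Y) (hx : x ∈ V) :
    fderiv ℝ (push F Y) x (X x) = - geodCurv F X Y x • push F X x := by
  have h1 : normalProj F x (fderiv ℝ (push F Y) x (X x)) = 0 := by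
    rw [h.fderiv_push h.smooth_snd hx]
    have h2 := h.conjugate x hx
    have h3 : normalProj F x (fderiv ℝ F x (fderiv ℝ Y x (X x))) = 0 :=
      h.normalProj_eq_zero hx _ fun η hη => by rw [real_inner_comm]; exact hη _
    unfold normalProj at h2 h3 ⊢
    rw [map_add, h2, h3, add_zero]
  rw [h.normalProj_eq hx, h.inner_fderiv_snd_snd hx, h.inner_fderiv_snd_fst hx, zero_smul, add_zero,
    sub_eq_zero] at h1
  exact h1

/-- Isothermic coordinates adapted to the orthonormal frame `X`, `Y`, with conformal factor `1 / ρ`.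
-/
structure IsIsothermicChart (F : E 2 → E N) (X Y : E 2 → E 2) (ρ : E 2 → ℝ) (J₁ J₂ : Set ℝ)
    (φ : OpenPartialHomeomorph (ℝ × ℝ) (E 2)) : Prop where
  isOpen_fst : IsOpen J₁
  ordConnected_fst : J₁.OrdConnected
  isOpen_snd : IsOpen J₂
  ordConnected_snd : J₂.OrdConnected
  source_eq : φ.source = J₁ ×ˢ J₂
  contDiffOn : ContDiffOn ℝ ∞ φ φ.source
  contDiffOn_symm : ContDiffOn ℝ ∞ φ.symm φ.target
  frame : IsPrincipalFrame F φ.target X Y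
  contDiffOn_factor : ContDiffOn ℝ ∞ ρ φ.target
  factor_pos : ∀ x ∈ φ.target, 0 < ρ x
  fderiv_factor_fst : ∀ x ∈ φ.target, fderiv ℝ ρ x (X x) = ρ x * geodCurv F Y X x
  fderiv_factor_snd : ∀ x ∈ φ.target, fderiv ℝ ρ x (Y x) = ρ x * geodCurv F X Y x
  fderiv_fst : ∀ z ∈ φ.source, fderiv ℝ φ z (1, 0) = (ρ (φ z))⁻¹ • X (φ z)
  fderiv_snd : ∀ z ∈ φ.source, fderiv ℝ φ z (0, 1) = (ρ (φ z))⁻¹ • Y (φ z)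

/-- A form aω₁ + bω₂ is closed when X b + a k₁ = Y a + b k₂. For a = -k₂, b = -k₁ this reduces to X
k₁ = Y k₂, and both sides are zero. With u a primitive and ρ = exp(u(x₀) - u), the forms ρω₁ and ρω₂
satisfy the same criterion; their primitives are the coordinates, and the chart is the local
inverse. -/
theorem IsPrincipalFrame.exists_isIsothermicChart {F : E 2 → E N} {V : Set (E 2)}
    {X Y : E 2 → E 2} {x₀ : E 2} (h : IsPrincipalFrame F V X Y) (hx₀ : x₀ ∈ V)
    (hX : ∀ x ∈ V, fderiv ℝ (geodCurv F X Y) x (X x) = 0)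
    (hY : ∀ x ∈ V, fderiv ℝ (geodCurv F Y X) x (Y x) = 0) :
    ∃ (ρ : E 2 → ℝ) (J₁ J₂ : Set ℝ) (φ : OpenPartialHomeomorph (ℝ × ℝ) (E 2)),
      IsIsothermicChart F X Y ρ J₁ J₂ φ ∧ φ.target ⊆ V ∧ x₀ ∈ φ.target ∧ ρ x₀ = 1 := by
  obtain ⟨ε, hε, hB⟩ := Metric.mem_nhds_iff.1 (h.isOpen.mem_nhds hx₀)
  set B := Metric.ball x₀ ε
  have hBo : IsOpen B := Metric.isOpen_ball
  have hx₀B : x₀ ∈ B := Metric.mem_ball_self hε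
  have hBc : Convex ℝ B := convex_ball _ _
  have hb := h.mono hBo hB
  obtain ⟨u, su, hu⟩ := hb.exists_primitive hBc hb.contDiffOn_geodCurv_swap.neg
    hb.contDiffOn_geodCurv.neg fun x hx => by
      have e1 : fderiv ℝ (-geodCurv F X Y) x (X x) = 0 := by
        rw [fderiv_neg, neg_apply, hX x (hB hx), neg_zero]
      have e2 : fderiv ℝ (-geodCurv F Y X) x (Y x) = 0 := by
        rw [fderiv_neg, neg_apply, hY x (hB hx), neg_zero]
      change fderiv ℝ (-geodCurv F X Y) x (X x) + -geodCurv F Y X x * geodCurv F X Y x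
        = fderiv ℝ (-geodCurv F Y X) x (Y x) + -geodCurv F X Y x * geodCurv F Y X x
      rw [e1, e2]; ring
  -- The constant of integration is fixed by ρ(x₀) = 1, so that a constant factor is exactly 1.
  let ρ : E 2 → ℝ := fun x => Real.exp (u x₀ - u x)
  have sρ : ContDiffOn ℝ ∞ ρ B := (contDiffOn_const.sub su).exp
  have dρ : ∀ x ∈ B, ∀ v, fderiv ℝ ρ x v = - (ρ x * fderiv ℝ u x v) := fun x hx v => by
    have := (((hb.differentiableAt_of_mem su hx).hasFDerivAt.const_sub (u x₀)).exp).fderiv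
    change fderiv ℝ ρ x = _ at this
    rw [this]
    simp [ρ]
  have ρX : ∀ x ∈ B, fderiv ℝ ρ x (X x) = ρ x * geodCurv F Y X x := fun x hx => by
    rw [dρ x hx, (hu x hx).1]; simp
  have ρY : ∀ x ∈ B, fderiv ℝ ρ x (Y x) = ρ x * geodCurv F X Y x := fun x hx => by
    rw [dρ x hx, (hu x hx).2]; simp
  have ρpos : ∀ x, 0 < ρ x := fun x => Real.exp_pos _
  obtain ⟨s, ss, hs⟩ := hb.exists_primitive hBc (a := ρ) (b := fun _ => 0) sρ contDiffOn_const
    fun x hx => by rw [ρY x hx]; simp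
  obtain ⟨t, st, ht⟩ := hb.exists_primitive hBc (a := fun _ => 0) (b := ρ) contDiffOn_const sρ
    fun x hx => by rw [ρX x hx]; simp
  let H : E 2 → ℝ × ℝ := fun x => (s x, t x)
  have sH : ContDiffOn ℝ ∞ H B := ss.prodMk st
  have hH : ∀ x ∈ B, ∃ L : E 2 ≃L[ℝ] ℝ × ℝ, HasFDerivAt H (L : E 2 →L[ℝ] ℝ × ℝ) x ∧
      L.symm (1, 0) = (ρ x)⁻¹ • X x ∧ L.symm (0, 1) = (ρ x)⁻¹ • Y x := fun x hx => by
    have hρ := (ρpos x).ne'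
    let f₂ : ℝ × ℝ →L[ℝ] E 2 :=
      (ContinuousLinearMap.fst ℝ ℝ ℝ).smulRight ((ρ x)⁻¹ • X x)
        + (ContinuousLinearMap.snd ℝ ℝ ℝ).smulRight ((ρ x)⁻¹ • Y x)
    have l : Function.LeftInverse f₂ ((fderiv ℝ s x).prod (fderiv ℝ t x)) := fun v => by
      rw [hb.decomp hx v]
      simp [f₂, (hs x hx).1, (hs x hx).2, (ht x hx).1, (ht x hx).2, smul_smul, hρ]
    have r : Function.RightInverse f₂ ((fderiv ℝ s x).prod (fderiv ℝ t x)) := fun z => by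
      simp [f₂, (hs x hx).1, (hs x hx).2, (ht x hx).1, (ht x hx).2, hρ]
    refine ⟨ContinuousLinearEquiv.equivOfInverse _ f₂ l r, ?_, ?_, ?_⟩
    · exact (hb.differentiableAt_of_mem ss hx).hasFDerivAt.prodMk
        (hb.differentiableAt_of_mem st hx).hasFDerivAt
    · change f₂ (1, 0) = _
      simp [f₂]
    · change f₂ (0, 1) = _
      simp [f₂]
  obtain ⟨L₀, hL₀, -, -⟩ := hH x₀ hx₀B
  have cH : ContDiffAt ℝ ∞ H x₀ := sH.contDiffAt (hBo.mem_nhds hx₀B)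
  let Φ := cH.toOpenPartialHomeomorph H hL₀ (by simp)
  have hΦ : ∀ x, Φ x = H x := fun x => rfl
  have hxs : x₀ ∈ Φ.source := cH.mem_toOpenPartialHomeomorph_source hL₀ (by simp)
  have hO : IsOpen (Φ.target ∩ Φ.symm ⁻¹' B) := Φ.isOpen_inter_preimage_symm hBo
  have hmem : H x₀ ∈ Φ.target ∩ Φ.symm ⁻¹' B :=
    ⟨Φ.map_source hxs, by change Φ.symm (Φ x₀) ∈ B; rw [Φ.left_inv hxs]; exact hx₀B⟩
  obtain ⟨δ, hδ, hball⟩ := Metric.mem_nhds_iff.1 (hO.mem_nhds hmem)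
  -- Balls of the sup metric on ℝ × ℝ are products of intervals, which gives the domain `J₁ × J₂`.
  have hbox : Metric.ball (H x₀) δ = Metric.ball (s x₀) δ ×ˢ Metric.ball (t x₀) δ :=
    (ball_prod_same (s x₀) (t x₀) δ).symm
  rw [hbox] at hball
  have hboxo : IsOpen (Metric.ball (s x₀) δ ×ˢ Metric.ball (t x₀) δ) :=
    Metric.isOpen_ball.prod Metric.isOpen_ball
  let φ := Φ.symm.restrOpen _ hboxo
  have hsrc : φ.source = Metric.ball (s x₀) δ ×ˢ Metric.ball (t x₀) δ := by
    rw [Φ.symm.restrOpen_source]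
    exact inter_eq_right.2 fun z hz => (hball hz).1
  have hφ : ∀ z, φ z = Φ.symm z := fun z => rfl
  have hφB : ∀ z ∈ φ.source, φ z ∈ B := fun z hz => (hball (hsrc ▸ hz)).2
  have htgt : φ.target ⊆ B := fun x hx => by
    rw [← φ.right_inv hx]; exact hφB _ (φ.map_target hx)
  have hx₀t : x₀ ∈ φ.target := by
    have : H x₀ ∈ φ.source := by
      rw [hsrc, ← hbox]; exact Metric.mem_ball_self hδ
    have := φ.map_source this
    rwa [hφ, ← hΦ, Φ.left_inv hxs] at this
  refine ⟨ρ, _, _, φ, ⟨Metric.isOpen_ball, (convex_ball (s x₀) δ).ordConnected,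
    Metric.isOpen_ball, (convex_ball (t x₀) δ).ordConnected, hsrc, ?_, ?_,
    hb.mono φ.open_target htgt, sρ.mono htgt,
    fun x _ => ρpos x, fun x hx => ρX x (htgt hx), fun x hx => ρY x (htgt hx), ?_, ?_⟩,
    htgt.trans hB, hx₀t, by simp [ρ]⟩
  · intro z hz
    obtain ⟨L, hL, -, -⟩ := hH _ (hφB z hz)
    exact (Φ.contDiffAt_symm (hball (hsrc ▸ hz)).1 hL
      (sH.contDiffAt (hBo.mem_nhds (hφB z hz)))).contDiffWithinAt
  · exact sH.mono htgt
  · intro z hz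
    obtain ⟨L, hL, h1, -⟩ := hH _ (hφB z hz)
    have := Φ.hasFDerivAt_symm (hball (hsrc ▸ hz)).1 hL
    change fderiv ℝ Φ.symm z (1, 0) = _
    rw [this.fderiv]; exact h1
  · intro z hz
    obtain ⟨L, hL, -, h2⟩ := hH _ (hφB z hz)
    have := Φ.hasFDerivAt_symm (hball (hsrc ▸ hz)).1 hL
    change fderiv ℝ Φ.symm z (0, 1) = _
    rw [this.fderiv]; exact h2

end Coordinates

/-! ### Functions of two variables that split as a sum. -/

section Nets

/-- `u` is, on the product `J₁ × J₂`, the sum of a function of the first and a function of the second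
variable. -/
def Splits {G : Type*} [AddCommGroup G] (J₁ J₂ : Set ℝ) (u : ℝ × ℝ → G) : Prop :=
  ∀ s ∈ J₁, ∀ s' ∈ J₁, ∀ t ∈ J₂, ∀ t' ∈ J₂, u (s, t) + u (s', t') = u (s, t') + u (s', t)

variable {G : Type*} [NormedAddCommGroup G] [NormedSpace ℝ G]

theorem eq_of_hasDerivAt_zero {J : Set ℝ} (hJ : J.OrdConnected) {u : ℝ → G}
    (hu : ∀ s ∈ J, HasDerivAt u 0 s) {s s' : ℝ} (hs : s ∈ J) (hs' : s' ∈ J) : u s = u s' := by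
  have := Convex.norm_image_sub_le_of_norm_hasDerivWithin_le (C := 0) (s := J) (f := u)
    (f' := fun _ => 0) (fun x hx => (hu x hx).hasDerivWithinAt) (by simp) hJ.convex hs' hs
  rw [zero_mul] at this
  exact sub_eq_zero.1 (norm_le_zero_iff.1 this)

/-- The mixed derivative vanishes: w = ∂u/∂t is constant in s, so the differences u(s, ·) - u(s', ·)
are constant in t. -/
theorem splits_of_hasDerivAt {J₁ J₂ : Set ℝ} (h₁ : J₁.OrdConnected) (h₂ : J₂.OrdConnected)
    {u w : ℝ × ℝ → G}
    (hu : ∀ s ∈ J₁, ∀ t ∈ J₂, HasDerivAt (fun t => u (s, t)) (w (s, t)) t)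
    (hw : ∀ s ∈ J₁, ∀ t ∈ J₂, HasDerivAt (fun s => w (s, t)) 0 s) : Splits J₁ J₂ u := by
  intro s hs s' hs' t ht t' ht'
  have h0 : ∀ t ∈ J₂, HasDerivAt (fun t => u (s, t) - u (s', t)) 0 t := fun t ht => by
    have e : w (s, t) = w (s', t) := eq_of_hasDerivAt_zero h₁ (fun s hs => hw s hs t ht) hs hs'
    have := (hu s hs t ht).sub (hu s' hs' t ht)
    rw [e, sub_self] at this
    exact this
  have := eq_of_hasDerivAt_zero h₂ h0 ht ht'
  rw [sub_eq_sub_iff_add_eq_add] at this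
  exact this

variable {N : ℕ}

/-- A net `g` that is conformal with factor `1 / ρ` and such that `ρ`, `ρ g` and `ρ ‖g‖²` are sums
of a function of `s` and a function of `t`. -/
structure IsSplitNet (J₁ J₂ : Set ℝ) (g : ℝ × ℝ → E N) (ρ : ℝ × ℝ → ℝ) : Prop where
  isOpen_fst : IsOpen J₁
  ordConnected_fst : J₁.OrdConnected
  isOpen_snd : IsOpen J₂
  ordConnected_snd : J₂.OrdConnected
  contDiffOn : ContDiffOn ℝ ∞ g (J₁ ×ˢ J₂)
  contDiffOn_factor : ContDiffOn ℝ ∞ ρ (J₁ ×ˢ J₂)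
  factor_pos : ∀ z ∈ J₁ ×ˢ J₂, 0 < ρ z
  inner_fst : ∀ z ∈ J₁ ×ˢ J₂,
    inner ℝ (fderiv ℝ g z (1, 0)) (fderiv ℝ g z (1, 0)) = (ρ z ^ 2)⁻¹
  inner_snd : ∀ z ∈ J₁ ×ˢ J₂,
    inner ℝ (fderiv ℝ g z (0, 1)) (fderiv ℝ g z (0, 1)) = (ρ z ^ 2)⁻¹
  inner_fst_snd : ∀ z ∈ J₁ ×ˢ J₂, inner ℝ (fderiv ℝ g z (1, 0)) (fderiv ℝ g z (0, 1)) = 0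
  splits_factor : Splits J₁ J₂ ρ
  splits_smul : Splits J₁ J₂ fun z => ρ z • g z
  splits_mul_sq : Splits J₁ J₂ fun z => ρ z * inner ℝ (g z) (g z)

theorem hasDerivAt_fst {J₁ J₂ : Set ℝ} (h₁ : IsOpen J₁) (h₂ : IsOpen J₂) {u : ℝ × ℝ → G}
    (hu : ContDiffOn ℝ ∞ u (J₁ ×ˢ J₂)) {s t : ℝ} (hs : s ∈ J₁) (ht : t ∈ J₂) :
    HasDerivAt (fun s => u (s, t)) (fderiv ℝ u (s, t) (1, 0)) s := by
  have h1 := ((hu.differentiableOn (by simp)).differentiableAt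
    ((h₁.prod h₂).mem_nhds (mk_mem_prod hs ht))).hasFDerivAt
  have h2 : HasDerivAt (fun s : ℝ => (s, t)) ((1 : ℝ), (0 : ℝ)) s :=
    (hasDerivAt_id s).prodMk (hasDerivAt_const s t)
  exact h1.comp_hasDerivAt s h2

theorem hasDerivAt_snd {J₁ J₂ : Set ℝ} (h₁ : IsOpen J₁) (h₂ : IsOpen J₂) {u : ℝ × ℝ → G}
    (hu : ContDiffOn ℝ ∞ u (J₁ ×ˢ J₂)) {s t : ℝ} (hs : s ∈ J₁) (ht : t ∈ J₂) :
    HasDerivAt (fun t => u (s, t)) (fderiv ℝ u (s, t) (0, 1)) t := by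
  have h1 := ((hu.differentiableOn (by simp)).differentiableAt
    ((h₁.prod h₂).mem_nhds (mk_mem_prod hs ht))).hasFDerivAt
  have h2 : HasDerivAt (fun t : ℝ => (s, t)) ((0 : ℝ), (1 : ℝ)) t :=
    (hasDerivAt_const t s).prodMk (hasDerivAt_id t)
  exact h1.comp_hasDerivAt t h2

theorem contDiffOn_comp_swap {J₁ J₂ : Set ℝ} {u : ℝ × ℝ → G}
    (hu : ContDiffOn ℝ ∞ u (J₁ ×ˢ J₂)) : ContDiffOn ℝ ∞ (u ∘ Prod.swap) (J₂ ×ˢ J₁) :=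
  hu.comp (contDiff_snd.prodMk contDiff_fst).contDiffOn fun _ hz => ⟨hz.2, hz.1⟩

theorem fderiv_comp_swap {J₁ J₂ : Set ℝ} (h₁ : IsOpen J₁) (h₂ : IsOpen J₂) {u : ℝ × ℝ → G}
    (hu : ContDiffOn ℝ ∞ u (J₁ ×ˢ J₂)) {z : ℝ × ℝ} (hz : z ∈ J₂ ×ˢ J₁) (v : ℝ × ℝ) :
    fderiv ℝ (u ∘ Prod.swap) z v = fderiv ℝ u z.swap v.swap := by
  have h1 := ((hu.differentiableOn (by simp)).differentiableAt
    ((h₁.prod h₂).mem_nhds (show z.swap ∈ J₁ ×ˢ J₂ from ⟨hz.2, hz.1⟩))).hasFDerivAt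
  have h2 : HasFDerivAt (Prod.swap : ℝ × ℝ → ℝ × ℝ)
      ((ContinuousLinearMap.snd ℝ ℝ ℝ).prod (ContinuousLinearMap.fst ℝ ℝ ℝ)) z :=
    hasFDerivAt_snd.prodMk hasFDerivAt_fst
  rw [(h1.comp z h2).fderiv]
  rfl

theorem Splits.comp_swap {G : Type*} [AddCommGroup G] {J₁ J₂ : Set ℝ} {u : ℝ × ℝ → G} (hu : Splits J₁ J₂ u) :
    Splits J₂ J₁ (u ∘ Prod.swap) := fun s hs s' hs' t ht t' ht' =>
  (hu t ht t' ht' s hs s' hs').trans (add_comm _ _)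

/-- The two families play symmetric roles; this lets either of them supply the spherical curve. -/
theorem IsSplitNet.comp_swap {J₁ J₂ : Set ℝ} {g : ℝ × ℝ → E N} {ρ : ℝ × ℝ → ℝ}
    (h : IsSplitNet J₁ J₂ g ρ) : IsSplitNet J₂ J₁ (g ∘ Prod.swap) (ρ ∘ Prod.swap) where
  isOpen_fst := h.isOpen_snd
  ordConnected_fst := h.ordConnected_snd
  isOpen_snd := h.isOpen_fst
  ordConnected_snd := h.ordConnected_fst
  contDiffOn := contDiffOn_comp_swap h.contDiffOn
  contDiffOn_factor := contDiffOn_comp_swap h.contDiffOn_factor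
  factor_pos z hz := h.factor_pos _ ⟨hz.2, hz.1⟩
  inner_fst z hz := by
    rw [fderiv_comp_swap h.isOpen_fst h.isOpen_snd h.contDiffOn hz]
    exact h.inner_snd _ ⟨hz.2, hz.1⟩
  inner_snd z hz := by
    rw [fderiv_comp_swap h.isOpen_fst h.isOpen_snd h.contDiffOn hz]
    exact h.inner_fst _ ⟨hz.2, hz.1⟩
  inner_fst_snd z hz := by
    rw [fderiv_comp_swap h.isOpen_fst h.isOpen_snd h.contDiffOn hz,
      fderiv_comp_swap h.isOpen_fst h.isOpen_snd h.contDiffOn hz, real_inner_comm]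
    exact h.inner_fst_snd _ ⟨hz.2, hz.1⟩
  splits_factor := h.splits_factor.comp_swap
  splits_smul := h.splits_smul.comp_swap
  splits_mul_sq := h.splits_mul_sq.comp_swap

end Nets

/-! ### The net of an isothermic chart splits. -/

section ChartNet

variable {N : ℕ} {F : E 2 → E N} {X Y : E 2 → E 2} {ρ : E 2 → ℝ} {J₁ J₂ : Set ℝ}
  {φ : OpenPartialHomeomorph (ℝ × ℝ) (E 2)}

namespace IsIsothermicChart

theorem fderiv_comp (h : IsIsothermicChart F X Y ρ J₁ J₂ φ) {G : Type*} [NormedAddCommGroup G]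
    [NormedSpace ℝ G] {u : E 2 → G} (hu : ContDiffOn ℝ ∞ u φ.target) {z : ℝ × ℝ}
    (hz : z ∈ J₁ ×ˢ J₂) (v : ℝ × ℝ) :
    fderiv ℝ (u ∘ φ) z v = fderiv ℝ u (φ z) (fderiv ℝ φ z v) := by
  rw [← h.source_eq] at hz
  rw [_root_.fderiv_comp z (h.frame.differentiableAt_of_mem hu (φ.map_source hz))
    ((h.contDiffOn.differentiableOn (by simp)).differentiableAt (φ.open_source.mem_nhds hz))]
  rfl

theorem contDiffOn_comp (h : IsIsothermicChart F X Y ρ J₁ J₂ φ) {G : Type*} [NormedAddCommGroup G]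
    [NormedSpace ℝ G] {u : E 2 → G} (hu : ContDiffOn ℝ ∞ u φ.target) :
    ContDiffOn ℝ ∞ (u ∘ φ) (J₁ ×ˢ J₂) := by
  rw [← h.source_eq]
  exact hu.comp h.contDiffOn fun z hz => φ.map_source hz

/-- In the chart ∂_s = ρ⁻¹X and ∂_t = ρ⁻¹Y, so the hypotheses say ∂_t u = w and ∂_s w = 0. -/
theorem splits (h : IsIsothermicChart F X Y ρ J₁ J₂ φ) {G : Type*} [NormedAddCommGroup G]
    [NormedSpace ℝ G] {u w : E 2 → G} (hu : ContDiffOn ℝ ∞ u φ.target)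
    (hw : ContDiffOn ℝ ∞ w φ.target) (huw : ∀ x ∈ φ.target, fderiv ℝ u x (Y x) = ρ x • w x)
    (hw0 : ∀ x ∈ φ.target, fderiv ℝ w x (X x) = 0) : Splits J₁ J₂ (u ∘ φ) := by
  have hmem : ∀ s ∈ J₁, ∀ t ∈ J₂, (s, t) ∈ φ.source := fun s hs t ht => by
    rw [h.source_eq]; exact mk_mem_prod hs ht
  refine splits_of_hasDerivAt (w := w ∘ φ) h.ordConnected_fst h.ordConnected_snd
    (fun s hs t ht => ?_) (fun s hs t ht => ?_)
  · have := hasDerivAt_snd h.isOpen_fst h.isOpen_snd (h.contDiffOn_comp hu) hs ht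
    have hx := φ.map_source (hmem s hs t ht)
    rwa [h.fderiv_comp hu (mk_mem_prod hs ht), h.fderiv_snd _ (hmem s hs t ht), map_smul, huw _ hx,
      smul_smul, inv_mul_cancel₀ (h.factor_pos _ hx).ne', one_smul] at this
  · have := hasDerivAt_fst h.isOpen_fst h.isOpen_snd (h.contDiffOn_comp hw) hs ht
    have hx := φ.map_source (hmem s hs t ht)
    rwa [h.fderiv_comp hw (mk_mem_prod hs ht), h.fderiv_fst _ (hmem s hs t ht), map_smul, hw0 _ hx,
      smul_zero] at this

/-- With Yρ = ρk₁, the t-derivatives of ρ, ρF, ρ‖F‖² are k₁, k₁F + F_*Y, k₁‖F‖² + 2⟨F, F_*Y⟩. Along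
X all terms cancel, by X k₁ = 0, D_X(F_*Y) = -k₁F_*X and F_*X ⟂ F_*Y. -/
theorem isSplitNet (h : IsIsothermicChart F X Y ρ J₁ J₂ φ)
    (hX : ∀ x ∈ φ.target, fderiv ℝ (geodCurv F X Y) x (X x) = 0) :
    IsSplitNet J₁ J₂ (F ∘ φ) (ρ ∘ φ) := by
  have hF := h.frame.smooth
  have hk := h.frame.contDiffOn_geodCurv
  have hE := h.frame.contDiffOn_snd
  have dF := fun x (hx : x ∈ φ.target) => h.frame.differentiableAt_of_mem hF hx
  have dk := fun x (hx : x ∈ φ.target) => h.frame.differentiableAt_of_mem hk hx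
  have dE := fun x (hx : x ∈ φ.target) => h.frame.differentiableAt_of_mem hE hx
  have dρ := fun x (hx : x ∈ φ.target) => h.frame.differentiableAt_of_mem h.contDiffOn_factor hx
  have hsrc : ∀ z ∈ J₁ ×ˢ J₂, z ∈ φ.source := fun z hz => by rw [h.source_eq]; exact hz
  have e₁ : ∀ z ∈ J₁ ×ˢ J₂, fderiv ℝ (F ∘ φ) z (1, 0) = (ρ (φ z))⁻¹ • push F X (φ z) :=
    fun z hz => by rw [h.fderiv_comp hF hz, h.fderiv_fst z (hsrc z hz), map_smul]; rfl
  have e₂ : ∀ z ∈ J₁ ×ˢ J₂, fderiv ℝ (F ∘ φ) z (0, 1) = (ρ (φ z))⁻¹ • push F Y (φ z) :=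
    fun z hz => by rw [h.fderiv_comp hF hz, h.fderiv_snd z (hsrc z hz), map_smul]; rfl
  refine ⟨h.isOpen_fst, h.ordConnected_fst, h.isOpen_snd, h.ordConnected_snd,
    h.contDiffOn_comp hF, h.contDiffOn_comp h.contDiffOn_factor,
    fun z hz => h.factor_pos _ (φ.map_source (hsrc z hz)), fun z hz => ?_, fun z hz => ?_,
    fun z hz => ?_, ?_, ?_, ?_⟩
  · rw [e₁ z hz, inner_smul_left, inner_smul_right,
      h.frame.inner_fst _ (φ.map_source (hsrc z hz))]
    simp [sq]
  · rw [e₂ z hz, inner_smul_left, inner_smul_right,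
      h.frame.inner_snd _ (φ.map_source (hsrc z hz))]
    simp [sq]
  · rw [e₁ z hz, e₂ z hz, inner_smul_left, inner_smul_right,
      h.frame.inner_fst_snd _ (φ.map_source (hsrc z hz))]
    simp
  · exact h.splits h.contDiffOn_factor hk h.fderiv_factor_snd hX
  · refine h.splits (u := fun x => ρ x • F x) (w := fun x => geodCurv F X Y x • F x + push F Y x)
      (h.contDiffOn_factor.smul hF) ((hk.smul hF).add hE) (fun x hx => ?_) (fun x hx => ?_)
    · rw [fderiv_fun_smul (dρ x hx) (dF x hx)]
      simp only [add_apply, smul_apply, ContinuousLinearMap.smulRight_apply,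
        h.fderiv_factor_snd x hx, smul_add, smul_smul]
      rw [add_comm]; rfl
    · rw [fderiv_fun_add ((dk x hx).fun_smul (dF x hx)) (dE x hx), fderiv_fun_smul (dk x hx) (dF x hx)]
      simp only [add_apply, smul_apply, ContinuousLinearMap.smulRight_apply, hX x hx,
        h.frame.fderiv_snd_fst hx, zero_smul, add_zero]
      simp [push]
  · refine h.splits (u := fun x => ρ x * inner ℝ (F x) (F x))
      (w := fun x => geodCurv F X Y x * inner ℝ (F x) (F x) + 2 * inner ℝ (F x) (push F Y x))
      (h.contDiffOn_factor.mul (hF.inner ℝ hF))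
      ((hk.mul (hF.inner ℝ hF)).add (contDiffOn_const.mul (hF.inner ℝ hE)))
      (fun x hx => ?_) (fun x hx => ?_)
    · rw [fderiv_fun_mul (dρ x hx) ((dF x hx).inner ℝ (dF x hx))]
      simp only [add_apply, smul_apply, fderiv_real_inner (dF x hx) (dF x hx),
        h.fderiv_factor_snd x hx, smul_eq_mul, push]
      rw [real_inner_comm (F x)]
      ring
    · rw [fderiv_fun_add ((dk x hx).fun_mul ((dF x hx).inner ℝ (dF x hx)))
        (((dF x hx).inner ℝ (dE x hx)).const_mul 2),
        fderiv_fun_mul (dk x hx) ((dF x hx).inner ℝ (dF x hx)),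
        fderiv_const_mul ((dF x hx).inner ℝ (dE x hx))]
      simp only [add_apply, smul_apply, fderiv_real_inner (dF x hx) (dF x hx),
        fderiv_real_inner (dF x hx) (dE x hx), hX x hx, h.frame.fderiv_snd_fst hx, smul_eq_mul]
      have e := h.frame.inner_fst_snd x hx
      simp only [push] at e ⊢
      rw [e, real_inner_comm (F x), inner_smul_right]
      ring

end IsIsothermicChart

end ChartNet

/-! ### Products of curves in Euclidean space and their inversions. -/

section Products

variable {N : ℕ}

theorem isUnitSpeed_coord {n : ℕ} {K : Submodule ℝ (E N)} (i : K ≃ₗᵢ[ℝ] E n) {p : ℝ → E N}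
    {J : Set ℝ} (hJ : IsOpen J) (hp : ContDiffOn ℝ ∞ p J) (hpK : ∀ s ∈ J, p s ∈ K)
    (hspeed : ∀ s ∈ J, ‖deriv p s‖ = 1) :
    IsUnitSpeed (fun s => i (K.orthogonalProjectionOnto (p s))) J := by
  let Λ : E N →L[ℝ] E n := (i : K →L[ℝ] E n).comp K.orthogonalProjectionOnto
  have hs : ContDiffOn ℝ ∞ (fun s => Λ (p s)) J := Λ.contDiff.comp_contDiffOn hp
  refine ⟨hs, fun s hsJ => ?_⟩
  let j : E n →L[ℝ] E N := K.subtypeL.comp (i.symm : E n →L[ℝ] K)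
  have hj : ∀ v, ‖j v‖ = ‖v‖ := fun v => by
    change ‖((i.symm v : K) : E N)‖ = ‖v‖
    rw [Submodule.norm_coe, i.symm.norm_map]
  have hd := ((hs.differentiableOn (by simp)).differentiableAt (hJ.mem_nhds hsJ)).hasDerivAt
  have hd' := j.hasFDerivAt.comp_hasDerivAt s hd
  have e : p =ᶠ[𝓝 s] fun s => j (Λ (p s)) := by
    filter_upwards [hJ.mem_nhds hsJ] with u hu
    change p u = ((i.symm (i (K.orthogonalProjectionOnto (p u))) : K) : E N)
    rw [i.symm_apply_apply]
    exact (Submodule.starProjection_eq_self_iff.2 (hpK u hu)).symm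
  have := (hd'.congr_of_eventuallyEq e).deriv
  change ‖deriv (fun s => Λ (p s)) s‖ = 1
  rw [← hj, ← this]
  exact hspeed s hsJ

/-- A net of the form `g₀ + p(s) + q(t)` with orthonormal derivatives is a product of two curves of
unit speed. -/
theorem exists_product {J₁ J₂ : Set ℝ} (h₁ : IsOpen J₁) (c₁ : J₁.OrdConnected) (h₂ : IsOpen J₂)
    (c₂ : J₂.OrdConnected) {s₀ t₀ : ℝ} (hs₀ : s₀ ∈ J₁) (ht₀ : t₀ ∈ J₂) {g : ℝ × ℝ → E N}
    (hg : ContDiffOn ℝ ∞ g (J₁ ×ˢ J₂)) (hsplit : Splits J₁ J₂ g)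
    (hfst : ∀ z ∈ J₁ ×ˢ J₂, inner ℝ (fderiv ℝ g z (1, 0)) (fderiv ℝ g z (1, 0)) = 1)
    (hsnd : ∀ z ∈ J₁ ×ˢ J₂, inner ℝ (fderiv ℝ g z (0, 1)) (fderiv ℝ g z (0, 1)) = 1)
    (hort : ∀ z ∈ J₁ ×ˢ J₂, inner ℝ (fderiv ℝ g z (1, 0)) (fderiv ℝ g z (0, 1)) = 0) :
    ∃ (N₁ N₂ : ℕ) (Φ : WithLp 2 (E N₁ × E N₂) ≃ᵢ E N) (α : ℝ → E N₁) (β : ℝ → E N₂),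
      IsUnitSpeed α J₁ ∧ IsUnitSpeed β J₂ ∧
      ∀ s ∈ J₁, ∀ t ∈ J₂, g (s, t) = Φ (WithLp.toLp 2 (α s, β t)) := by
  let p : ℝ → E N := fun s => g (s, t₀) - g (s₀, t₀)
  let q : ℝ → E N := fun t => g (s₀, t) - g (s₀, t₀)
  have hgpq : ∀ s ∈ J₁, ∀ t ∈ J₂, g (s, t) = g (s₀, t₀) + (p s + q t) := fun s hs t ht => by
    have := hsplit s hs s₀ hs₀ t ht t₀ ht₀
    rw [eq_sub_of_add_eq this]; simp only [p, q]; abel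
  have dp : ∀ s ∈ J₁, ∀ t ∈ J₂, HasDerivAt p (fderiv ℝ g (s, t) (1, 0)) s := fun s hs t ht => by
    have := (hasDerivAt_fst h₁ h₂ hg hs ht).sub_const (g (s₀, t₀) + q t)
    refine this.congr_of_eventuallyEq ?_
    filter_upwards [h₁.mem_nhds hs] with u hu
    rw [hgpq u hu t ht]; abel
  have dq : ∀ s ∈ J₁, ∀ t ∈ J₂, HasDerivAt q (fderiv ℝ g (s, t) (0, 1)) t := fun s hs t ht => by
    have := (hasDerivAt_snd h₁ h₂ hg hs ht).sub_const (g (s₀, t₀) + p s)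
    refine this.congr_of_eventuallyEq ?_
    filter_upwards [h₂.mem_nhds ht] with u hu
    rw [hgpq s hs u hu]; abel
  have sp : ContDiffOn ℝ ∞ p J₁ :=
    (hg.comp (contDiff_id.prodMk contDiff_const).contDiffOn
      fun s hs => mk_mem_prod hs ht₀).sub contDiffOn_const
  have sq : ContDiffOn ℝ ∞ q J₂ :=
    (hg.comp (contDiff_const.prodMk contDiff_id).contDiffOn
      fun t ht => mk_mem_prod hs₀ ht).sub contDiffOn_const
  have hp₀ : p s₀ = 0 := sub_self _
  have hq₀ : q t₀ = 0 := sub_self _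
  -- The velocity of p does not depend on t, nor that of q on s, so orthogonality of the velocities
  -- integrates first in t and then in s to that of the curves.
  have hpq : ∀ s ∈ J₁, ∀ t ∈ J₂, inner ℝ (p s) (q t) = 0 := by
    have step : ∀ s ∈ J₁, ∀ t ∈ J₂, inner ℝ (fderiv ℝ g (s, t₀) (1, 0)) (q t) = 0 :=
      fun s hs t ht => by
        have := eq_of_hasDerivAt_zero c₂
          (u := fun t => inner ℝ (fderiv ℝ g (s, t₀) (1, 0)) (q t)) (fun t ht => by
            have h := (hasDerivAt_const t (fderiv ℝ g (s, t₀) (1, 0))).inner ℝ (dq s hs t ht)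
            rw [(dp s hs t₀ ht₀).unique (dp s hs t ht), hort _ (mk_mem_prod hs ht)] at h
            rw [(dp s hs t₀ ht₀).unique (dp s hs t ht)]
            simpa using h) ht ht₀
        simpa [hq₀] using this
    intro s hs t ht
    have := eq_of_hasDerivAt_zero c₁ (u := fun s => inner ℝ (p s) (q t)) (fun s hs => by
      have h := (dp s hs t₀ ht₀).inner ℝ (hasDerivAt_const s (q t))
      rw [step s hs t ht] at h
      simpa using h) hs hs₀
    simpa [hp₀] using this
  -- The two Euclidean factors are the span of p and its orthogonal complement, which contains q.
  let K : Submodule ℝ (E N) := Submodule.span ℝ (p '' J₁)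
  have hpK : ∀ s ∈ J₁, p s ∈ K := fun s hs => Submodule.subset_span (mem_image_of_mem p hs)
  have hqK : ∀ t ∈ J₂, q t ∈ Kᗮ := fun t ht => by
    rw [Submodule.mem_orthogonal]
    intro u hu
    induction hu using Submodule.span_induction with
    | mem x hx => obtain ⟨s, hs, rfl⟩ := hx; exact hpq s hs t ht
    | zero => simp
    | add x y _ _ hx hy => rw [inner_add_left, hx, hy, add_zero]
    | smul a x _ hx => rw [inner_smul_left, hx, mul_zero]
  let i₁ := (stdOrthonormalBasis ℝ K).repr
  let i₂ := (stdOrthonormalBasis ℝ Kᗮ).repr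
  let Φ := ((LinearIsometryEquiv.withLpProdCongr 2 i₁.symm i₂.symm).trans
    K.orthogonalDecomposition.symm).toIsometryEquiv.trans (IsometryEquiv.addLeft (g (s₀, t₀)))
  refine ⟨_, _, Φ, fun s => i₁ (K.orthogonalProjectionOnto (p s)),
    fun t => i₂ (Kᗮ.orthogonalProjectionOnto (q t)),
    isUnitSpeed_coord i₁ h₁ sp hpK fun s hs => ?_, isUnitSpeed_coord i₂ h₂ sq hqK fun t ht => ?_,
    fun s hs t ht => ?_⟩
  · rw [(dp s hs t₀ ht₀).deriv, norm_eq_sqrt_real_inner, hfst _ (mk_mem_prod hs ht₀), Real.sqrt_one]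
  · rw [(dq s₀ hs₀ t ht).deriv, norm_eq_sqrt_real_inner, hsnd _ (mk_mem_prod hs₀ ht), Real.sqrt_one]
  · rw [hgpq s hs t ht]
    change _ = g (s₀, t₀) + K.orthogonalDecomposition.symm (WithLp.toLp 2
      (i₁.symm (i₁ (K.orthogonalProjectionOnto (p s))),
        i₂.symm (i₂ (Kᗮ.orthogonalProjectionOnto (q t)))))
    rw [i₁.symm_apply_apply, i₂.symm_apply_apply]
    congr 1
    rw [LinearIsometryEquiv.eq_symm_apply, Submodule.orthogonalDecomposition_apply, map_add, map_add,
      Submodule.orthogonalProjectionOnto_eq_zero_iff.2 (hqK t ht),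
      Submodule.orthogonalProjectionOnto_eq_zero_iff.2
        (K.le_orthogonal_orthogonal (hpK s hs)), add_zero, zero_add]

/-- `g` is the composition of a product of two curves of unit speed with an inversion. -/
def IsInvertedProduct (J₁ J₂ : Set ℝ) (g : ℝ × ℝ → E N) : Prop :=
  ∃ (N₁ N₂ : ℕ) (Φ : WithLp 2 (E N₁ × E N₂) ≃ᵢ E N) (I : E N → E N)
      (α : ℝ → E N₁) (β : ℝ → E N₂),
      IsUnitSpeed α J₁ ∧ IsUnitSpeed β J₂ ∧
      IsInversionOn I {x | ∃ s ∈ J₁, ∃ t ∈ J₂, x = Φ (WithLp.toLp 2 (α s, β t))} ∧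
      ∀ s ∈ J₁, ∀ t ∈ J₂, g (s, t) = I (Φ (WithLp.toLp 2 (α s, β t)))

/-- Here g is already a product of curves. The required inversion is a hyperplane reflection, undone
by absorbing the same reflection into the isometry. -/
theorem IsSplitNet.isInvertedProduct_of_factor_eq_one {J₁ J₂ : Set ℝ} {g : ℝ × ℝ → E N}
    {ρ : ℝ × ℝ → ℝ} (h : IsSplitNet J₁ J₂ g ρ) {z₀ : ℝ × ℝ} (hz₀ : z₀ ∈ J₁ ×ˢ J₂)
    (hρ : ∀ z ∈ J₁ ×ˢ J₂, ρ z = 1) : IsInvertedProduct J₁ J₂ g := by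
  have hsplit : Splits J₁ J₂ g := fun s hs s' hs' t ht t' ht' => by
    have := h.splits_smul s hs s' hs' t ht t' ht'
    simpa only [hρ _ (mk_mem_prod hs ht), hρ _ (mk_mem_prod hs' ht'), hρ _ (mk_mem_prod hs ht'),
      hρ _ (mk_mem_prod hs' ht), one_smul] using this
  obtain ⟨N₁, N₂, Φ, α, β, hα, hβ, hg⟩ := exists_product h.isOpen_fst h.ordConnected_fst
    h.isOpen_snd h.ordConnected_snd hz₀.1 hz₀.2 h.contDiffOn hsplit
    (fun z hz => by rw [h.inner_fst z hz, hρ z hz]; norm_num)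
    (fun z hz => by rw [h.inner_snd z hz, hρ z hz]; norm_num) h.inner_fst_snd
  -- The tangent vector serves only as some unit vector of ℝ^N.
  let v := fderiv ℝ g z₀ (1, 0)
  have hv : inner ℝ v v = 1 := by rw [h.inner_fst z₀ hz₀, hρ z₀ hz₀]; norm_num
  have hv1 : ‖v‖ = 1 := by rw [norm_eq_sqrt_real_inner, hv, Real.sqrt_one]
  let R := (ℝ ∙ v)ᗮ.reflection
  have hR : ∀ x, R x = x - (2 * inner ℝ v x) • v := fun x => by
    simp only [R]
    rw [Submodule.reflection_orthogonal_apply, Submodule.reflection_singleton_apply, hv1]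
    simp [two_smul, two_mul, add_smul]
  refine ⟨N₁, N₂, Φ.trans R.toIsometryEquiv, fun x => x - (2 * inner ℝ v (x - 0)) • v, α, β, hα, hβ,
    Or.inr ⟨0, v, hv1, rfl⟩, fun s hs t ht => ?_⟩
  have : R (R (Φ (WithLp.toLp 2 (α s, β t)))) = _ - _ := hR _
  rw [Submodule.reflection_reflection] at this
  rw [hg s hs t ht]
  simp only [sub_zero]
  exact this

/-- Since ρ = κ/‖g - y‖², the inversion of radius √κ at y takes g to y + ρ(g - y). This splits
because ρ and ρg do, and its metric is flat because the inversion scales lengths by exactly ρ. -/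
theorem IsSplitNet.isInvertedProduct_of_center {J₁ J₂ : Set ℝ} {g : ℝ × ℝ → E N}
    {ρ : ℝ × ℝ → ℝ} (h : IsSplitNet J₁ J₂ g ρ) {z₀ : ℝ × ℝ} (hz₀ : z₀ ∈ J₁ ×ˢ J₂) {y : E N} {κ : ℝ}
    (hκ : 0 < κ) (hy : ∀ z ∈ J₁ ×ˢ J₂, ρ z * inner ℝ (g z - y) (g z - y) = κ) :
    IsInvertedProduct J₁ J₂ g := by
  have hopen := h.isOpen_fst.prod h.isOpen_snd
  let G : ℝ × ℝ → E N := fun z => y + ρ z • (g z - y)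
  have hG : ContDiffOn ℝ ∞ G (J₁ ×ˢ J₂) :=
    contDiffOn_const.add (h.contDiffOn_factor.smul (h.contDiffOn.sub contDiffOn_const))
  have hsplit : Splits J₁ J₂ G := fun s hs s' hs' t ht t' ht' => by
    have e1 := h.splits_smul s hs s' hs' t ht t' ht'
    have e2 := congrArg (fun r : ℝ => r • y) (h.splits_factor s hs s' hs' t ht t' ht')
    simp only [add_smul] at e2
    simp only [G, smul_sub]
    have e3 := congrArg₂ (fun a b => a - b) e1 e2
    simp only at e3
    calc _ = y + y + (ρ (s, t) • g (s, t) + ρ (s', t') • g (s', t')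
          - (ρ (s, t) • y + ρ (s', t') • y)) := by abel
      _ = _ := by rw [e3]; abel
  have dg : ∀ z ∈ J₁ ×ˢ J₂, DifferentiableAt ℝ g z := fun z hz =>
    (h.contDiffOn.differentiableOn (by simp)).differentiableAt (hopen.mem_nhds hz)
  have dρ : ∀ z ∈ J₁ ×ˢ J₂, DifferentiableAt ℝ ρ z := fun z hz =>
    (h.contDiffOn_factor.differentiableOn (by simp)).differentiableAt (hopen.mem_nhds hz)
  have dG : ∀ z ∈ J₁ ×ˢ J₂, ∀ v, fderiv ℝ G z v
      = fderiv ℝ ρ z v • (g z - y) + ρ z • fderiv ℝ g z v := fun z hz v => by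
    have := (((dρ z hz).hasFDerivAt.smul ((dg z hz).hasFDerivAt.sub_const y)).const_add y).fderiv
    change fderiv ℝ G z = _ at this
    rw [this]
    simp [add_comm]
  -- The differentiated constraint; it cancels the terms with dρ in the metric of G.
  have hcon : ∀ z ∈ J₁ ×ˢ J₂, ∀ v, fderiv ℝ ρ z v * inner ℝ (g z - y) (g z - y)
      + 2 * (ρ z * inner ℝ (g z - y) (fderiv ℝ g z v)) = 0 := fun z hz v => by
    have dgy : HasFDerivAt (fun z => g z - y) (fderiv ℝ g z) z := (dg z hz).hasFDerivAt.sub_const y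
    have h1 := (dρ z hz).hasFDerivAt.mul (dgy.inner ℝ dgy)
    have e : (ρ * fun z => inner ℝ (g z - y) (g z - y)) =ᶠ[𝓝 z] fun _ => κ := by
      filter_upwards [hopen.mem_nhds hz] with u hu using hy u hu
    have h2 := h1.unique ((hasFDerivAt_const κ z).congr_of_eventuallyEq e)
    have h3 := congrArg (fun T => T v) h2
    simp [fderivInnerCLM_apply] at h3
    rw [real_inner_comm (g z - y) (fderiv ℝ g z v)] at h3
    rw [real_inner_self_eq_norm_sq]
    linarith
  have hGG : ∀ z ∈ J₁ ×ˢ J₂, ∀ u v, inner ℝ (fderiv ℝ G z u) (fderiv ℝ G z v)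
      = ρ z ^ 2 * inner ℝ (fderiv ℝ g z u) (fderiv ℝ g z v) := fun z hz u v => by
    have hu := hcon z hz u
    have hv := hcon z hz v
    rw [dG z hz, dG z hz]
    simp only [inner_add_left, inner_add_right, inner_smul_left, inner_smul_right,
      RCLike.conj_to_real]
    rw [real_inner_comm (g z - y) (fderiv ℝ g z u)]
    linear_combination (fderiv ℝ ρ z v / 2) * hu + (fderiv ℝ ρ z u / 2) * hv
  have hρ : ∀ z ∈ J₁ ×ˢ J₂, ρ z ^ 2 * (ρ z ^ 2)⁻¹ = 1 := fun z hz =>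
    mul_inv_cancel₀ (pow_ne_zero _ (h.factor_pos z hz).ne')
  obtain ⟨N₁, N₂, Φ, α, β, hα, hβ, hg⟩ := exists_product h.isOpen_fst h.ordConnected_fst
    h.isOpen_snd h.ordConnected_snd hz₀.1 hz₀.2 hG hsplit
    (fun z hz => by rw [hGG z hz, h.inner_fst z hz, hρ z hz])
    (fun z hz => by rw [hGG z hz, h.inner_snd z hz, hρ z hz])
    (fun z hz => by rw [hGG z hz, h.inner_fst_snd z hz, mul_zero])
  have hne : ∀ z ∈ J₁ ×ˢ J₂, g z - y ≠ 0 := fun z hz h0 => by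
    have := hy z hz
    rw [h0, inner_zero_left, mul_zero] at this
    exact hκ.ne this
  have hinv : ∀ z ∈ J₁ ×ˢ J₂, EuclideanGeometry.inversion y (√κ) (g z) = G z := fun z hz => by
    have h1 : ‖g z - y‖ ≠ 0 := norm_ne_zero_iff.2 (hne z hz)
    have h2 : (√κ / dist (g z) y) ^ 2 = ρ z := by
      rw [div_pow, Real.sq_sqrt hκ.le, dist_eq_norm, ← hy z hz, real_inner_self_eq_norm_sq]
      field_simp
    simp only [EuclideanGeometry.inversion, h2, G, vsub_eq_sub, vadd_eq_add]
    rw [add_comm]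
  refine ⟨N₁, N₂, Φ, EuclideanGeometry.inversion y (√κ), α, β, hα, hβ,
    Or.inl ⟨y, √κ, Real.sqrt_pos.2 hκ, ?_, rfl⟩, fun s hs t ht => ?_⟩
  · rintro ⟨s, hs, t, ht, hyst⟩
    have hz := mk_mem_prod hs ht
    rw [← hg s hs t ht] at hyst
    have : ρ (s, t) • (g (s, t) - y) = 0 := by
      simpa only [G, left_eq_add] using hyst
    rcases smul_eq_zero.1 this with h0 | h0
    · exact (h.factor_pos _ hz).ne' h0
    · exact hne _ hz h0
  · rw [← hg s hs t ht, ← hinv _ (mk_mem_prod hs ht),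
      EuclideanGeometry.inversion_inversion y (Real.sqrt_pos.2 hκ).ne']

end Products

/-! ### Linear algebra in Minkowski space and flat nets in the light cone. -/

section Lorentz

variable {n : ℕ}

/-- The Lorentz scalar product as a bilinear form. -/
def lorForm (n : ℕ) : LinearMap.BilinForm ℝ (L n) :=
  LinearMap.mk₂ ℝ lor
    (fun X X' Y => by simp only [lor, Prod.fst_add, Prod.snd_add, inner_add_left]; ring)
    (fun a X Y => by
      simp only [lor, Prod.smul_fst, Prod.smul_snd, inner_smul_left, RCLike.conj_to_real,
        smul_eq_mul]
      ring)
    (fun X Y Y' => by simp only [lor, Prod.fst_add, Prod.snd_add, inner_add_right]; ring)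
    (fun a X Y => by
      simp only [lor, Prod.smul_fst, Prod.smul_snd, inner_smul_right, smul_eq_mul]; ring)

theorem lorForm_apply (X Y : L n) : lorForm n X Y = lor X Y := rfl

theorem lor_comm (X Y : L n) : lor X Y = lor Y X := by
  simp only [lor, real_inner_comm X.1 Y.1, mul_comm X.2]

theorem lor_add_left (X X' Y : L n) : lor (X + X') Y = lor X Y + lor X' Y :=
  (lorForm n).map_add₂ X X' Y

theorem lor_add_right (X Y Y' : L n) : lor X (Y + Y') = lor X Y + lor X Y' :=
  (lorForm n X).map_add Y Y'

theorem lor_sub_left (X X' Y : L n) : lor (X - X') Y = lor X Y - lor X' Y :=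
  (lorForm n).map_sub₂ X X' Y

theorem lor_sub_right (X Y Y' : L n) : lor X (Y - Y') = lor X Y - lor X Y' :=
  (lorForm n X).map_sub Y Y'

theorem lor_smul_left (a : ℝ) (X Y : L n) : lor (a • X) Y = a * lor X Y :=
  (lorForm n).map_smul₂ a X Y

theorem lor_smul_right (a : ℝ) (X Y : L n) : lor X (a • Y) = a * lor X Y :=
  (lorForm n X).map_smul a Y

theorem lor_neg_left (X Y : L n) : lor (-X) Y = -lor X Y := (lorForm n).map_neg₂ X Y

theorem lor_neg_right (X Y : L n) : lor X (-Y) = -lor X Y := (lorForm n X).map_neg Y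

theorem lor_zero_left (Y : L n) : lor 0 Y = 0 := (lorForm n).map_zero₂ Y

theorem lor_eq_zero_of_mem_span {A : Set (L n)} {v : L n} (h : ∀ x ∈ A, lor x v = 0) {u : L n}
    (hu : u ∈ Submodule.span ℝ A) : lor u v = 0 := by
  induction hu using Submodule.span_induction with
  | mem x hx => exact h x hx
  | zero => exact lor_zero_left _
  | add x y _ _ hx hy => rw [lor_add_left, hx, hy, add_zero]
  | smul a x _ hx => rw [lor_smul_left, hx, mul_zero]

/-- Orthogonal causal vectors are light-like and proportional. -/
theorem smul_eq_smul_of_causal {u v : L n} (hu : lor u u ≤ 0) (hv : lor v v ≤ 0)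
    (huv : lor u v = 0) : v.2 • u = u.2 • v := by
  simp only [lor, real_inner_self_eq_norm_sq] at hu hv huv
  have h : ‖v.2 • u.1 - u.2 • v.1‖ ^ 2 ≤ 0 := by
    rw [norm_sub_sq_real, norm_smul, norm_smul, inner_smul_left, inner_smul_right, mul_pow, mul_pow,
      Real.norm_eq_abs, Real.norm_eq_abs, sq_abs, sq_abs, RCLike.conj_to_real, sub_eq_zero.1 huv]
    nlinarith [mul_nonneg (sq_nonneg v.2) (neg_nonneg.2 hu),
      mul_nonneg (sq_nonneg u.2) (neg_nonneg.2 hv)]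
  have h0 : v.2 • u.1 - u.2 • v.1 = 0 := by
    rw [← norm_eq_zero]; exact pow_eq_zero_iff (two_ne_zero) |>.1 (le_antisymm h (sq_nonneg _))
  ext1
  · exact sub_eq_zero.1 h0
  · simp [mul_comm]

theorem snd_ne_zero_of_causal {u : L n} (hu : lor u u ≤ 0) (h0 : u ≠ 0) : u.2 ≠ 0 := by
  intro h
  apply h0
  simp only [lor, real_inner_self_eq_norm_sq, h] at hu
  have : ‖u.1‖ = 0 := by nlinarith [norm_nonneg u.1]
  exact Prod.ext (norm_eq_zero.1 this) h

/-- The reflection in the hyperplane orthogonal to `a`. -/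
def lorReflection (a : L n) : L n →ₗ[ℝ] L n :=
  LinearMap.id - ((2 / lor a a) • (lorForm n a)).smulRight a

theorem lorReflection_apply (a X : L n) :
    lorReflection a X = X - (2 / lor a a * lor a X) • a := rfl

theorem lor_lorReflection {a : L n} (ha : lor a a ≠ 0) (X Y : L n) :
    lor (lorReflection a X) (lorReflection a Y) = lor X Y := by
  simp only [lorReflection_apply, lor_sub_left, lor_sub_right, lor_smul_left, lor_smul_right]
  rw [lor_comm X a]
  field_simp
  ring

theorem lorReflection_lorReflection {a : L n} (ha : lor a a ≠ 0) (X : L n) :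
    lorReflection a (lorReflection a X) = X := by
  rw [lorReflection_apply, lorReflection_apply, lor_sub_right, lor_smul_right, sub_sub, ← add_smul]
  have : 2 / lor a a * lor a X + 2 / lor a a * (lor a X - 2 / lor a a * lor a X * lor a a) = 0 := by
    field_simp; ring
  rw [this, zero_smul, sub_zero]

/-- The reflection along τ - b, with b the vector on the time axis of the same square, exchanges τ
and b; minus the reflection along τ + b also takes τ to b. The sign of the time coordinate of τ
decides which of τ ∓ b is certainly not light-like. The map turns questions about τ^⊥ into Euclidean
ones. -/
theorem exists_lor_involution (τ : L n) {R : ℝ} (hR : 0 < R) (hτ : lor τ τ = -R) :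
    ∃ M : L n →ₗ[ℝ] L n, (∀ X Y, lor (M X) (M Y) = lor X Y) ∧ (∀ X, M (M X) = X) ∧
      M τ = (0, √R) := by
  have hs : 0 < √R := Real.sqrt_pos.2 hR
  have hsq : √R * √R = R := Real.mul_self_sqrt hR.le
  let b : L n := (0, √R)
  have hbb : lor b b = -R := by simp [lor, b, hsq]
  have hτb : lor τ b = -(τ.2 * √R) := by simp [lor, b]
  have hbτ : lor b τ = -(τ.2 * √R) := by rw [lor_comm, hτb]
  rcases le_total τ.2 0 with h | h
  · have h1 : lor (τ - b) (τ - b) = 2 * (τ.2 * √R - R) := by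
      simp only [lor_sub_left, lor_sub_right, hτ, hbb, hτb, hbτ]; ring
    have h2 : lor (τ - b) (τ - b) ≠ 0 := by
      rw [h1]; nlinarith
    refine ⟨lorReflection (τ - b), lor_lorReflection h2, lorReflection_lorReflection h2, ?_⟩
    have h3 : lor (τ - b) τ = lor (τ - b) (τ - b) / 2 := by
      rw [h1, lor_sub_left, hτ, hbτ]; ring
    rw [lorReflection_apply, h3]
    have h4 : 2 / lor (τ - b) (τ - b) * (lor (τ - b) (τ - b) / 2) = 1 := by field_simp
    rw [h4, one_smul, sub_sub_cancel]
  · have h1 : lor (τ + b) (τ + b) = -2 * (τ.2 * √R + R) := by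
      simp only [lor_add_left, lor_add_right, hτ, hbb, hτb, hbτ]; ring
    have h2 : lor (τ + b) (τ + b) ≠ 0 := by
      rw [h1]; nlinarith [mul_nonneg h hs.le]
    refine ⟨-lorReflection (τ + b), fun X Y => ?_, fun X => ?_, ?_⟩
    · rw [LinearMap.neg_apply, LinearMap.neg_apply, lor_neg_left, lor_neg_right, neg_neg,
        lor_lorReflection h2]
    · rw [LinearMap.neg_apply, LinearMap.neg_apply, map_neg, neg_neg,
        lorReflection_lorReflection h2]
    have h3 : lor (τ + b) τ = lor (τ + b) (τ + b) / 2 := by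
      rw [h1, lor_add_left, hτ, hbτ]; ring
    rw [LinearMap.neg_apply, lorReflection_apply, h3]
    have h4 : 2 / lor (τ + b) (τ + b) * (lor (τ + b) (τ + b) / 2) = 1 := by field_simp
    rw [h4, one_smul, sub_add_cancel_left, neg_neg]

/-- Orthogonal decomposition along a space-like subspace. -/
theorem exists_decomposition (W : Submodule ℝ (L n)) (hW : ∀ u ∈ W, u ≠ 0 → 0 < lor u u) (X : L n) :
    ∃ w ∈ W, ∃ v, (∀ u ∈ W, lor u v = 0) ∧ X = v + w := by
  have hrefl : (lorForm n).IsRefl := fun X Y h => by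
    rw [lorForm_apply, lor_comm]; exact h
  have hdisj : Disjoint W ((lorForm n).orthogonal W) := by
    rw [Submodule.disjoint_def]
    intro u hu hu'
    by_contra h0
    exact (hW u hu h0).ne' ((LinearMap.BilinForm.mem_orthogonal_iff.1 hu') u hu)
  have hc := (LinearMap.BilinForm.isCompl_orthogonal_iff_disjoint hrefl).2 hdisj
  have hX : X ∈ W ⊔ (lorForm n).orthogonal W := by rw [hc.sup_eq_top]; trivial
  obtain ⟨w, hw, v, hv, rfl⟩ := Submodule.mem_sup.1 hX
  exact ⟨w, hw, v, fun u hu => (LinearMap.BilinForm.mem_orthogonal_iff.1 hv) u hu, add_comm _ _⟩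

theorem hasDerivAt_of_comp_eq {m : ℕ} {G : Type*} [NormedAddCommGroup G] [NormedSpace ℝ G]
    [FiniteDimensional ℝ G] {J : Set ℝ} (hJ : IsOpen J) (T : G →ₗ[ℝ] L m) {a : ℝ → G} {p : ℝ → L m}
    (ha : ContDiffOn ℝ ∞ a J) (hp : ∀ s ∈ J, T (a s) = p s) {s : ℝ} (hs : s ∈ J) {p' : L m}
    (hp' : HasDerivAt p p' s) : T (deriv a s) = p' := by
  have hd := ((ha.differentiableOn (by simp)).differentiableAt (hJ.mem_nhds hs)).hasDerivAt
  have hd' : HasDerivAt (fun s => T (a s)) (T (deriv a s)) s :=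
    (LinearMap.toContinuousLinearMap T).hasFDerivAt.comp_hasDerivAt s hd
  refine hd'.unique (hp'.congr_of_eventuallyEq ?_)
  filter_upwards [hJ.mem_nhds hs] with u hu using hp u hu

/-- A flat net `F₀ + p(s) + q(t)` in the light cone, with `q` in a space-like subspace, is a product
of a curve in a hyperbolic space and a curve in a sphere. -/
theorem exists_hyp_sph {N : ℕ} {J₁ J₂ : Set ℝ} (h₁ : IsOpen J₁) (c₁ : J₁.OrdConnected)
    (h₂ : IsOpen J₂) {s₀ t₀ : ℝ} (hs₀ : s₀ ∈ J₁) (ht₀ : t₀ ∈ J₂) {p q : ℝ → L (N + 1)}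
    {F₀ : L (N + 1)} (sp : ContDiffOn ℝ ∞ p J₁) (sq : ContDiffOn ℝ ∞ q J₂)
    (dp : ∀ s ∈ J₁, lor (deriv p s) (deriv p s) = 1)
    (dq : ∀ t ∈ J₂, lor (deriv q t) (deriv q t) = 1)
    (hpq : ∀ s ∈ J₁, ∀ t ∈ J₂, lor (p s) (q t) = 0)
    (hnull : ∀ s ∈ J₁, ∀ t ∈ J₂, lor (F₀ + (p s + q t)) (F₀ + (p s + q t)) = 0)
    (hpos : ∀ u ∈ Submodule.span ℝ (q '' J₂), u ≠ 0 → 0 < lor u u) :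
    ∃ (m k : ℕ) (c : ℝ) (S : Splitting m k N) (α : ℝ → L m) (β : ℝ → E (k + 1)),
      1 ≤ m ∧ 1 ≤ k ∧ 0 < c ∧ IsUnitSpeedHyp c α J₁ ∧ IsUnitSpeedSph c β J₂ ∧
      ∀ s ∈ J₁, ∀ t ∈ J₂, S.toCone (α s, β t) = F₀ + (p s + q t) := by
  set W := Submodule.span ℝ (q '' J₂) with hW
  have hqW : ∀ t ∈ J₂, q t ∈ W := fun t ht => Submodule.subset_span (mem_image_of_mem q ht)
  have hpW : ∀ s ∈ J₁, ∀ u ∈ W, lor u (p s) = 0 := fun s hs u hu => by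
    refine lor_eq_zero_of_mem_span ?_ hu
    rintro _ ⟨t, ht, rfl⟩
    rw [lor_comm]; exact hpq s hs t ht
  -- Splitting the base point makes the net a(s) + b(t) with b in W and a orthogonal to W.
  -- Light-likeness then says ⟨a, a⟩ = -⟨b, b⟩, so both are constant.
  obtain ⟨w, hw, v, hv, rfl⟩ := exists_decomposition W hpos F₀
  let a : ℝ → L (N + 1) := fun s => v + p s
  let b : ℝ → L (N + 1) := fun t => w + q t
  have sa : ContDiffOn ℝ ∞ a J₁ := contDiffOn_const.add sp
  have sb : ContDiffOn ℝ ∞ b J₂ := contDiffOn_const.add sq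
  have hab : ∀ s t, v + w + (p s + q t) = a s + b t := fun s t => by simp only [a, b]; abel
  have hbW : ∀ t ∈ J₂, b t ∈ W := fun t ht => add_mem hw (hqW t ht)
  have haW : ∀ s ∈ J₁, ∀ u ∈ W, lor u (a s) = 0 := fun s hs u hu => by
    simp only [a]; rw [lor_add_right, hv u hu, hpW s hs u hu, add_zero]
  have hsum : ∀ s ∈ J₁, ∀ t ∈ J₂, lor (a s) (a s) + lor (b t) (b t) = 0 := fun s hs t ht => by
    have := hnull s hs t ht
    rw [hab, lor_add_left, lor_add_right (a s) (a s), lor_add_right (b t) (a s),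
      haW s hs _ (hbW t ht), lor_comm (a s) (b t), haW s hs _ (hbW t ht)] at this
    linarith
  have da : ∀ s ∈ J₁, HasDerivAt a (deriv p s) s := fun s hs =>
    ((sp.differentiableOn (by simp)).differentiableAt (h₁.mem_nhds hs)).hasDerivAt.const_add v
  have db : ∀ t ∈ J₂, HasDerivAt b (deriv q t) t := fun t ht =>
    ((sq.differentiableOn (by simp)).differentiableAt (h₂.mem_nhds ht)).hasDerivAt.const_add w
  set R := lor (b t₀) (b t₀) with hRdef
  have haR : ∀ s ∈ J₁, lor (a s) (a s) = -R := fun s hs => by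
    have := hsum s hs t₀ ht₀; linarith
  have hbR : ∀ t ∈ J₂, lor (b t) (b t) = R := fun t ht => by
    have h1 := hsum s₀ hs₀ t ht
    have h2 := hsum s₀ hs₀ t₀ ht₀
    linarith
  -- W is positive definite, so R ≤ 0 would make b vanish identically, against its unit speed.
  have hR : 0 < R := by
    by_contra hle
    have hb0 : ∀ t ∈ J₂, b t = 0 := fun t ht => by
      by_contra h0
      have := hpos _ (hbW t ht) h0
      rw [hbR t ht] at this
      exact hle this
    have hd0 : HasDerivAt b 0 t₀ := (hasDerivAt_const t₀ (0 : L (N + 1))).congr_of_eventuallyEq (by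
      filter_upwards [h₂.mem_nhds ht₀] with t ht using hb0 t ht)
    have := dq t₀ ht₀
    rw [(db t₀ ht₀).unique hd0, lor_zero_left] at this
    exact zero_ne_one this
  obtain ⟨M, hM, hMM, hMτ⟩ := exists_lor_involution (a s₀) hR (haR s₀ hs₀)
  have hsR : 0 < √R := Real.sqrt_pos.2 hR
  -- M takes a(s₀) ⟂ W to the time axis, hence W into the slice of time zero, where it becomes the
  -- Euclidean subspace K. Then Kᗮ together with the time axis models W^⊥.
  let K : Submodule ℝ (E (N + 1)) := W.comap (M ∘ₗ LinearMap.inl ℝ (E (N + 1)) ℝ)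
  have hK : ∀ x, x ∈ K ↔ M (x, 0) ∈ W := fun x => Iff.rfl
  have hMW : ∀ u ∈ W, (M u).2 = 0 := fun u hu => by
    have h1 := hM u (a s₀)
    rw [haW s₀ hs₀ u hu, hMτ] at h1
    simp only [lor, inner_zero_right, zero_sub, neg_eq_zero, mul_eq_zero] at h1
    exact h1.resolve_right hsR.ne'
  have hMK : ∀ u ∈ W, (M u).1 ∈ K := fun u hu => by
    rw [hK]
    have : ((M u).1, (0 : ℝ)) = M u := Prod.ext rfl (hMW u hu).symm
    rw [this, hMM]; exact hu
  have hMKo : ∀ s ∈ J₁, (M (a s)).1 ∈ Kᗮ := fun s hs => by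
    rw [Submodule.mem_orthogonal]
    intro x hx
    have h1 := hM (M (x, 0)) (a s)
    rw [hMM, haW s hs _ ((hK x).1 hx)] at h1
    simpa [lor] using h1
  have hbne : b t₀ ≠ 0 := fun h0 => by
    have := hbR t₀ ht₀
    rw [h0, lor_zero_left] at this
    exact hR.ne this
  have hKpos : 0 < Module.finrank ℝ K := by
    rw [Module.finrank_pos_iff_exists_ne_zero]
    refine ⟨⟨(M (b t₀)).1, hMK _ (hbW t₀ ht₀)⟩, fun h0 => hbne ?_⟩
    have h1 : (M (b t₀)).1 = 0 := congrArg Subtype.val h0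
    have h2 : M (b t₀) = 0 := Prod.ext h1 (hMW _ (hbW t₀ ht₀))
    rw [← hMM (b t₀), h2, map_zero]
  obtain ⟨k, hk⟩ : ∃ k, Module.finrank ℝ K = k + 1 := ⟨_, (Nat.succ_pred_eq_of_pos hKpos).symm⟩
  let i : K ≃ₗᵢ[ℝ] E (k + 1) := ((stdOrthonormalBasis ℝ K).reindex (finCongr hk)).repr
  let m := Module.finrank ℝ Kᗮ
  let j : Kᗮ ≃ₗᵢ[ℝ] E m := (stdOrthonormalBasis ℝ Kᗮ).repr
  have hdim : m + k = N := by
    have := K.finrank_add_finrank_orthogonal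
    rw [hk, finrank_euclideanSpace_fin] at this
    simp only [m]; omega
  let C : L m →ₗ[ℝ] L (N + 1) :=
    M ∘ₗ ((Kᗮ.subtype ∘ₗ j.symm.toLinearEquiv.toLinearMap).prodMap LinearMap.id)
  let D : E (k + 1) →ₗ[ℝ] L (N + 1) :=
    M ∘ₗ LinearMap.inl ℝ (E (N + 1)) ℝ ∘ₗ K.subtype ∘ₗ i.symm.toLinearEquiv.toLinearMap
  have hC : ∀ X, C X = M ((j.symm X.1 : E (N + 1)), X.2) := fun X => rfl
  have hD : ∀ Y, D Y = M ((i.symm Y : E (N + 1)), 0) := fun Y => rfl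
  let S : Splitting m k N :=
    { dim := hdim
      C := C
      D := D
      lor_C := fun X X' => by
        rw [hC, hC, hM]
        simp only [lor, ← Submodule.coe_inner, LinearIsometryEquiv.inner_map_map]
      lor_D := fun Y Y' => by
        rw [hD, hD, hM]
        simp only [lor, ← Submodule.coe_inner, LinearIsometryEquiv.inner_map_map]
        ring
      lor_C_D := fun X Y => by
        rw [hC, hD, hM]
        simp only [lor, mul_zero, sub_zero]
        exact Submodule.inner_left_of_mem_orthogonal (i.symm Y).2 (j.symm X.1).2 }
  let Λ₁ : L (N + 1) →ₗ[ℝ] L m := ((j.toLinearEquiv.toLinearMap ∘ₗ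
    (Kᗮ.orthogonalProjectionOnto : E (N + 1) →L[ℝ] Kᗮ).toLinearMap).prodMap LinearMap.id) ∘ₗ M
  let Λ₂ : L (N + 1) →ₗ[ℝ] E (k + 1) := i.toLinearEquiv.toLinearMap ∘ₗ
    (K.orthogonalProjectionOnto : E (N + 1) →L[ℝ] K).toLinearMap ∘ₗ LinearMap.fst ℝ _ _ ∘ₗ M
  let α : ℝ → L m := fun s => Λ₁ (a s)
  let β : ℝ → E (k + 1) := fun t => Λ₂ (b t)
  have sα : ContDiffOn ℝ ∞ α J₁ :=
    (LinearMap.toContinuousLinearMap Λ₁).contDiff.comp_contDiffOn sa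
  have sβ : ContDiffOn ℝ ∞ β J₂ :=
    (LinearMap.toContinuousLinearMap Λ₂).contDiff.comp_contDiffOn sb
  have hα : ∀ s ∈ J₁, C (α s) = a s := fun s hs => by
    rw [hC]
    change M (((j.symm (j (Kᗮ.orthogonalProjectionOnto (M (a s)).1)) : Kᗮ) : E (N + 1)),
      (M (a s)).2) = a s
    rw [j.symm_apply_apply]
    have h1 : ((Kᗮ.orthogonalProjectionOnto (M (a s)).1 : Kᗮ) : E (N + 1)) = (M (a s)).1 :=
      Submodule.starProjection_eq_self_iff.2 (hMKo s hs)
    rw [h1]; exact hMM _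
  have hβ : ∀ t ∈ J₂, D (β t) = b t := fun t ht => by
    rw [hD]
    change M (((i.symm (i (K.orthogonalProjectionOnto (M (b t)).1)) : K) : E (N + 1)), 0) = b t
    rw [i.symm_apply_apply]
    have h1 : ((K.orthogonalProjectionOnto (M (b t)).1 : K) : E (N + 1)) = (M (b t)).1 :=
      Submodule.starProjection_eq_self_iff.2 (hMK _ (hbW t ht))
    have h2 : ((M (b t)).1, (0 : ℝ)) = M (b t) := Prod.ext rfl (hMW _ (hbW t ht)).symm
    rw [h1, h2]; exact hMM _
  have dα : ∀ s ∈ J₁, lor (deriv α s) (deriv α s) = 1 := fun s hs => by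
    rw [← S.lor_C, hasDerivAt_of_comp_eq h₁ S.C sα hα hs (da s hs), dp s hs]
  have dβ : ∀ t ∈ J₂, inner ℝ (deriv β t) (deriv β t) = 1 := fun t ht => by
    rw [← S.lor_D, hasDerivAt_of_comp_eq h₂ S.D sβ hβ ht (db t ht), dq t ht]
  have lα : ∀ s ∈ J₁, lor (α s) (α s) = -R := fun s hs => by
    rw [← S.lor_C]; change lor (C (α s)) (C (α s)) = -R; rw [hα s hs, haR s hs]
  have lβ : ∀ t ∈ J₂, inner ℝ (β t) (β t) = R := fun t ht => by
    rw [← S.lor_D]; change lor (D (β t)) (D (β t)) = R; rw [hβ t ht, hbR t ht]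
  -- For m = 0 the space 𝕃¹ is negative definite and admits no curve of square speed 1.
  have hm : 1 ≤ m := by
    by_contra h0
    have : (deriv α s₀).1 = 0 := by
      ext x; exact absurd x.2 (by omega)
    have h1 := dα s₀ hs₀
    simp only [lor, this, inner_zero_left] at h1
    nlinarith [mul_self_nonneg (deriv α s₀).2]
  -- For k = 0 the curve β would lie on a line with ⟨β', β⟩ = 0, impossible as both β and β' are
  -- nonzero.
  have hk1 : 1 ≤ k := by
    by_contra h0
    obtain rfl : k = 0 := by omega
    have e1 : inner ℝ (deriv β t₀) (β t₀) = 0 := by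
      have hd := ((sβ.differentiableOn (by simp)).differentiableAt (h₂.mem_nhds ht₀)).hasDerivAt
      have h1 := hd.inner ℝ hd
      have h2 := h1.unique ((hasDerivAt_const t₀ R).congr_of_eventuallyEq (by
        filter_upwards [h₂.mem_nhds ht₀] with t ht using lβ t ht))
      rw [real_inner_comm] at h2
      linarith
    have e2 := dβ t₀ ht₀
    have e3 := lβ t₀ ht₀
    simp only [PiLp.inner_apply, Fin.sum_univ_succ, Finset.univ_eq_empty, Finset.sum_empty,
      RCLike.inner_apply, RCLike.conj_to_real, add_zero] at e1 e2 e3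
    rcases mul_eq_zero.1 e1 with h | h
    · rw [h, zero_mul] at e3; exact hR.ne e3
    · rw [h, zero_mul] at e2; exact zero_ne_one e2
  -- α starts on the upper sheet by the choice of M; to leave it, α would have to meet the
  -- hyperplane of time zero, where squares are nonnegative.
  have hsnd : ∀ s ∈ J₁, 0 < (α s).2 := by
    intro s hs
    by_contra hle
    have h0 : (α s₀).2 = √R := by
      change (M (a s₀)).2 = √R
      rw [hMτ]
    have hcont : ContinuousOn (fun s => (α s).2) J₁ := continuous_snd.comp_continuousOn sα.continuousOn
    obtain ⟨r, hr, hr0⟩ := c₁.isPreconnected.intermediate_value hs hs₀ hcont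
      (show (0 : ℝ) ∈ Icc (α s).2 (α s₀).2 from ⟨not_lt.1 hle, by rw [h0]; exact hsR.le⟩)
    have := lα r hr
    simp only at hr0
    simp only [lor, hr0, real_inner_self_eq_norm_sq] at this
    nlinarith [sq_nonneg ‖(α r).1‖]
  refine ⟨m, k, 1 / R, S, α, β, hm, hk1, by positivity,
    ⟨sα, fun s hs => ⟨⟨?_, hsnd s hs⟩, dα s hs⟩⟩, ⟨⟨sβ, fun t ht => ?_⟩, fun t ht => ?_⟩,
    fun s hs t ht => ?_⟩
  · rw [lα s hs]; field_simp
  · rw [norm_eq_sqrt_real_inner, dβ t ht, Real.sqrt_one]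
  · change inner ℝ (β t) (β t) = _
    rw [lβ t ht]; field_simp
  · rw [hab, ← hα s hs, ← hβ t ht]; rfl

end Lorentz

/-! ### The light cone model of ℝ^N and the classification of split nets. -/

section LightCone

variable {N : ℕ}

/-- The inclusion of `ℝ^N` in `ℝ^(N+1)` as the first `N` coordinates. -/
def inclusion (N : ℕ) : E N →ₗ[ℝ] E (N + 1) where
  toFun x := WithLp.toLp 2 (Fin.snoc (α := fun _ => ℝ) (fun i => x i) 0)
  map_add' x y := by
    ext i
    refine Fin.lastCases ?_ (fun i => ?_) i <;> simp
  map_smul' a x := by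
    ext i
    refine Fin.lastCases ?_ (fun i => ?_) i <;> simp

/-- The standard model of `ℝ^N` in the light cone. -/
def stdTriple (N : ℕ) : Triple N where
  p₀ := ((1 / 2 : ℝ) • EuclideanSpace.single (Fin.last N) 1, 1 / 2)
  w := (EuclideanSpace.single (Fin.last N) 1, -1)
  A := LinearMap.inl ℝ (E (N + 1)) ℝ ∘ₗ inclusion N
  lor_p₀ := by
    simp only [lor, inner_smul_left, inner_smul_right, EuclideanSpace.inner_single_left]
    simp
  lor_w := by simp [lor]
  lor_p₀_w := by simp [lor, inner_smul_left]; norm_num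
  lor_A x y := by
    simp [lor, inclusion, PiLp.inner_apply, Fin.sum_univ_castSucc]
  lor_A_p₀ x := by simp [lor, inclusion, inner_smul_right, EuclideanSpace.inner_single_right]
  lor_A_w x := by simp [lor, inclusion, EuclideanSpace.inner_single_right]

theorem exists_stdTriple_decomposition (X : L (N + 1)) : ∃ (a b : ℝ) (y : E N),
    X = a • (stdTriple N).p₀ + (stdTriple N).A y + b • (stdTriple N).w := by
  refine ⟨X.1 (Fin.last N) + X.2, (X.1 (Fin.last N) - X.2) / 2,
    WithLp.toLp 2 fun i => X.1 i.castSucc, Prod.ext ?_ ?_⟩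
  · ext i
    refine Fin.lastCases ?_ (fun i => ?_) i
    · simp [stdTriple, inclusion]; ring
    · simp [stdTriple, inclusion, Fin.castSucc_ne_last]
  · simp [stdTriple, inclusion]; ring

namespace Triple

variable (T : Triple N)

theorem lor_Psi_w (x : E N) : lor (T.Psi x) T.w = 1 := by
  rw [Psi, lor_sub_left, lor_add_left, lor_smul_left, T.lor_p₀_w, T.lor_A_w, T.lor_w]; ring

theorem lor_Psi_A (x y : E N) : lor (T.Psi x) (T.A y) = inner ℝ x y := by
  rw [Psi, lor_sub_left, lor_add_left, lor_smul_left, T.lor_A, lor_comm T.p₀, T.lor_A_p₀,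
    lor_comm T.w, T.lor_A_w]; ring

theorem lor_Psi_p₀ (x : E N) : lor (T.Psi x) T.p₀ = -(1 / 2 * ‖x‖ ^ 2) := by
  rw [Psi, lor_sub_left, lor_add_left, lor_smul_left, T.lor_p₀, T.lor_A_p₀, lor_comm T.w,
    T.lor_p₀_w]; ring

theorem lor_Psi_Psi (x : E N) : lor (T.Psi x) (T.Psi x) = 0 := by
  have h : lor (T.Psi x) (T.Psi x)
    = lor (T.Psi x) (T.p₀ + T.A x - ((1 / 2 : ℝ) * ‖x‖ ^ 2) • T.w) := rfl
  rw [h, lor_sub_right, lor_add_right, lor_smul_right, lor_Psi_p₀, lor_Psi_A, lor_Psi_w,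
    real_inner_self_eq_norm_sq]
  ring

theorem Psi_injective : Function.Injective T.Psi := fun x y h => by
  refine ext_inner_right ℝ fun v => ?_
  rw [← T.lor_Psi_A, ← T.lor_Psi_A, h]

theorem toEuclidean_smul_Psi {r : ℝ} (hr : r ≠ 0) (x : E N) : T.toEuclidean (r • T.Psi x) = x := by
  rw [toEuclidean, lor_smul_left, lor_Psi_w, mul_one, smul_smul, inv_mul_cancel₀ hr, one_smul]
  exact Function.leftInverse_invFun T.Psi_injective x

/-- rΨ(x) depends linearly on the triple (r, rx, r‖x‖²); with r = ρ and x = g these are exactly the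
functions that split. -/
theorem smul_Psi (r : ℝ) (x : E N) :
    r • T.Psi x = r • T.p₀ + T.A (r • x) - ((1 / 2 : ℝ) * (r * inner ℝ x x)) • T.w := by
  rw [Psi, smul_sub, smul_add, smul_smul, map_smul, real_inner_self_eq_norm_sq]
  congr 2
  ring

theorem hasFDerivAt_Psi (x : E N) :
    HasFDerivAt T.Psi (LinearMap.toContinuousLinearMap T.A - (innerSL ℝ x).smulRight T.w) x := by
  have h1 : HasFDerivAt (fun x => T.p₀ + T.A x) (LinearMap.toContinuousLinearMap T.A) x :=
    (LinearMap.toContinuousLinearMap T.A).hasFDerivAt.const_add T.p₀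
  have h2 : HasFDerivAt (fun x : E N => ((1 / 2 : ℝ) * ‖x‖ ^ 2) • T.w)
      ((innerSL ℝ x).smulRight T.w) x := by
    have := (((hasFDerivAt_id x).norm_sq).const_mul (1 / 2 : ℝ)).smul_const T.w
    refine this.congr_fderiv ?_
    ext v <;> simp
  exact h1.sub h2

end Triple

namespace IsSplitNet

variable {J₁ J₂ : Set ℝ} {g : ℝ × ℝ → E N} {ρ : ℝ × ℝ → ℝ}

theorem contDiffOn_lift (h : IsSplitNet J₁ J₂ g ρ) (T : Triple N) :
    ContDiffOn ℝ ∞ (fun z => ρ z • T.Psi (g z)) (J₁ ×ˢ J₂) :=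
  h.contDiffOn_factor.smul ((contDiffOn_const.add
    ((LinearMap.toContinuousLinearMap T.A).contDiff.comp_contDiffOn h.contDiffOn)).sub
    ((contDiffOn_const.mul (h.contDiffOn.norm_sq ℝ)).smul contDiffOn_const))

theorem splits_lift (h : IsSplitNet J₁ J₂ g ρ) (T : Triple N) :
    Splits J₁ J₂ (fun z => ρ z • T.Psi (g z)) := fun s hs s' hs' t ht t' ht' => by
  have e1 := h.splits_factor s hs s' hs' t ht t' ht'
  have e2 := congrArg T.A (h.splits_smul s hs s' hs' t ht t' ht')
  have e3 := h.splits_mul_sq s hs s' hs' t ht t' ht'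
  have key : ∀ z z' : ℝ × ℝ, ρ z • T.Psi (g z) + ρ z' • T.Psi (g z')
      = (ρ z + ρ z') • T.p₀ + T.A (ρ z • g z + ρ z' • g z')
        - ((1 / 2 : ℝ) * (ρ z * inner ℝ (g z) (g z) + ρ z' * inner ℝ (g z') (g z'))) • T.w :=
    fun z z' => by
      rw [T.smul_Psi, T.smul_Psi, map_add, add_smul, mul_add, add_smul]; abel
  simp only [key]
  rw [e1, e2, e3]

/-- Ψ is light-like and orthogonal to its derivatives, so the terms with dρ drop out, and Ψ is
isometric. As g has conformal factor 1/ρ, the coordinate curves of the lift have unit speed. -/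
theorem lor_fderiv_lift (h : IsSplitNet J₁ J₂ g ρ) (T : Triple N) {z : ℝ × ℝ} (hz : z ∈ J₁ ×ˢ J₂)
    (v : ℝ × ℝ) :
    lor (fderiv ℝ (fun z => ρ z • T.Psi (g z)) z v) (fderiv ℝ (fun z => ρ z • T.Psi (g z)) z v)
      = ρ z ^ 2 * inner ℝ (fderiv ℝ g z v) (fderiv ℝ g z v) := by
  have hopen := (h.isOpen_fst.prod h.isOpen_snd).mem_nhds hz
  have dg := ((h.contDiffOn.differentiableOn (by simp)).differentiableAt hopen).hasFDerivAt
  have dρ := ((h.contDiffOn_factor.differentiableOn (by simp)).differentiableAt hopen).hasFDerivAt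
  have e := (dρ.smul ((T.hasFDerivAt_Psi (g z)).comp z dg)).fderiv
  have e' : fderiv ℝ (fun z => ρ z • T.Psi (g z)) z v = fderiv ℝ ρ z v • T.Psi (g z)
      + ρ z • (T.A (fderiv ℝ g z v) - (inner ℝ (g z) (fderiv ℝ g z v)) • T.w) := by
    change fderiv ℝ (fun z => ρ z • T.Psi (g z)) z = _ at e
    rw [e]
    exact add_comm (ρ z • (T.A (fderiv ℝ g z v) - (inner ℝ (g z) (fderiv ℝ g z v)) • T.w)) _
  rw [e']
  simp only [lor_add_left, lor_add_right, lor_sub_left, lor_sub_right, lor_smul_left,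
    lor_smul_right, T.lor_Psi_Psi, T.lor_Psi_A, T.lor_Psi_w, T.lor_A, T.lor_A_w, T.lor_w,
    lor_comm T.w (T.A _), lor_comm (T.A _) (T.Psi _), lor_comm T.w (T.Psi _)]
  ring

end IsSplitNet

/-- `g` is the image of a product of curves of unit speed in a hyperbolic space and a sphere. -/
def IsHypSphProduct (J₁ J₂ : Set ℝ) (g : ℝ × ℝ → E N) : Prop :=
  ∃ (m k : ℕ) (c : ℝ) (T : Triple N) (S : Splitting m k N) (α : ℝ → L m) (β : ℝ → E (k + 1)),
      1 ≤ m ∧ 1 ≤ k ∧ 0 < c ∧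
      IsUnitSpeedHyp c α J₁ ∧ IsUnitSpeedSph c β J₂ ∧
      ∀ s ∈ J₁, ∀ t ∈ J₂, lor (S.toCone (α s, β t)) T.w ≠ 0 ∧
        g (s, t) = Theta T S (α s, β t)

namespace IsSplitNet

variable {J₁ J₂ : Set ℝ} {g : ℝ × ℝ → E N} {ρ : ℝ × ℝ → ℝ}

theorem lift_eq (h : IsSplitNet J₁ J₂ g ρ) (T : Triple N) {s s₀ t t₀ : ℝ} (hs : s ∈ J₁)
    (hs₀ : s₀ ∈ J₁) (ht : t ∈ J₂) (ht₀ : t₀ ∈ J₂) :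
    ρ (s, t) • T.Psi (g (s, t)) = ρ (s₀, t₀) • T.Psi (g (s₀, t₀))
      + ((ρ (s, t₀) • T.Psi (g (s, t₀)) - ρ (s₀, t₀) • T.Psi (g (s₀, t₀)))
        + (ρ (s₀, t) • T.Psi (g (s₀, t)) - ρ (s₀, t₀) • T.Psi (g (s₀, t₀)))) := by
  have := h.splits_lift T s hs s₀ hs₀ t ht t₀ ht₀
  simp only at this
  rw [eq_sub_of_add_eq this]; abel

/-- Let a, b, c be the lifts at (s, t₀), (s₀, t), (s₀, t₀). The fourth corner is a + b - c; all four
are light-like, and the square of a + b - c is then 2⟨a - c, b - c⟩. -/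
theorem lor_lift_sub (h : IsSplitNet J₁ J₂ g ρ) (T : Triple N) {s s₀ t t₀ : ℝ} (hs : s ∈ J₁)
    (hs₀ : s₀ ∈ J₁) (ht : t ∈ J₂) (ht₀ : t₀ ∈ J₂) :
    lor (ρ (s, t₀) • T.Psi (g (s, t₀)) - ρ (s₀, t₀) • T.Psi (g (s₀, t₀)))
      (ρ (s₀, t) • T.Psi (g (s₀, t)) - ρ (s₀, t₀) • T.Psi (g (s₀, t₀))) = 0 := by
  have hnull : ∀ z, lor (ρ z • T.Psi (g z)) (ρ z • T.Psi (g z)) = 0 := fun z => by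
    rw [lor_smul_left, lor_smul_right, T.lor_Psi_Psi]; ring
  have h0 := hnull (s, t)
  rw [h.lift_eq T hs hs₀ ht ht₀] at h0
  have h1 := hnull (s₀, t₀)
  have h2 := hnull (s, t₀)
  have h3 := hnull (s₀, t)
  generalize ρ (s, t₀) • T.Psi (g (s, t₀)) = a at *
  generalize ρ (s₀, t) • T.Psi (g (s₀, t)) = b at *
  generalize ρ (s₀, t₀) • T.Psi (g (s₀, t₀)) = c at *
  simp only [lor_add_left, lor_add_right, lor_sub_left, lor_sub_right] at h0 ⊢
  rw [lor_comm b a, lor_comm c a, lor_comm c b] at h0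
  rw [lor_comm c b]
  linarith

theorem isHypSphProduct (h : IsSplitNet J₁ J₂ g ρ) {s₀ t₀ : ℝ} (hs₀ : s₀ ∈ J₁) (ht₀ : t₀ ∈ J₂)
    (T : Triple N)
    (hpos : ∀ u ∈ Submodule.span ℝ ((fun t => ρ (s₀, t) • T.Psi (g (s₀, t))
      - ρ (s₀, t₀) • T.Psi (g (s₀, t₀))) '' J₂), u ≠ 0 → 0 < lor u u) :
    IsHypSphProduct J₁ J₂ g := by
  have hl := h.contDiffOn_lift T
  have hρ : ∀ z ∈ J₁ ×ˢ J₂, ρ z ^ 2 * (ρ z ^ 2)⁻¹ = 1 := fun z hz =>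
    mul_inv_cancel₀ (pow_ne_zero _ (h.factor_pos z hz).ne')
  obtain ⟨m, k, c, S, α, β, hm, hk, hc, hα, hβ, hS⟩ := exists_hyp_sph (N := N) h.isOpen_fst
    h.ordConnected_fst h.isOpen_snd hs₀ ht₀
    (p := fun s => ρ (s, t₀) • T.Psi (g (s, t₀)) - ρ (s₀, t₀) • T.Psi (g (s₀, t₀)))
    (q := fun t => ρ (s₀, t) • T.Psi (g (s₀, t)) - ρ (s₀, t₀) • T.Psi (g (s₀, t₀)))
    (F₀ := ρ (s₀, t₀) • T.Psi (g (s₀, t₀)))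
    ((hl.comp (contDiff_id.prodMk contDiff_const).contDiffOn
      fun s hs => mk_mem_prod hs ht₀).sub contDiffOn_const)
    ((hl.comp (contDiff_const.prodMk contDiff_id).contDiffOn
      fun t ht => mk_mem_prod hs₀ ht).sub contDiffOn_const)
    (fun s hs => by
      have hz := mk_mem_prod hs ht₀
      rw [((hasDerivAt_fst h.isOpen_fst h.isOpen_snd hl hs ht₀).sub_const _).deriv,
        h.lor_fderiv_lift T hz, h.inner_fst _ hz, hρ _ hz])
    (fun t ht => by
      have hz := mk_mem_prod hs₀ ht
      rw [((hasDerivAt_snd h.isOpen_fst h.isOpen_snd hl hs₀ ht).sub_const _).deriv,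
        h.lor_fderiv_lift T hz, h.inner_snd _ hz, hρ _ hz])
    (fun s hs t ht => h.lor_lift_sub T hs hs₀ ht ht₀)
    (fun s hs t ht => by
      rw [← h.lift_eq T hs hs₀ ht ht₀, lor_smul_left, lor_smul_right, T.lor_Psi_Psi]; ring)
    hpos
  refine ⟨m, k, c, T, S, α, β, hm, hk, hc, hα, hβ, fun s hs t ht => ?_⟩
  have hr := (h.factor_pos _ (mk_mem_prod hs ht)).ne'
  have e := (hS s hs t ht).trans (h.lift_eq T hs hs₀ ht ht₀).symm
  constructor
  · rw [e, lor_smul_left, T.lor_Psi_w, mul_one]; exact hr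
  · rw [Theta, e, T.toEuclidean_smul_Psi hr]

/-- Write ν = a p₀ + A y + b w. If a = 0, light-likeness gives y = 0 and the constant quantity is
ρb, so ρ = 1. If a ≠ 0, then ν = aΨ(y/a), and ⟨Ψ(x), Ψ(y')⟩ = -‖x - y'‖²/2 makes ρ‖g - y'‖² constant
with y' = y/a. -/
theorem isInvertedProduct_of_null (h : IsSplitNet J₁ J₂ g ρ) {z₀ : ℝ × ℝ} (hz₀ : z₀ ∈ J₁ ×ˢ J₂)
    (hρ₀ : ρ z₀ = 1) {ν : L (N + 1)} (hν : ν ≠ 0) (hνν : lor ν ν = 0)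
    (hc : ∀ z ∈ J₁ ×ˢ J₂, lor (ρ z • (stdTriple N).Psi (g z)) ν
      = lor (ρ z₀ • (stdTriple N).Psi (g z₀)) ν) :
    IsInvertedProduct J₁ J₂ g := by
  obtain ⟨a, b, y, rfl⟩ := exists_stdTriple_decomposition ν
  set T := stdTriple N
  have hab : 2 * (a * b) + ‖y‖ ^ 2 = 0 := by
    simp only [lor_add_left, lor_add_right, lor_smul_left, lor_smul_right, T.lor_p₀, T.lor_p₀_w,
      T.lor_A, T.lor_A_p₀, T.lor_A_w, T.lor_w, lor_comm T.w T.p₀, lor_comm T.w (T.A y),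
      lor_comm T.p₀ (T.A y), real_inner_self_eq_norm_sq] at hνν
    linarith
  have hl : ∀ x, lor (T.Psi x) (a • T.p₀ + T.A y + b • T.w)
      = -(a / 2 * ‖x‖ ^ 2) + inner ℝ x y + b := fun x => by
    simp only [lor_add_right, lor_smul_right, T.lor_Psi_p₀, T.lor_Psi_A, T.lor_Psi_w]; ring
  simp only [lor_smul_left, hl, hρ₀, one_mul] at hc
  by_cases ha : a = 0
  · have hy : y = 0 := by
      have : ‖y‖ ^ 2 = 0 := by rw [ha] at hab; linarith
      simpa using this
    have hb : b ≠ 0 := fun hb => hν (by simp [ha, hy, hb])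
    refine h.isInvertedProduct_of_factor_eq_one hz₀ fun z hz => ?_
    have := hc z hz
    simp only [ha, hy, inner_zero_right] at this
    refine mul_right_cancel₀ hb ?_
    linarith
  · let y' := a⁻¹ • y
    have hy' : ∀ x, -(a / 2 * ‖x‖ ^ 2) + inner ℝ x y + b
        = -(a / 2) * inner ℝ (x - y') (x - y') := fun x => by
      have hb : b = -(‖y‖ ^ 2) / (2 * a) := by field_simp; linarith
      simp only [y', real_inner_self_eq_norm_sq, norm_sub_sq_real, inner_smul_right, norm_smul,
        mul_pow, Real.norm_eq_abs, sq_abs]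
      rw [hb]
      field_simp
      ring
    simp only [hy'] at hc
    have hc' : ∀ z ∈ J₁ ×ˢ J₂, ρ z * inner ℝ (g z - y') (g z - y')
        = inner ℝ (g z₀ - y') (g z₀ - y') := fun z hz => by
      have := hc z hz
      have ha2 : -(a / 2) ≠ 0 := by simpa using ha
      exact mul_left_cancel₀ ha2 (by linarith)
    refine h.isInvertedProduct_of_center hz₀ (lt_of_le_of_ne real_inner_self_nonneg ?_) hc'
    -- A zero constant would force g to be constant, against the conformality of g.
    intro h0
    have hg : ∀ z ∈ J₁ ×ˢ J₂, g z = y' := fun z hz => by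
      have := hc' z hz
      rw [← h0] at this
      exact sub_eq_zero.1 (inner_self_eq_zero.1
        ((mul_eq_zero.1 this).resolve_left (h.factor_pos z hz).ne'))
    have hd : fderiv ℝ g z₀ = 0 := by
      have e : g =ᶠ[𝓝 z₀] fun _ => y' := by
        filter_upwards [(h.isOpen_fst.prod h.isOpen_snd).mem_nhds hz₀] with z hz using hg z hz
      rw [e.fderiv_eq]; simp
    have := h.inner_fst z₀ hz₀
    rw [hd, hρ₀] at this
    simp at this

/-- The three outcomes: neither span is space-like, the span of q is, or the span of p is. In the
last case the second family carries the hyperbolic curve, hence the swap. -/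
theorem classification (h : IsSplitNet J₁ J₂ g ρ) {z₀ : ℝ × ℝ} (hz₀ : z₀ ∈ J₁ ×ˢ J₂)
    (hρ₀ : ρ z₀ = 1) :
    IsInvertedProduct J₁ J₂ g ∨ IsHypSphProduct J₁ J₂ g ∨
      IsHypSphProduct J₂ J₁ (g ∘ Prod.swap) := by
  obtain ⟨s₀, t₀⟩ := z₀
  have hs₀ : s₀ ∈ J₁ := hz₀.1
  have ht₀ : t₀ ∈ J₂ := hz₀.2
  let T := stdTriple N
  by_cases hpos₂ : ∀ u ∈ Submodule.span ℝ ((fun t => ρ (s₀, t) • T.Psi (g (s₀, t))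
      - ρ (s₀, t₀) • T.Psi (g (s₀, t₀))) '' J₂), u ≠ 0 → 0 < lor u u
  · exact Or.inr (Or.inl (h.isHypSphProduct hs₀ ht₀ T hpos₂))
  by_cases hpos₁ : ∀ u ∈ Submodule.span ℝ ((fun s => ρ (s, t₀) • T.Psi (g (s, t₀))
      - ρ (s₀, t₀) • T.Psi (g (s₀, t₀))) '' J₁), u ≠ 0 → 0 < lor u u
  · exact Or.inr (Or.inr (h.comp_swap.isHypSphProduct ht₀ hs₀ T hpos₁))
  left
  push Not at hpos₁ hpos₂
  obtain ⟨u₁, hu₁, hu₁0, hu₁c⟩ := hpos₁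
  obtain ⟨u₂, hu₂, hu₂0, hu₂c⟩ := hpos₂
  have hort₁ : ∀ t ∈ J₂, lor u₁ (ρ (s₀, t) • T.Psi (g (s₀, t))
      - ρ (s₀, t₀) • T.Psi (g (s₀, t₀))) = 0 := fun t ht => by
    refine lor_eq_zero_of_mem_span ?_ hu₁
    rintro _ ⟨s, hs, rfl⟩
    exact h.lor_lift_sub T hs hs₀ ht ht₀
  have hort₂ : ∀ s ∈ J₁, lor u₂ (ρ (s, t₀) • T.Psi (g (s, t₀))
      - ρ (s₀, t₀) • T.Psi (g (s₀, t₀))) = 0 := fun s hs => by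
    refine lor_eq_zero_of_mem_span ?_ hu₂
    rintro _ ⟨t, ht, rfl⟩
    rw [lor_comm]; exact h.lor_lift_sub T hs hs₀ ht ht₀
  have h₂₁ : lor u₂ u₁ = 0 := by
    refine lor_eq_zero_of_mem_span ?_ hu₂
    rintro _ ⟨t, ht, rfl⟩
    rw [lor_comm]; exact hort₁ t ht
  -- Proportionality makes `u₁` orthogonal not only to q but also to p and to itself, so it is the
  -- light-like vector against which the lift is constant.
  have hprop := smul_eq_smul_of_causal hu₁c hu₂c (by rw [lor_comm, h₂₁])
  have hne := snd_ne_zero_of_causal hu₂c hu₂0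
  have key : ∀ v, lor u₂ v = 0 → lor u₁ v = 0 := fun v hv => by
    refine (mul_eq_zero.1 ?_).resolve_left hne
    rw [← lor_smul_left, hprop, lor_smul_left, hv, mul_zero]
  refine h.isInvertedProduct_of_null hz₀ hρ₀ hu₁0 (key _ h₂₁) ?_
  rintro ⟨s, t⟩ ⟨hs, ht⟩
  change lor (ρ (s, t) • T.Psi (g (s, t))) u₁ = lor (ρ (s₀, t₀) • T.Psi (g (s₀, t₀))) u₁
  rw [h.lift_eq T hs hs₀ ht ht₀, lor_comm, lor_add_right, lor_add_right, hort₁ t ht,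
    key _ (hort₂ s hs), lor_comm, add_zero, add_zero]

end IsSplitNet

end LightCone

/-! ### From the preferred chart at each point to one fixed chart. -/

section Transition

variable {N : ℕ} {M : Type*} [TopologicalSpace M] [ChartedSpace (E 2) M]

/-- The change of coordinates from the preferred chart at `p` to that at the point with
coordinates `x`. -/
def coordChange (p : M) (x : E 2) : E 2 → E 2 :=
  extChartAt (𝓡 2) ((extChartAt (𝓡 2) p).symm x) ∘ (extChartAt (𝓡 2) p).symm

variable {f : M → E N} {p : M} {x : E 2}

theorem diff_eq (hf : IsSmoothImmersion f) (q : M) :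
    diff f q = fderiv ℝ (localRep f q) (extChartAt (𝓡 2) q q) := by
  rw [diff, ((hf.1 q).mdifferentiableAt (by simp)).mfderiv, ModelWithCorners.range_eq_univ,
    fderivWithin_univ]
  rfl

/-- `diff` and `sff` at a point use the preferred chart there, while the frames live in the chart at
`p`; all comparisons below come from this factorization and the chain rule. -/
theorem localRep_eventuallyEq (hx : x ∈ (extChartAt (𝓡 2) p).target) :
    localRep f p =ᶠ[𝓝 x] localRep f ((extChartAt (𝓡 2) p).symm x) ∘ coordChange p x := by
  have h1 : ContinuousAt (extChartAt (𝓡 2) p).symm x := continuousAt_extChartAt_symm'' hx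
  filter_upwards [h1 (extChartAt_source_mem_nhds (I := 𝓡 2) ((extChartAt (𝓡 2) p).symm x))] with y hy
  simp only [localRep, coordChange, Function.comp_apply]
  rw [PartialEquiv.left_inv _ hy]

variable [IsManifold (𝓡 2) ∞ M]

theorem contDiffAt_coordChange (hx : x ∈ (extChartAt (𝓡 2) p).target) :
    ContDiffAt ℝ ∞ (coordChange p x) x := by
  have h : x ∈ ((extChartAt (𝓡 2) p).symm ≫
      extChartAt (𝓡 2) ((extChartAt (𝓡 2) p).symm x)).source := by
    rw [PartialEquiv.trans_source, PartialEquiv.symm_source]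
    exact ⟨hx, mem_extChartAt_source _⟩
  have := contDiffWithinAt_ext_coord_change (I := 𝓡 2) (n := ∞) _ p h
  rwa [ModelWithCorners.range_eq_univ, contDiffWithinAt_univ] at this

theorem mdifferentiableAt_extChartAt_symm' (hx : x ∈ (extChartAt (𝓡 2) p).target) :
    MDifferentiableAt 𝓘(ℝ, E 2) (𝓡 2) (extChartAt (𝓡 2) p).symm x :=
  ((contMDiffOn_extChartAt_symm (n := ∞) p).contMDiffAt
    ((isOpen_extChartAt_target p).mem_nhds hx)).mdifferentiableAt (by simp)

theorem mfderiv_extChartAt_symm (hx : x ∈ (extChartAt (𝓡 2) p).target) :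
    mfderiv 𝓘(ℝ, E 2) (𝓡 2) (extChartAt (𝓡 2) p).symm x = fderiv ℝ (coordChange p x) x := by
  rw [(mdifferentiableAt_extChartAt_symm' hx).mfderiv, ModelWithCorners.range_eq_univ,
    fderivWithin_univ]
  rfl

theorem fderiv_coordChange_surjective (hx : x ∈ (extChartAt (𝓡 2) p).target) :
    Function.Surjective (fderiv ℝ (coordChange p x) x) := by
  have : IsManifold (𝓡 2) 1 M := IsManifold.of_le (n := ∞) (by simp)
  have h := isInvertible_mfderivWithin_extChartAt_symm (I := 𝓡 2) hx
  rw [ModelWithCorners.range_eq_univ, mfderivWithin_univ, mfderiv_extChartAt_symm hx] at h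
  exact h.bijective.surjective

theorem contDiffOn_localRep (hf : IsSmoothImmersion f) (p : M) :
    ContDiffOn ℝ ∞ (localRep f p) (extChartAt (𝓡 2) p).target :=
  contMDiffOn_iff_contDiffOn.1 (hf.1.comp_contMDiffOn (contMDiffOn_extChartAt_symm p))

theorem contDiffAt_localRep_self (hf : IsSmoothImmersion f) (q : M) :
    ContDiffAt ℝ ∞ (localRep f q) (extChartAt (𝓡 2) q q) :=
  (contDiffOn_localRep hf q).contDiffAt (extChartAt_target_mem_nhds q)

theorem fderiv_localRep (hf : IsSmoothImmersion f) (hx : x ∈ (extChartAt (𝓡 2) p).target)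
    (v : E 2) :
    fderiv ℝ (localRep f p) x v
      = fderiv ℝ (localRep f ((extChartAt (𝓡 2) p).symm x))
        (extChartAt (𝓡 2) ((extChartAt (𝓡 2) p).symm x) ((extChartAt (𝓡 2) p).symm x))
        (fderiv ℝ (coordChange p x) x v) := by
  rw [(localRep_eventuallyEq hx).fderiv_eq, fderiv_comp]
  · rfl
  · exact (contDiffAt_localRep_self hf _).differentiableAt (by simp)
  · exact (contDiffAt_coordChange hx).differentiableAt (by simp)

theorem diff_coordChange (hf : IsSmoothImmersion f) (hx : x ∈ (extChartAt (𝓡 2) p).target)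
    (v : E 2) :
    diff f ((extChartAt (𝓡 2) p).symm x) (fderiv ℝ (coordChange p x) x v)
      = fderiv ℝ (localRep f p) x v := by
  rw [diff_eq hf, fderiv_localRep hf hx]
  rfl

theorem range_fderiv_localRep (hf : IsSmoothImmersion f) (hx : x ∈ (extChartAt (𝓡 2) p).target) :
    LinearMap.range (fderiv ℝ (localRep f ((extChartAt (𝓡 2) p).symm x))
        (extChartAt (𝓡 2) ((extChartAt (𝓡 2) p).symm x)
          ((extChartAt (𝓡 2) p).symm x))).toLinearMap
      = LinearMap.range (fderiv ℝ (localRep f p) x).toLinearMap := by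
  ext y
  constructor
  · rintro ⟨v, rfl⟩
    obtain ⟨u, rfl⟩ := fderiv_coordChange_surjective hx v
    exact ⟨u, fderiv_localRep hf hx u⟩
  · rintro ⟨u, rfl⟩
    exact ⟨_, (fderiv_localRep hf hx u).symm⟩

theorem tangentProj_localRep (hf : IsSmoothImmersion f) (hx : x ∈ (extChartAt (𝓡 2) p).target)
    (v : E N) :
    tangentProj (localRep f ((extChartAt (𝓡 2) p).symm x))
        (extChartAt (𝓡 2) ((extChartAt (𝓡 2) p).symm x) ((extChartAt (𝓡 2) p).symm x)) v
      = tangentProj (localRep f p) x v := by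
  simp only [tangentProj, range_fderiv_localRep hf hx]

theorem normalProj_localRep (hf : IsSmoothImmersion f) (hx : x ∈ (extChartAt (𝓡 2) p).target)
    (v : E N) :
    normalProj (localRep f ((extChartAt (𝓡 2) p).symm x))
        (extChartAt (𝓡 2) ((extChartAt (𝓡 2) p).symm x) ((extChartAt (𝓡 2) p).symm x)) v
      = normalProj (localRep f p) x v := by
  simp only [normalProj, range_fderiv_localRep hf hx]

theorem normalProj_fderiv (F : E 2 → E N) (x v : E 2) : normalProj F x (fderiv ℝ F x v) = 0 := by
  rw [normalProj, Submodule.starProjection_apply_eq_zero_iff]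
  exact Submodule.le_orthogonal_orthogonal _ ⟨v, rfl⟩

/-- The normal part of the second derivative is tensorial. -/
theorem normalProj_fderiv_fderiv_comp {G : E 2 → E N} {τ : E 2 → E 2} {x : E 2}
    (hG : ContDiffAt ℝ ∞ G (τ x)) (hτ : ContDiffAt ℝ ∞ τ x) (u v : E 2) :
    normalProj G (τ x) (fderiv ℝ (fderiv ℝ (G ∘ τ)) x u v)
      = normalProj G (τ x) (fderiv ℝ (fderiv ℝ G) (τ x) (fderiv ℝ τ x u) (fderiv ℝ τ x v)) := by
  have e : fderiv ℝ (G ∘ τ) =ᶠ[𝓝 x] fun y => (fderiv ℝ G (τ y)).comp (fderiv ℝ τ y) := by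
    have h1 := (hG.of_le (show (1 : WithTop ℕ∞) ≤ ∞ by simp)).eventually (by simp)
    have h2 := (hτ.of_le (show (1 : WithTop ℕ∞) ≤ ∞ by simp)).eventually (by simp)
    filter_upwards [hτ.continuousAt.eventually h1, h2] with y hy1 hy2
    exact fderiv_comp y (hy1.differentiableAt (by simp)) (hy2.differentiableAt (by simp))
  have d1 : DifferentiableAt ℝ (fderiv ℝ G) (τ x) :=
    (hG.fderiv_right (m := 1) (by exact_mod_cast two_le_infty)).differentiableAt (by simp)
  have d2 : DifferentiableAt ℝ (fderiv ℝ τ) x :=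
    (hτ.fderiv_right (m := 1) (by exact_mod_cast two_le_infty)).differentiableAt (by simp)
  have d3 : HasFDerivAt (fun y => fderiv ℝ G (τ y))
      ((fderiv ℝ (fderiv ℝ G) (τ x)).comp (fderiv ℝ τ x)) x :=
    d1.hasFDerivAt.comp x (hτ.differentiableAt (by simp)).hasFDerivAt
  have d4 := (d3.clm_comp d2.hasFDerivAt).fderiv
  have d5 : fderiv ℝ (fderiv ℝ (G ∘ τ)) x u v = fderiv ℝ G (τ x) (fderiv ℝ (fderiv ℝ τ) x u v)
      + fderiv ℝ (fderiv ℝ G) (τ x) (fderiv ℝ τ x u) (fderiv ℝ τ x v) := by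
    rw [e.fderiv_eq, d4]
    simp
  have d6 := normalProj_fderiv G (τ x) (fderiv ℝ (fderiv ℝ τ) x u v)
  rw [d5]
  unfold normalProj at d6 ⊢
  rw [map_add, d6, zero_add]

theorem sff_coordChange (hf : IsSmoothImmersion f) (hx : x ∈ (extChartAt (𝓡 2) p).target)
    (u v : E 2) :
    sff f ((extChartAt (𝓡 2) p).symm x) (fderiv ℝ (coordChange p x) x u)
        (fderiv ℝ (coordChange p x) x v)
      = normalProj (localRep f p) x (fderiv ℝ (fderiv ℝ (localRep f p)) x u v) := by
  have h := normalProj_fderiv_fderiv_comp (x := x) (τ := coordChange p x)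
    (contDiffAt_localRep_self hf ((extChartAt (𝓡 2) p).symm x)) (contDiffAt_coordChange hx) u v
  have e := ((localRep_eventuallyEq (f := f) hx).fderiv (𝕜 := ℝ)).fderiv_eq (𝕜 := ℝ)
  rw [e, ← normalProj_localRep hf hx]
  exact h.symm

theorem metric_coordChange (hf : IsSmoothImmersion f) (hx : x ∈ (extChartAt (𝓡 2) p).target)
    (u v : E 2) :
    metric f ((extChartAt (𝓡 2) p).symm x) (fderiv ℝ (coordChange p x) x u)
        (fderiv ℝ (coordChange p x) x v)
      = inner ℝ (fderiv ℝ (localRep f p) x u) (fderiv ℝ (localRep f p) x v) := by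
  rw [← diff_coordChange hf hx, ← diff_coordChange hf hx]
  rfl

theorem fderiv_localRep_injective (hf : IsSmoothImmersion f)
    (hx : x ∈ (extChartAt (𝓡 2) p).target) : Function.Injective (fderiv ℝ (localRep f p) x) := by
  have hinj : Function.Injective (fderiv ℝ (coordChange p x) x) :=
    LinearMap.injective_iff_surjective.2 (fderiv_coordChange_surjective hx)
  intro u v huv
  rw [← diff_coordChange hf hx, ← diff_coordChange hf hx] at huv
  exact hinj (hf.2 _ huv)

theorem not_umbilic_localRep (hf : IsSmoothImmersion f) (hx : x ∈ (extChartAt (𝓡 2) p).target)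
    (hu : ¬ IsUmbilic f ((extChartAt (𝓡 2) p).symm x)) :
    ¬ ∃ H : E N, ∀ u v, normalProj (localRep f p) x (fderiv ℝ (fderiv ℝ (localRep f p)) x u v)
      = inner ℝ (fderiv ℝ (localRep f p) x u) (fderiv ℝ (localRep f p) x v) • H := by
  rintro ⟨H, hH⟩
  refine hu ⟨H, fun X Y => ?_⟩
  obtain ⟨u, rfl⟩ := fderiv_coordChange_surjective hx X
  obtain ⟨v, rfl⟩ := fderiv_coordChange_surjective hx Y
  rw [sff_coordChange hf hx, metric_coordChange hf hx, hH]

/-- Since α(X, Y) = 0, the vector X is an eigenvector of A_ξ with eigenvalue ⟨α(X, X), ξ⟩. -/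
theorem IsPrincipalFrame.isPrincipal_fst (hf : IsSmoothImmersion f) {V : Set (E 2)}
    {X Y : E 2 → E 2} (h : IsPrincipalFrame (localRep f p) V X Y) (hxV : x ∈ V)
    (hx : x ∈ (extChartAt (𝓡 2) p).target) {a : ℝ} (ha : a ≠ 0) :
    IsPrincipal f ((extChartAt (𝓡 2) p).symm x) (fderiv ℝ (coordChange p x) x (a • X x)) := by
  constructor
  · intro h0
    have h1 := diff_coordChange hf hx (a • X x)
    rw [h0, map_zero, map_smul] at h1
    have h2 := h.inner_fst x hxV
    rw [push, (smul_eq_zero.1 h1.symm).resolve_left ha, inner_zero_left] at h2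
    exact zero_ne_one h2
  · intro ξ _
    refine ⟨inner ℝ (normalProj (localRep f p) x
      (fderiv ℝ (fderiv ℝ (localRep f p)) x (X x) (X x))) ξ, fun Z => ?_⟩
    obtain ⟨v, rfl⟩ := fderiv_coordChange_surjective hx Z
    have hc := h.conjugate x hxV
    have e11 := h.inner_fst x hxV
    have e12 := h.inner_fst_snd x hxV
    rw [sff_coordChange hf hx, metric_coordChange hf hx, h.decomp hxV v]
    unfold normalProj at hc ⊢
    unfold push at e11 e12 ⊢
    simp only [map_add, map_smul, smul_apply, inner_add_right, inner_smul_left, inner_smul_right, hc, e11, e12, RCLike.conj_to_real, smul_zero, add_zero,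
      mul_zero, mul_one]
    ring

end Transition

/-! ### Curvature lines and isothermic parametrizations on the manifold. -/

section Parametrization

theorem IsIsothermicChart.comp_swap {N : ℕ} {F : E 2 → E N} {X Y : E 2 → E 2} {ρ : E 2 → ℝ}
    {J₁ J₂ : Set ℝ} {φ : OpenPartialHomeomorph (ℝ × ℝ) (E 2)}
    (h : IsIsothermicChart F X Y ρ J₁ J₂ φ) :
    IsIsothermicChart F Y X ρ J₂ J₁ ((Homeomorph.prodComm ℝ ℝ).transOpenPartialHomeomorph φ) := by
  have hsrc : ((Homeomorph.prodComm ℝ ℝ).transOpenPartialHomeomorph φ).source = J₂ ×ˢ J₁ := by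
    change Prod.swap ⁻¹' φ.source = _
    rw [h.source_eq]; ext z; simp [and_comm]
  have hc : ContDiffOn ℝ ∞ φ (J₁ ×ˢ J₂) := h.source_eq ▸ h.contDiffOn
  refine ⟨h.isOpen_snd, h.ordConnected_snd, h.isOpen_fst, h.ordConnected_fst, hsrc, ?_,
    (contDiff_snd.prodMk contDiff_fst).comp_contDiffOn h.contDiffOn_symm, h.frame.swap,
    h.contDiffOn_factor, h.factor_pos, h.fderiv_factor_snd, h.fderiv_factor_fst, ?_, ?_⟩
  · rw [hsrc]; exact contDiffOn_comp_swap hc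
  · intro z hz
    rw [hsrc] at hz
    exact (fderiv_comp_swap h.isOpen_fst h.isOpen_snd hc hz (1, 0)).trans
      (h.fderiv_snd _ (by rw [h.source_eq]; exact ⟨hz.2, hz.1⟩))
  · intro z hz
    rw [hsrc] at hz
    exact (fderiv_comp_swap h.isOpen_fst h.isOpen_snd hc hz (0, 1)).trans
      (h.fderiv_fst _ (by rw [h.source_eq]; exact ⟨hz.2, hz.1⟩))

variable {N : ℕ} {M : Type*} [TopologicalSpace M] [ChartedSpace (E 2) M] [IsManifold (𝓡 2) ∞ M]
  {f : M → E N} {p : M}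

theorem mfderiv_extChartAt_symm_comp {G : Type*} [NormedAddCommGroup G] [NormedSpace ℝ G]
    {c : G → E 2} {z : G} (hz : c z ∈ (extChartAt (𝓡 2) p).target) (hc : DifferentiableAt ℝ c z)
    (v : G) :
    mfderiv 𝓘(ℝ, G) (𝓡 2) ((extChartAt (𝓡 2) p).symm ∘ c) z v
      = fderiv ℝ (coordChange p (c z)) (c z) (fderiv ℝ c z v) := by
  have h := mfderiv_comp (I := 𝓘(ℝ, G)) (I' := 𝓘(ℝ, E 2)) (I'' := 𝓡 2) z
    (mdifferentiableAt_extChartAt_symm' hz) hc.mdifferentiableAt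
  rw [mfderiv_extChartAt_symm hz, mfderiv_eq_fderiv] at h
  exact DFunLike.congr_fun h v

/-- Along an integral curve of X the acceleration is D_X(F_*X), whose only tangential component is
k₁ along the unit vector F_*Y. -/
theorem geodesicCurvature_integralCurve (hf : IsSmoothImmersion f) {V : Set (E 2)}
    {X Y : E 2 → E 2} (h : IsFrame (localRep f p) V X Y) (hV : V ⊆ (extChartAt (𝓡 2) p).target)
    {c : ℝ → E 2} {J : Set ℝ} (hJ : IsOpen J) (hcV : ∀ t ∈ J, c t ∈ V)
    (hc : ∀ t ∈ J, HasDerivAt c (X (c t)) t) {t : ℝ} (ht : t ∈ J) :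
    geodesicCurvature f ((extChartAt (𝓡 2) p).symm ∘ c) t = |geodCurv (localRep f p) X Y (c t)| := by
  have hct := hcV t ht
  have d1 : deriv (f ∘ (extChartAt (𝓡 2) p).symm ∘ c) =ᶠ[𝓝 t] push (localRep f p) X ∘ c := by
    filter_upwards [hJ.mem_nhds ht] with s hs
    exact ((h.differentiableAt_of_mem h.smooth (hcV s hs)).hasFDerivAt.comp_hasDerivAt s
      (hc s hs)).deriv
  have d2 : deriv (deriv (f ∘ (extChartAt (𝓡 2) p).symm ∘ c)) t
      = fderiv ℝ (push (localRep f p) X) (c t) (X (c t)) := by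
    rw [d1.deriv_eq]
    exact ((h.differentiableAt_of_mem h.contDiffOn_fst hct).hasFDerivAt.comp_hasDerivAt t
      (hc t ht)).deriv
  have e1 : geodesicCurvature f ((extChartAt (𝓡 2) p).symm ∘ c) t
      = ‖tangentProj (localRep f p) (c t)
        (deriv (deriv (f ∘ (extChartAt (𝓡 2) p).symm ∘ c)) t)‖ := by
    rw [← tangentProj_localRep hf (hV hct)]; rfl
  rw [e1, d2, h.tangentProj_eq hct, h.inner_fderiv_fst_fst hct, zero_smul, zero_add, norm_smul,
    norm_eq_sqrt_real_inner (push (localRep f p) Y (c t)), h.inner_snd _ hct, Real.sqrt_one, mul_one,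
    Real.norm_eq_abs]
  rfl

theorem IsPrincipalFrame.isCurvatureLine (hf : IsSmoothImmersion f) {V : Set (E 2)}
    {X Y : E 2 → E 2} (h : IsPrincipalFrame (localRep f p) V X Y)
    (hV : V ⊆ (extChartAt (𝓡 2) p).target) {c : ℝ → E 2} {J : Set ℝ} (hJ : IsOpen J)
    (hJ' : J.OrdConnected) (hcV : ∀ t ∈ J, c t ∈ V) (hc : ∀ t ∈ J, HasDerivAt c (X (c t)) t) :
    IsCurvatureLine f ((extChartAt (𝓡 2) p).symm ∘ c) J := by
  refine ⟨hJ, hJ', ?_, fun t ht => ?_⟩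
  · exact (contMDiffOn_extChartAt_symm p).comp
      (contMDiffOn_iff_contDiffOn.2 (contDiffOn_integralCurve h.smooth_fst hJ hcV hc))
      fun t ht => hV (hcV t ht)
  · have hct := hcV t ht
    have hv : velocity ((extChartAt (𝓡 2) p).symm ∘ c) t
        = fderiv ℝ (coordChange p (c t)) (c t) ((1 : ℝ) • X (c t)) := by
      rw [one_smul, velocity, mfderiv_extChartAt_symm_comp (hV hct) (hc t ht).differentiableAt]
      have : fderiv ℝ c t 1 = X (c t) := by rw [fderiv_apply_one_eq_deriv, (hc t ht).deriv]
      rw [this]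
    rw [hv]
    refine ⟨?_, h.isPrincipal_fst hf hct (hV hct) one_ne_zero⟩
    have e := diff_coordChange hf (hV hct) ((1 : ℝ) • X (c t))
    refine (congrArg norm e).trans ?_
    rw [one_smul]
    change ‖push (localRep f p) X (c t)‖ = 1
    rw [norm_eq_sqrt_real_inner, h.inner_fst _ hct, Real.sqrt_one]

/-- The geometric hypothesis enters here, turned into the differential equation X k₁ = 0; applied to
the swapped frame it gives Y k₂ = 0. -/
theorem IsPrincipalFrame.fderiv_geodCurv (hf : IsSmoothImmersion f)
    (hgeod : CurvatureLinesHaveConstantGeodesicCurvature f) {V : Set (E 2)}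
    {X Y : E 2 → E 2} (h : IsPrincipalFrame (localRep f p) V X Y)
    (hV : V ⊆ (extChartAt (𝓡 2) p).target) {x : E 2} (hx : x ∈ V) :
    fderiv ℝ (geodCurv (localRep f p) X Y) x (X x) = 0 := by
  refine fderiv_eq_zero_of_abs_const h.isOpen h.smooth_fst
    (h.contDiffOn_geodCurv.differentiableOn (by simp)) (fun c J hJ hJ' hcV hc s hs t ht => ?_) hx
  rw [← geodesicCurvature_integralCurve hf h.toIsFrame hV hJ hcV hc hs,
    ← geodesicCurvature_integralCurve hf h.toIsFrame hV hJ hcV hc ht]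
  exact hgeod _ J (h.isCurvatureLine hf hV hJ hJ' hcV hc) s hs t ht

theorem IsIsothermicChart.exists_isIsothermicAt (hf : IsSmoothImmersion f) {X Y : E 2 → E 2}
    {ρ : E 2 → ℝ} {J₁ J₂ : Set ℝ} {φ : OpenPartialHomeomorph (ℝ × ℝ) (E 2)}
    (h : IsIsothermicChart (localRep f p) X Y ρ J₁ J₂ φ)
    (hφ : φ.target ⊆ (extChartAt (𝓡 2) p).target) (hp : extChartAt (𝓡 2) p p ∈ φ.target) :
    ∃ ψ : PartialDiffeomorph 𝓘(ℝ, ℝ × ℝ) (𝓡 2) (ℝ × ℝ) M ∞, IsIsothermicAt f p J₁ J₂ ψ ∧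
      ∀ z, ψ z = (extChartAt (𝓡 2) p).symm (φ z) := by
  let e := φ.toPartialEquiv.trans (extChartAt (𝓡 2) p).symm
  have hsrc : e.source = φ.source := by
    rw [PartialEquiv.trans_source, PartialEquiv.symm_source]
    exact inter_eq_left.2 fun z hz => hφ (φ.map_source hz)
  have htgt : e.target = (extChartAt (𝓡 2) p).source ∩ extChartAt (𝓡 2) p ⁻¹' φ.target := by
    rw [PartialEquiv.trans_target, PartialEquiv.symm_target]; rfl
  let ψ : PartialDiffeomorph 𝓘(ℝ, ℝ × ℝ) (𝓡 2) (ℝ × ℝ) M ∞ :=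
    { toPartialEquiv := e
      open_source := by rw [hsrc]; exact φ.open_source
      open_target := by
        rw [htgt]
        exact (continuousOn_extChartAt p).isOpen_inter_preimage (isOpen_extChartAt_source p)
          φ.open_target
      contMDiffOn_toFun := by
        rw [hsrc]
        exact (contMDiffOn_extChartAt_symm p).comp (contMDiffOn_iff_contDiffOn.2 h.contDiffOn)
          fun z hz => hφ (φ.map_source hz)
      contMDiffOn_invFun := by
        rw [htgt]
        have h1 : ContMDiffOn (𝓡 2) 𝓘(ℝ, E 2) ∞ (extChartAt (𝓡 2) p)
            (extChartAt (𝓡 2) p).source := by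
          rw [extChartAt_source]; exact contMDiffOn_extChartAt
        exact (contMDiffOn_iff_contDiffOn.2 h.contDiffOn_symm).comp (h1.mono inter_subset_left)
          fun q hq => hq.2 }
  refine ⟨ψ, ⟨h.isOpen_fst, h.ordConnected_fst, h.isOpen_snd, h.ordConnected_snd,
    hsrc.trans h.source_eq, ?_, fun z hz => ?_⟩, fun z => rfl⟩
  · change p ∈ e.target
    rw [htgt]; exact ⟨mem_extChartAt_source p, hp⟩
  · rw [← h.source_eq] at hz
    have hx := φ.map_source hz
    have hx' := hφ hx
    have hρ := h.factor_pos _ hx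
    have hd : DifferentiableAt ℝ φ z :=
      (h.contDiffOn.differentiableOn (by simp)).differentiableAt (φ.open_source.mem_nhds hz)
    have c₁ : coordVec ψ z (1, 0)
        = fderiv ℝ (coordChange p (φ z)) (φ z) ((ρ (φ z))⁻¹ • X (φ z)) := by
      rw [← h.fderiv_fst z hz]; exact mfderiv_extChartAt_symm_comp hx' hd (1, 0)
    have c₂ : coordVec ψ z (0, 1)
        = fderiv ℝ (coordChange p (φ z)) (φ z) ((ρ (φ z))⁻¹ • Y (φ z)) := by
      rw [← h.fderiv_snd z hz]; exact mfderiv_extChartAt_symm_comp hx' hd (0, 1)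
    have e₁ := h.frame.inner_fst _ hx
    have e₂ := h.frame.inner_snd _ hx
    have e₁₂ := h.frame.inner_fst_snd _ hx
    unfold push at e₁ e₂ e₁₂
    rw [c₁, c₂]
    refine ⟨⟨(ρ (φ z))⁻¹, inv_pos.2 hρ, ?_, ?_, ?_⟩,
      h.frame.isPrincipal_fst hf hx hx' (inv_ne_zero hρ.ne'),
      h.frame.swap.isPrincipal_fst hf hx hx' (inv_ne_zero hρ.ne')⟩
    · refine (metric_coordChange hf hx' _ _).trans ?_
      rw [map_smul, inner_smul_left, inner_smul_right, e₁]; simp [sq]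
    · refine (metric_coordChange hf hx' _ _).trans ?_
      rw [map_smul, inner_smul_left, inner_smul_right, e₂]; simp [sq]
    · refine (metric_coordChange hf hx' _ _).trans ?_
      rw [map_smul, map_smul, inner_smul_left, inner_smul_right, e₁₂]; simp

end Parametrization

end

end Isothermic

/-! ### The theorem. -/

theorem corollary4p3 {N : ℕ} {M : Type*} [TopologicalSpace M]
    [ChartedSpace (EuclideanSpace ℝ (Fin 2)) M] [IsManifold (𝓡 2) ∞ M]
    (f : M → EuclideanSpace ℝ (Fin N)) (hf : Isothermic.IsSmoothImmersion f)
    (hflat : Isothermic.HasFlatNormalBundle f)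
    (humb : ∀ p : M, ¬ Isothermic.IsUmbilic f p)
    (hgeod : Isothermic.CurvatureLinesHaveConstantGeodesicCurvature f) (p : M) :
    Isothermic.IsInvertedProductAt f p ∨ Isothermic.IsHypSphProductAt f p := by
  have hp : extChartAt (𝓡 2) p p ∈ (extChartAt (𝓡 2) p).target := mem_extChartAt_target p
  have hU : IsOpen (extChartAt (𝓡 2) p).target := isOpen_extChartAt_target p
  obtain ⟨X₀, Y₀, h₀⟩ := Isothermic.exists_isFrame hU (Isothermic.contDiffOn_localRep hf p)
    fun x hx => Isothermic.fderiv_localRep_injective hf hx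
  obtain ⟨V, hV, hpV, X, Y, h⟩ := h₀.exists_isPrincipalFrame (hflat p) hp
    (Isothermic.not_umbilic_localRep hf hp (humb _))
  have hX : ∀ x ∈ V, _ := fun x hx => h.fderiv_geodCurv hf hgeod hV hx
  have hY : ∀ x ∈ V, _ := fun x hx => h.swap.fderiv_geodCurv hf hgeod hV hx
  obtain ⟨ρ, J₁, J₂, φ, hφ, hφV, hpφ, hρ⟩ := h.exists_isIsothermicChart hpV hX hY
  have hz := φ.map_target hpφ
  rw [hφ.source_eq] at hz
  have hρ' : (ρ ∘ φ) (φ.symm (extChartAt (𝓡 2) p p)) = 1 := by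
    rw [Function.comp_apply, φ.right_inv hpφ, hρ]
  obtain ⟨ψ, hψ, hψφ⟩ := hφ.exists_isIsothermicAt hf (hφV.trans hV) hpφ
  rcases (hφ.isSplitNet fun x hx => hX x (hφV hx)).classification hz hρ' with
    ⟨N₁, N₂, Φ, I, α, β, hα, hβ, hI, hg⟩ | ⟨m, k, c, T, S, α, β, hm, hk, hc, hα, hβ, hg⟩ |
    ⟨m, k, c, T, S, α, β, hm, hk, hc, hα, hβ, hg⟩
  · exact Or.inl ⟨J₁, J₂, ψ, hψ, N₁, N₂, Φ, I, α, β, hα, hβ, hI, fun s hs t ht => by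
      rw [hψφ, ← hg s hs t ht]; rfl⟩
  · exact Or.inr ⟨J₁, J₂, ψ, hψ, m, k, c, T, S, α, β, hm, hk, hc, hα, hβ, fun s hs t ht =>
      ⟨(hg s hs t ht).1, by rw [hψφ, ← (hg s hs t ht).2]; rfl⟩⟩
  -- The second family carries the hyperbolic curve, so the coordinates are exchanged; the order of
  -- the families is free.
  · obtain ⟨ψ', hψ', hψφ'⟩ := hφ.comp_swap.exists_isIsothermicAt hf (hφV.trans hV) hpφ
    exact Or.inr ⟨J₂, J₁, ψ', hψ', m, k, c, T, S, α, β, hm, hk, hc, hα, hβ, fun s hs t ht =>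
      ⟨(hg s hs t ht).1, by rw [hψφ', ← (hg s hs t ht).2]; rfl⟩⟩
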